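/- Let $n\ge 3$ and let $\mathfrak g=\mathbb R^n\oplus\Lambda^2\mathbb R^n$ be the vector space underlying the Poincaré or (A)dS algebra in $n$ dimensions (the Lie bracket plays no role below). Let $\mathfrak g[1]$ be the graded manifold with coordinates $\xi^a$ and $\rho^{ab}=-\rho^{ba}$ ($a,b=1,\dots,n$) of degree $1$ (hence odd), and put $$\mathcal V_{a_1\dots a_k}(\xi)=\tfrac1{(n-k)!}\,\epsilon_{a_1\dots a_kb_1\dots b_{n-k}}\,\xi^{b_1}\cdots\xi^{b_{n-k}},\qquad \omega^{\mathfrak g[1]}=\mathcal V_{abc}(\xi)\,d\xi^a\,d\rho^{bc}.$$ Let $M$ be the graded manifold of supermaps from $\mathbb R^n[1]\cong T_x[1]X$, with odd coordinates $\theta^1,\dots,\theta^n$, to $\mathfrak g[1]$ whose frame component is invertible. Writing $\psi^A$ for the coordinates $\xi^a,\rho^{ab}$ $(a<b)$, its coordinates are the components $\psi^A_{\mu_1\dots\mu_k}$ $(\mu_1<\dots<\mu_k)$, of degree $1-k$, of $\psi^A(\theta)=\sum_{\mu_1<\dots<\mu_k}\psi^A_{\mu_1\dots\mu_k}\theta^{\mu_1}\cdots\theta^{\mu_k}$.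 The degree-$0$ coordinates are $e^a_\mu$ and $\omega^{ab}_\mu$; the body of $M$ is the open set $\det(e^a_\mu)\ne0$, and functions over an open subset $U$ of the body form the algebra $\mathcal O(U)$ of polynomials in the (graded-commuting) coordinates of nonzero degree with coefficients in $C^\infty(U)$. Put $$\omega^M=\int d^n\theta\;\mathcal V_{abc}(\xi(\theta))\,d\xi^a(\theta)\,d\rho^{bc}(\theta).$$ The prolongation of a vector field $X$ on $\mathfrak g[1]$ is the vector field $\hat X$ on $M$ with $\hat X\psi^A(\theta)=X^A(\psi(\theta))$, where $X^A=X\psi^A$. (1) Let $n=4$, write $\xi^{(k)}_{a_1\dots a_{4-k}}=\mathcal V_{a_1\dots a_{4-k}}(\xi)$, and consider the vector fields on $\mathfrak g[1]$ $$X^4_a=\xi^{(4)}\tfrac{\partial}{\partial\xi^a},\quad X^3_{ab}=\xi^{(3)}_a\tfrac{\partial}{\partial\xi^b}+\xi^{(3)}_b\tfrac{\partial}{\partial\xi^a},\quad Y^4_{ab}=\xi^{(4)}\tfrac{\partial}{\partial\rho^{ab}},\quad Y^3_{abc}=\xi^{(3)}_a\tfrac{\partial}{\partial\rho^{bc}}+\xi^{(3)}_b\tfrac{\partial}{\partial\rho^{ac}},$$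 $$Y^2_{abcd}=\xi^{(2)}_{ab}\tfrac{\partial}{\partial\rho^{cd}}+\xi^{(2)}_{cb}\tfrac{\partial}{\partial\rho^{ad}}+\xi^{(2)}_{ad}\tfrac{\partial}{\partial\rho^{cb}}+\xi^{(2)}_{cd}\tfrac{\partial}{\partial\rho^{ab}}.$$ They lie in the kernel of $\omega^{\mathfrak g[1]}$ and commute (in the graded sense) with one another. For every open subset $U$ of the body of $M$, a vector field $V$ on $M$ over $U$ satisfies $i_V\omega^M=0$ if and only if it is an $\mathcal O(U)$-linear combination of the prolongations of these vector fields. (2) For every $n\ge3$, $(M,\omega^M)$ is a regular presymplectic manifold: $d\omega^M=0$ and $\omega^M$ has constant graded rank. That is, there are a subset $K$ of an index set $I$ and integers $(k_i)_{i\in I}$ such that over every open subset $U$ of the body there is an $\mathcal O(U)$-basis $(E_i)_{i\in I}$ of the vector fields on $M$, with $E_i$ homogeneous of degree $k_i$, such that $i_{E_i}\omega^M=0$ for $i\in K$, and the matrix $(i_{E_j}i_{E_i}\omega^M)_{i,j\notin K}$ is invertible over $\mathcal O(U)$. Moreover, over every such $U$ the vector fields $V$ with $i_V\omega^M=0$ are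 exactly the $\mathcal O(U)$-linear combinations of prolongations of those vector fields on $\mathfrak g[1]$ that have $\rho$-independent components and lie in the kernel of $\omega^{\mathfrak g[1]}$. -/

import Mathlib

open TopologicalSpace
open scoped TensorProduct ContDiff

noncomputable section

namespace FrameGravity

/-! ### Functions of finitely many even and odd variables -/

/-- The supercommutative algebra `C[x_i, i ∈ ev] ⊗ Λ[η_j, j ∈ od]` of polynomials in even variables
`x_i` and odd variables `η_j` with coefficients in a commutative algebra `C`. -/
def SAlg (C : Type) [CommRing C] [Algebra ℝ C] (ev od : Type) : Type :=
  C ⊗[ℝ] (MvPolynomial ev ℝ ⊗[ℝ] ExteriorAlgebra ℝ (od →₀ ℝ))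

namespace SAlg

variable {C : Type} [CommRing C] [Algebra ℝ C] {ev od ev' od' τ : Type}

instance instRing : Ring (SAlg C ev od) :=
  inferInstanceAs (Ring (C ⊗[ℝ] (MvPolynomial ev ℝ ⊗[ℝ] ExteriorAlgebra ℝ (od →₀ ℝ))))

instance instAlgebra : Algebra ℝ (SAlg C ev od) :=
  inferInstanceAs (Algebra ℝ (C ⊗[ℝ] (MvPolynomial ev ℝ ⊗[ℝ] ExteriorAlgebra ℝ (od →₀ ℝ))))

/-- The product of a coefficient, a polynomial and an element of the exterior algebra. -/
def mk (f : C) (p : MvPolynomial ev ℝ) (u : ExteriorAlgebra ℝ (od →₀ ℝ)) : SAlg C ev od :=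
  f ⊗ₜ[ℝ] (p ⊗ₜ[ℝ] u)

theorem mk_mul_mk (f g : C) (p q : MvPolynomial ev ℝ) (u v : ExteriorAlgebra ℝ (od →₀ ℝ)) :
    mk f p u * mk g q v = mk (f * g) (p * q) (u * v) := by
  refine (Algebra.TensorProduct.tmul_mul_tmul f g (p ⊗ₜ[ℝ] u) (q ⊗ₜ[ℝ] v)).trans ?_
  rw [Algebra.TensorProduct.tmul_mul_tmul]
  rfl

theorem mk_add (f : C) (p : MvPolynomial ev ℝ) (u v : ExteriorAlgebra ℝ (od →₀ ℝ)) :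
    mk f p (u + v) = mk f p u + mk f p v :=
  (congrArg (fun t => f ⊗ₜ[ℝ] t) (TensorProduct.tmul_add p u v)).trans
    (TensorProduct.tmul_add f _ _)

theorem mk_zero (f : C) (p : MvPolynomial ev ℝ) :
    mk f p (0 : ExteriorAlgebra ℝ (od →₀ ℝ)) = 0 :=
  (congrArg (fun t => f ⊗ₜ[ℝ] t) (TensorProduct.tmul_zero _ p)).trans (TensorProduct.tmul_zero _ f)

/-- A coefficient `f`, regarded as a function. -/
def ofCoeff (ev od : Type) (f : C) : SAlg C ev od := mk f 1 1

/-- An element of the exterior algebra, regarded as a function. -/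
def ofExt (C : Type) [CommRing C] [Algebra ℝ C] (ev : Type) {od : Type}
    (u : ExteriorAlgebra ℝ (od →₀ ℝ)) : SAlg C ev od := mk 1 1 u

/-- The even variable `x_i`. -/
def even (C : Type) [CommRing C] [Algebra ℝ C] (od : Type) {ev : Type} (i : ev) : SAlg C ev od :=
  mk 1 (MvPolynomial.X i) 1

/-- The odd variable `η_j`. -/
def odd (C : Type) [CommRing C] [Algebra ℝ C] (ev : Type) {od : Type} (j : od) : SAlg C ev od :=
  ofExt C ev (ExteriorAlgebra.ι ℝ (Finsupp.single j 1))

/-- Inclusion of an algebra with fewer variables. -/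
def incl (f : ev → ev') (g : od → od') : SAlg C ev od →ₐ[ℝ] SAlg C ev' od' :=
  Algebra.TensorProduct.map (AlgHom.id ℝ C) (Algebra.TensorProduct.map (MvPolynomial.rename f)
    (ExteriorAlgebra.map (Finsupp.lmapDomain ℝ ℝ g)))

theorem incl_mk (f : ev → ev') (g : od → od') (h : C) (p : MvPolynomial ev ℝ)
    (u : ExteriorAlgebra ℝ (od →₀ ℝ)) :
    incl f g (mk h p u) = mk h (MvPolynomial.rename f p)
      (ExteriorAlgebra.map (Finsupp.lmapDomain ℝ ℝ g) u) := rfl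

/-- A linear operator on the coefficients, extended to all functions. -/
def onCoeff (D : C →ₗ[ℝ] C) : SAlg C ev od →ₗ[ℝ] SAlg C ev od :=
  LinearMap.rTensor _ D

/-- The derivative `∂/∂x_i` with respect to an even variable. -/
def dEven (i : ev) : SAlg C ev od →ₗ[ℝ] SAlg C ev od :=
  LinearMap.lTensor _ (LinearMap.rTensor _ (MvPolynomial.pderiv i).toLinearMap)

/-- The left derivative `∂/∂η_j` with respect to an odd variable. -/
def dOdd (j : od) : SAlg C ev od →ₗ[ℝ] SAlg C ev od :=
  LinearMap.lTensor _ (LinearMap.lTensor _ (CliffordAlgebra.contractLeft (Finsupp.lapply j)))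

/-- The right derivative with respect to an odd variable. -/
def dOddRight (j : od) : SAlg C ev od →ₗ[ℝ] SAlg C ev od :=
  LinearMap.lTensor _ (LinearMap.lTensor _
    (CliffordAlgebra.contractRight.flip (Finsupp.lapply j)))

/-- Setting the odd variables `θ_μ`, `μ ∈ τ`, equal to zero. -/
def dropTheta : SAlg C ev (od ⊕ τ) →ₐ[ℝ] SAlg C ev od :=
  Algebra.TensorProduct.map (AlgHom.id ℝ C) (Algebra.TensorProduct.map (AlgHom.id ℝ _)
    (ExteriorAlgebra.map (Finsupp.lcomapDomain Sum.inl Sum.inl_injective)))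

/-- The monomial `θ^S = θ^{μ₁} ⋯ θ^{μₖ}` for `S = {μ₁ < ⋯ < μₖ}`. -/
def thetaMonomial (C : Type) [CommRing C] [Algebra ℝ C] (ev od : Type) {n : ℕ}
    (S : Finset (Fin n)) : SAlg C ev (od ⊕ Fin n) :=
  ofExt C ev (S.sort.map fun μ => ExteriorAlgebra.ι ℝ (Finsupp.single (Sum.inr μ) 1)).prod

/-- The coefficient `F_S` in the expansion `F = ∑_S F_S θ^S`. -/
def thetaCoeff {n : ℕ} (S : Finset (Fin n)) (F : SAlg C ev (od ⊕ Fin n)) : SAlg C ev od :=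
  dropTheta (S.sort.foldr (fun μ G => dOddRight (Sum.inr μ) G) F)

/-- The Berezin integral `∫ dⁿθ F`: the coefficient of `θ^1 ⋯ θ^n`. -/
def berezin {n : ℕ} (F : SAlg C ev (od ⊕ Fin n)) : SAlg C ev od := thetaCoeff Finset.univ F

/-- The elements that are odd for the `ℤ/2`-grading. -/
def oddPart (C : Type) [CommRing C] [Algebra ℝ C] (ev od : Type) : Submodule ℝ (SAlg C ev od) :=
  Submodule.span ℝ {x | ∃ (f : C) (p : MvPolynomial ev ℝ) (u : ExteriorAlgebra ℝ (od →₀ ℝ)),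
    u ∈ CliffordAlgebra.evenOdd (0 : QuadraticForm ℝ (od →₀ ℝ)) 1 ∧
      x = mk f p u}

theorem mul_add_mul_eq_zero_of_odd {x y : SAlg C ev od} (hx : x ∈ oddPart C ev od)
    (hy : y ∈ oddPart C ev od) : x * y + y * x = 0 := by
  induction hx, hy using Submodule.span_induction₂ with
  | mem_mem x y hx hy =>
    obtain ⟨f, p, u, hu, rfl⟩ := hx
    obtain ⟨g, q, v, hv, rfl⟩ := hy
    have h := CliffordAlgebra.map_mul_map_eq_neg_of_isOrtho_of_mem_evenOdd_one
      (QuadraticMap.Isometry.id (0 : QuadraticForm ℝ (od →₀ ℝ)))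
      (QuadraticMap.Isometry.id (0 : QuadraticForm ℝ (od →₀ ℝ)))
      (fun x y => by simp [QuadraticMap.isOrtho_def]) u v hu hv
    simp only [CliffordAlgebra.map_id, AlgHom.id_apply] at h
    rw [mk_mul_mk, mk_mul_mk, mul_comm g f, mul_comm q p, ← mk_add, h, neg_mul, neg_add_cancel,
      mk_zero]
  | zero_left y hy => simp
  | zero_right x hx => simp
  | add_left x y z hx hy hz h₁ h₂ =>
    rw [add_mul, mul_add, add_add_add_comm, h₁, h₂, add_zero]
  | add_right x y z hx hy hz h₁ h₂ =>
    rw [add_mul, mul_add, add_add_add_comm, h₁, h₂, add_zero]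
  | smul_left r x y hx hy h => rw [smul_mul_assoc, mul_smul_comm, ← smul_add, h, smul_zero]
  | smul_right r x y hx hy h => rw [smul_mul_assoc, mul_smul_comm, ← smul_add, h, smul_zero]

theorem mul_self_eq_zero_of_odd {x : SAlg C ev od} (hx : x ∈ oddPart C ev od) : x * x = 0 := by
  have h := mul_add_mul_eq_zero_of_odd hx hx
  rw [← two_smul ℝ (x * x)] at h
  exact (smul_eq_zero.mp h).resolve_left two_ne_zero

theorem prod_theta_mem (l : List τ) :
    (l.map fun μ => ExteriorAlgebra.ι ℝ (Finsupp.single (Sum.inr μ : od ⊕ τ) (1 : ℝ))).prod ∈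
      CliffordAlgebra.evenOdd (0 : QuadraticForm ℝ (od ⊕ τ →₀ ℝ)) (l.length : ZMod 2) := by
  induction l with
  | nil => simpa using CliffordAlgebra.one_le_evenOdd_zero _ (Submodule.one_le.mp le_rfl)
  | cons a l ih =>
    rw [List.map_cons, List.prod_cons, List.length_cons, Nat.cast_add, add_comm, Nat.cast_one]
    exact SetLike.mul_mem_graded (CliffordAlgebra.ι_mem_evenOdd_one _ _) ih

theorem iota_mul_mem (v : od →₀ ℝ) {u : ExteriorAlgebra ℝ (od →₀ ℝ)}
    (hu : u ∈ CliffordAlgebra.evenOdd (0 : QuadraticForm ℝ (od →₀ ℝ)) 0) :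
    ExteriorAlgebra.ι ℝ v * u ∈ CliffordAlgebra.evenOdd (0 : QuadraticForm ℝ (od →₀ ℝ)) 1 := by
  have h := SetLike.mul_mem_graded
    (CliffordAlgebra.ι_mem_evenOdd_one (0 : QuadraticForm ℝ (od →₀ ℝ)) v) hu
  rwa [add_zero] at h

end SAlg

/-! ### The target `𝔤[1]` -/

/-- Indices of the coordinates on `𝔤[1]`, where `𝔤 = ℝⁿ ⊕ Λ²ℝⁿ` as a vector space: `inl a` stands
for `ξ^a` and `inr (a, b)` with `a < b` for `ρ^{ab}`. All these coordinates are odd, of degree 1. -/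
abbrev TIdx (n : ℕ) : Type := Fin n ⊕ {p : Fin n × Fin n // p.1 < p.2}

/-- Given a quantity with components labelled by the coordinates of `𝔤[1]`, its components
labelled by `ρ^{ab}` for arbitrary `a, b`, where `ρ^{ba} = -ρ^{ab}`. -/
def rhoComp {n : ℕ} {G : Type} [AddGroup G] (f : TIdx n → G) (a b : Fin n) : G :=
  if h : a < b then f (Sum.inr ⟨(a, b), h⟩)
  else if h : b < a then -f (Sum.inr ⟨(b, a), h⟩) else 0

/-- Functions on `𝔤[1]`. -/
abbrev TFun (n : ℕ) : Type := ExteriorAlgebra ℝ (TIdx n →₀ ℝ)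

/-- The coordinate function `ψ^A` on `𝔤[1]`. -/
def tCoord {n : ℕ} (A : TIdx n) : TFun n := ExteriorAlgebra.ι ℝ (Finsupp.single A 1)

/-- The coordinate function `ξ^a`. -/
def xi {n : ℕ} (a : Fin n) : TFun n := tCoord (Sum.inl a)

/-- The Levi-Civita symbol `ε_{a₁ … aₙ}`, for a list of `n` indices. -/
def eps {n : ℕ} (l : List (Fin n)) : ℝ :=
  Matrix.det (Matrix.of fun i j : Fin n => if l[(i : ℕ)]? = some j then (1 : ℝ) else 0)

/-- `𝒱_{a₁ … aₖ}(ξ) = 1/(n-k)! ε_{a₁ … aₖ b₁ … b_{n-k}} ξ^{b₁} ⋯ ξ^{b_{n-k}}`, for a list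
`[a₁, …, aₖ]` of at most `n` indices. -/
def calV {n : ℕ} (l : List (Fin n)) : TFun n :=
  (1 / (Nat.factorial (n - l.length) : ℝ)) • ∑ b : Fin (n - l.length) → Fin n,
    eps (l ++ List.ofFn b) • (List.ofFn fun i => xi (b i)).prod

/-- Vector fields `X = ∑_A X^A ∂/∂ψ^A` on `𝔤[1]`, given by their components `X^A`. -/
abbrev TVec (n : ℕ) : Type := TIdx n → TFun n

/-- The action of a vector field on functions. -/
def TVec.apply {n : ℕ} (X : TVec n) (f : TFun n) : TFun n :=
  ∑ A, X A * CliffordAlgebra.contractLeft (Finsupp.lapply A) f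

/-- The vector field `f ∂/∂ξ^a`. -/
def ddXi {n : ℕ} (f : TFun n) (a : Fin n) : TVec n := Pi.single (Sum.inl a) f

/-- The vector field `f ∂/∂ρ^{ab}`, antisymmetric in `a, b`. -/
def ddRho {n : ℕ} (f : TFun n) (a b : Fin n) : TVec n := rhoComp (fun A => Pi.single A f) a b

/-- Differential forms on `𝔤[1]`. Since the `ψ^A` are odd, their differentials are even. -/
abbrev TForm (n : ℕ) : Type := SAlg ℝ (TIdx n) (TIdx n)

/-- The differential `dψ^A`. -/
def tD {n : ℕ} (A : TIdx n) : TForm n := SAlg.even ℝ (TIdx n) A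

/-- The presymplectic form `𝒱_{abc}(ξ) dξ^a dρ^{bc}` on `𝔤[1]`. -/
def omegaT (n : ℕ) : TForm n :=
  ∑ a : Fin n, ∑ b : Fin n, ∑ c : Fin n,
    SAlg.ofExt ℝ (TIdx n) (calV [a, b, c]) * tD (Sum.inl a) * rhoComp tD b c

/-- The contraction `i_X α`; it is determined by `i_X dψ^A = X^A`. -/
def tIota {n : ℕ} (X : TVec n) (α : TForm n) : TForm n :=
  ∑ A, SAlg.ofExt ℝ (TIdx n) (X A) * SAlg.dEven A α

/-- The vector fields on `𝔤[1]` whose components do not depend on `ρ`. -/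
def IsRhoIndependent {n : ℕ} (X : TVec n) : Prop :=
  ∀ A, X A ∈ Algebra.adjoin ℝ (Set.range (xi : Fin n → TFun n))

/-- Labels of the explicit vector fields on `𝔤[1]` for `n = 4`. -/
inductive KerIdx : Type
  | X4 (a : Fin 4)
  | X3 (a b : Fin 4)
  | Y4 (a b : Fin 4)
  | Y3 (a b c : Fin 4)
  | Y2 (a b c d : Fin 4)

/-- The explicit vector fields, where `ξ^{(k)}_{a₁ … a_{4-k}} = 𝒱_{a₁ … a_{4-k}}(ξ)`. -/
def kerField : KerIdx → TVec 4
  | .X4 a => ddXi (calV []) a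
  | .X3 a b => ddXi (calV [a]) b + ddXi (calV [b]) a
  | .Y4 a b => ddRho (calV []) a b
  | .Y3 a b c => ddRho (calV [a]) b c + ddRho (calV [b]) a c
  | .Y2 a b c d => ddRho (calV [a, b]) c d + ddRho (calV [c, b]) a d
      + ddRho (calV [a, d]) c b + ddRho (calV [c, d]) a b

/-- The degree of the explicit vector fields (`k - 1` for components of degree `k` in `ξ`). -/
def kerDeg : KerIdx → ℕ
  | .X4 _ => 3
  | .X3 _ _ => 2
  | .Y4 _ _ => 3
  | .Y3 _ _ _ => 2
  | .Y2 _ _ _ _ => 1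

/-! ### The graded manifold `M` of supermaps -/

/-- Coordinates on the space of supermaps: `(A, S)` with `S = {μ₁ < ⋯ < μₖ}` stands for the
component `ψ^A_{μ₁ … μₖ}` in `ψ^A(θ) = ∑_S ψ^A_S θ^S`. -/
abbrev Coord (n : ℕ) : Type := TIdx n × Finset (Fin n)

/-- The (ghost) degree `1 - k` of `ψ^A_{μ₁ … μₖ}`; the parity is the degree modulo 2. -/
def Coord.deg {n : ℕ} (c : Coord n) : ℤ := 1 - c.2.card

/-- Coordinates of degree `0`, i.e. `e^a_μ` and `ω^{ab}_μ`. -/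
abbrev BodyIdx (n : ℕ) : Type := {c : Coord n // c.2.card = 1}

/-- Even coordinates of nonzero degree. -/
abbrev EvIdx (n : ℕ) : Type := {c : Coord n // Odd c.2.card ∧ c.2.card ≠ 1}

/-- Odd coordinates. -/
abbrev OdIdx (n : ℕ) : Type := {c : Coord n // Even c.2.card}

/-- All even coordinates; their differentials are odd. -/
abbrev EvIdxAll (n : ℕ) : Type := {c : Coord n // Odd c.2.card}

/-- The space in which the body of `M` is an open subset. -/
abbrev BodySpace (n : ℕ) : Type := BodyIdx n → ℝ

/-- The frame matrix `e^a_μ`. -/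
def frame {n : ℕ} (x : BodySpace n) : Matrix (Fin n) (Fin n) ℝ :=
  Matrix.of fun a μ => x ⟨(Sum.inl a, {μ}), Finset.card_singleton μ⟩

/-- The body of `M`: the frame is invertible, the connection `ω^{ab}_μ` is arbitrary. -/
def body (n : ℕ) : Opens (BodySpace n) where
  carrier := {x | IsUnit (frame x).det}
  is_open' := by
    have h : Continuous fun x : BodySpace n => (frame x).det :=
      Continuous.matrix_det (continuous_matrix fun a μ => continuous_apply _)
    have h' : {x : BodySpace n | IsUnit (frame x).det} = (fun x => (frame x).det) ⁻¹' {0}ᶜ := by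
      ext x; simp
    rw [h']
    exact isOpen_compl_singleton.preimage h

/-- Extension by zero of a function on `U`. -/
def ext0 {n : ℕ} {U : Opens (BodySpace n)} (f : U → ℝ) : BodySpace n → ℝ :=
  Function.extend Subtype.val f 0

theorem ext0_apply {n : ℕ} {U : Opens (BodySpace n)} (f : U → ℝ) {x : BodySpace n} (hx : x ∈ U) :
    ext0 f x = f ⟨x, hx⟩ :=
  Subtype.val_injective.extend_apply f 0 ⟨x, hx⟩

/-- The algebra of smooth real functions on an open set `U`. -/
def Smooth {n : ℕ} (U : Opens (BodySpace n)) : Subalgebra ℝ (U → ℝ) where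
  carrier := {f | ContDiffOn ℝ ∞ (ext0 f) U}
  mul_mem' {f g} hf hg := (ContDiffOn.mul hf hg).congr fun x hx => by
    simp [ext0_apply _ hx]
  add_mem' {f g} hf hg := (ContDiffOn.add hf hg).congr fun x hx => by
    simp [ext0_apply _ hx]
  algebraMap_mem' r := (contDiffOn_const (c := r)).congr fun x hx => by
    simp [ext0_apply _ hx]

/-- The restriction to `U` of a coordinate of degree `0`. -/
def bodyCoord {n : ℕ} (U : Opens (BodySpace n)) (b : BodyIdx n) : Smooth U :=
  ⟨fun x => x.1 b, ((contDiff_apply ℝ ℝ b).contDiffOn (s := (U : Set (BodySpace n)))).congr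
    fun x hx => by simp [ext0_apply _ hx]⟩

theorem ext0_differentiableAt {n : ℕ} {U : Opens (BodySpace n)} (f : Smooth U)
    {x : BodySpace n} (hx : x ∈ U) : DifferentiableAt ℝ (ext0 f.1) x :=
  (ContDiffOn.differentiableOn f.2 (by simp)).differentiableAt (U.isOpen.mem_nhds hx)

/-- The partial derivative of a smooth function with respect to a coordinate of degree `0`. -/
def bodyDeriv {n : ℕ} {U : Opens (BodySpace n)} (b : BodyIdx n) : Smooth U →ₗ[ℝ] Smooth U where
  toFun f := ⟨fun x => fderiv ℝ (ext0 f.1) x.1 (Pi.single b 1),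
    ((ContDiffOn.fderiv_of_isOpen (m := ∞) f.2 U.isOpen (by simp)).clm_apply
      (contDiffOn_const (c := (Pi.single b 1 : BodySpace n)))).congr fun x hx => by simp [ext0_apply _ hx]⟩
  map_add' f g := by
    ext x
    have h : ext0 (f + g).1 = ext0 f.1 + ext0 g.1 := by
      simpa [ext0] using Function.extend_add (Subtype.val : U → BodySpace n) f.1 g.1 0 0
    simp only [h]
    rw [fderiv_add (ext0_differentiableAt f x.2) (ext0_differentiableAt g x.2)]
    rfl
  map_smul' r f := by
    ext x
    have h : ext0 (r • f).1 = r • ext0 f.1 := by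
      simpa [ext0] using Function.extend_smul r (Subtype.val : U → BodySpace n) f.1 0
    simp only [h]
    rw [fderiv_const_smul (ext0_differentiableAt f x.2)]
    rfl

variable {n : ℕ}

/-- Functions on `M` over an open subset `U` of the body: polynomials in the coordinates of nonzero
degree (the even ones commute, the odd ones anticommute) with smooth coefficients. As all
coordinates of positive degree are odd, hence nilpotent, a homogeneous formal power series
in the coordinates of nonzero degree is automatically of this form. -/
abbrev Fn (U : Opens (BodySpace n)) : Type := SAlg (Smooth U) (EvIdx n) (OdIdx n)

/-- Functions of a point of `M` and of `θ^1, …, θ^n`. -/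
abbrev FnTheta (U : Opens (BodySpace n)) : Type := SAlg (Smooth U) (EvIdx n) (OdIdx n ⊕ Fin n)

/-- Differential forms on `M`: functions of the coordinates and their differentials, the
differential of a coordinate having the opposite parity. -/
abbrev Form (U : Opens (BodySpace n)) : Type :=
  SAlg (Smooth U) (EvIdx n ⊕ OdIdx n) (OdIdx n ⊕ EvIdxAll n)

/-- Differential forms on `M` depending on `θ^1, …, θ^n`. -/
abbrev FormTheta (U : Opens (BodySpace n)) : Type :=
  SAlg (Smooth U) (EvIdx n ⊕ OdIdx n) ((OdIdx n ⊕ EvIdxAll n) ⊕ Fin n)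

/-- Functions as forms of degree zero. -/
def Fn.toForm (U : Opens (BodySpace n)) : Fn U →ₐ[ℝ] Form U := SAlg.incl Sum.inl Sum.inl

/-- Functions depending on `θ` as forms of degree zero depending on `θ`. -/
def FnTheta.toForm (U : Opens (BodySpace n)) : FnTheta U →ₐ[ℝ] FormTheta U :=
  SAlg.incl Sum.inl (Sum.map Sum.inl id)

/-- The coordinate functions on `M`. -/
def coordFn (U : Opens (BodySpace n)) (c : Coord n) : Fn U :=
  if h₁ : c.2.card = 1 then SAlg.ofCoeff _ _ (bodyCoord U ⟨c, h₁⟩)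
  else if h₂ : Odd c.2.card then SAlg.even _ _ ⟨c, h₂, h₁⟩
  else SAlg.odd _ _ ⟨c, Nat.not_odd_iff_even.mp h₂⟩

/-- The differentials of the coordinate functions on `M`. -/
def dCoord (U : Opens (BodySpace n)) (c : Coord n) : Form U :=
  if h : Odd c.2.card then SAlg.odd _ _ (Sum.inr ⟨c, h⟩)
  else SAlg.even _ _ (Sum.inr ⟨c, Nat.not_odd_iff_even.mp h⟩)

/-- The (left) partial derivative of the coefficients of a form with respect to a coordinate. -/
def partialCoord {U : Opens (BodySpace n)} (c : Coord n) : Form U →ₗ[ℝ] Form U :=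
  if h₁ : c.2.card = 1 then SAlg.onCoeff (bodyDeriv ⟨c, h₁⟩)
  else if h₂ : Odd c.2.card then SAlg.dEven (Sum.inl ⟨c, h₂, h₁⟩)
  else SAlg.dOdd (Sum.inl ⟨c, Nat.not_odd_iff_even.mp h₂⟩)

/-- The (left) partial derivative of a form with respect to the differential of a coordinate. -/
def partialD {U : Opens (BodySpace n)} (c : Coord n) : Form U →ₗ[ℝ] Form U :=
  if h : Odd c.2.card then SAlg.dOdd (Sum.inr ⟨c, h⟩)
  else SAlg.dEven (Sum.inr ⟨c, Nat.not_odd_iff_even.mp h⟩)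

/-- The de Rham differential `d = ∑ dz^c ∂/∂z^c`. -/
def deRham {U : Opens (BodySpace n)} (α : Form U) : Form U :=
  ∑ c : Coord n, dCoord U c * partialCoord c α

/-- Vector fields `V = ∑ V^c ∂/∂z^c` on `M` over `U`, given by their components; this is a left
module over the functions. -/
abbrev Vec (U : Opens (BodySpace n)) : Type := Coord n → Fn U

/-- The contraction `i_V α`; it is determined by `i_V dz^c = V^c`. -/
def iota {U : Opens (BodySpace n)} (V : Vec U) (α : Form U) : Form U :=
  ∑ c : Coord n, Fn.toForm U (V c) * partialD c α

/-- The Euler vector field, which multiplies a function of degree `k` by `k`. -/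
def euler (U : Opens (BodySpace n)) : Vec U := fun c => c.deg • coordFn U c

/-- `f` is a homogeneous function of degree `k`. -/
def Fn.IsHomogeneous {U : Opens (BodySpace n)} (f : Fn U) (k : ℤ) : Prop :=
  iota (euler U) (deRham (Fn.toForm U f)) = k • Fn.toForm U f

/-- `V` is a homogeneous vector field of degree `k`. -/
def Vec.IsHomogeneous {U : Opens (BodySpace n)} (V : Vec U) (k : ℤ) : Prop :=
  ∀ c, Fn.IsHomogeneous (V c) (k + c.deg)

/-- The generating function `ψ^A(θ) = ∑_S ψ^A_S θ^S`. -/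
def psiTheta (U : Opens (BodySpace n)) (A : TIdx n) : FnTheta U :=
  ∑ S : Finset (Fin n), SAlg.incl id Sum.inl (coordFn U (A, S)) * SAlg.thetaMonomial _ _ _ S

/-- The generating function `dψ^A(θ) = ∑_S dψ^A_S θ^S`. -/
def dPsiTheta (U : Opens (BodySpace n)) (A : TIdx n) : FormTheta U :=
  ∑ S : Finset (Fin n), SAlg.incl id Sum.inl (dCoord U (A, S)) * SAlg.thetaMonomial _ _ _ S

theorem psiTheta_mem_oddPart (U : Opens (BodySpace n)) (A : TIdx n) :
    psiTheta U A ∈ SAlg.oddPart (Smooth U) (EvIdx n) (OdIdx n ⊕ Fin n) := by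
  refine Submodule.sum_mem _ fun S _ => Submodule.subset_span ?_
  have hS := SAlg.prod_theta_mem (od := OdIdx n) S.sort
  rw [Finset.length_sort] at hS
  unfold coordFn SAlg.thetaMonomial SAlg.ofExt
  split_ifs with h₁ h₂
  · refine ⟨_, _, _, ?_, by rw [SAlg.ofCoeff, SAlg.incl_mk, SAlg.mk_mul_mk]⟩
    have h₃ : S.card = 1 := h₁
    rw [h₃] at hS
    simpa using hS
  · refine ⟨_, _, _, ?_, by rw [SAlg.even, SAlg.incl_mk, SAlg.mk_mul_mk]⟩
    rw [ZMod.natCast_eq_one_iff_odd.mpr h₂] at hS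
    simpa using hS
  · refine ⟨_, _, _, ?_, by rw [SAlg.odd, SAlg.ofExt, SAlg.incl_mk, SAlg.mk_mul_mk]⟩
    rw [ZMod.natCast_eq_zero_iff_even.mpr (Nat.not_odd_iff_even.mp h₂)] at hS
    rw [ExteriorAlgebra.map_apply_ι]
    exact SAlg.iota_mul_mem _ hS

/-- The substitution `F(ψ) ↦ F(ψ(θ))`. -/
def subst (U : Opens (BodySpace n)) : TFun n →ₐ[ℝ] FnTheta U :=
  ExteriorAlgebra.lift ℝ ⟨Finsupp.linearCombination ℝ (psiTheta U), fun m =>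
    SAlg.mul_self_eq_zero_of_odd <| by
      rw [Finsupp.linearCombination_apply]
      exact Submodule.sum_mem _ fun A _ => Submodule.smul_mem _ _ (psiTheta_mem_oddPart U A)⟩

/-- The prolongation `X̂` of a vector field `X` on `𝔤[1]`: the vector field on `M` with
`X̂ ψ^A(θ) = X^A(ψ(θ))`. -/
def prolong (U : Opens (BodySpace n)) (X : TVec n) : Vec U :=
  fun c => SAlg.thetaCoeff c.2 (subst U (X c.1))

/-- The 2-form `ω^M = ∫ dⁿθ 𝒱_{abc}(ξ(θ)) dξ^a(θ) dρ^{bc}(θ)` on `M` over `U`. -/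
def omegaM (U : Opens (BodySpace n)) : Form U :=
  SAlg.berezin (∑ a : Fin n, ∑ b : Fin n, ∑ c : Fin n,
    FnTheta.toForm U (subst U (calV [a, b, c])) * dPsiTheta U (Sum.inl a) * rhoComp (dPsiTheta U) b c)

/-- A family of 2-forms on `M` is a regular presymplectic structure: it is closed, and its kernel
has constant (graded) rank. The latter means that there are homogeneous frames `E`, with the same
degrees everywhere, such that the `E i` with `i ∈ K` lie in the kernel, while the form is
nondegenerate (its matrix is invertible) on the span of the remaining `E i`. -/
def IsRegularPresymplectic (σ : ∀ U : Opens (BodySpace n), Form U) : Prop :=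
  (∀ U ≤ body n, deRham (σ U) = 0) ∧
  ∃ (K : Finset (Coord n)) (k : Coord n → ℤ), ∀ U ≤ body n,
    ∃ E : Module.Basis (Coord n) (Fn U) (Vec U),
      (∀ i, Vec.IsHomogeneous (E i) (k i)) ∧
      (∀ i ∈ K, iota (E i) (σ U) = 0) ∧
      ∃ G H : Matrix {i // i ∉ K} {i // i ∉ K} (Fn U), G * H = 1 ∧ H * G = 1 ∧
        ∀ i j, Fn.toForm U (G i j) = iota (E j) (iota (E i) (σ U))

end FrameGravity

end

/-! Both two-forms are governed by the same symmetric matrix S_{AB} (`sCoeff`) of polynomials in ξ.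
Since dψ^A(θ) is even, contracting ω^M with V gives ∫dⁿθ Σ_B (Σ_A V^A(θ) S_{AB}(ξ(θ))) dψ^B(θ)
(`iota_omegaM`). The Berezin pairing is nondegenerate, so V is in the kernel iff Σ_A V^A(θ)
S_{AB}(ξ(θ)) = 0 for every B (`iota_omegaM_eq_zero_iff`).

The invertible frame enters at one point. It allows θ^μ to be recovered, up to order two in θ, from
ξ(θ) = ξ_∅ + e_μ θ^μ + …; by descending induction on degree, the monomials ξ(θ)^S form a basis of
the functions of θ over the functions on M (`exists_eq_sum_mono_xi`, `eq_zero_of_sum_mono_xi`). In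
this basis the components of any vector field on M look like those of a ρ-independent vector field
on 𝔤[1], with coefficients in 𝒪(U) instead of ℝ, and the kernel equation has constant real
coefficients. It is thus solved by linear algebra over ℝ.

That linear algebra is graded: contraction raises the degree in ξ by n - 3. A homogeneous real basis
adapted to its kernel exists (`exists_adapted_basis`), and its prolongations are an 𝒪(U)-basis of
the vector fields (`exists_prolong_basis`). Those indexed by K span the kernel. On the others the
Gram matrix has a one-sided inverse, built from functionals dual to their contractions and from the
Berezin dual of the ξ(θ)^S. It is a two-sided inverse because invertibility may be tested modulo the
odd variables, where the ring is commutative and the error is nilpotent (`isUnit_of_map_red_mul`).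

Closedness comes from 𝒱_{abc} being a third derivative of 𝒱: odd derivatives anticommute, whereas
the dψ^A(θ) commute (`deRham_omegaM`).

For n = 4, 𝒱_{abc} is linear in ξ, and the kernel equations become X^a ξ^d = X^d ξ^a and the
vanishing of the cyclic sum of X^{bc} ξ^d (`contr_eq_zero_iff_four`). They force X^a to be
annihilated by products of two ξ's and X^{bc} by products of three, so both expand in the 𝒱 with at
most one, respectively two, indices. The coefficient tensors inherit symmetry, cyclicity or the
symmetries of the Riemann tensor, which are exactly dual to the symmetrisations in X³, Y³ and Y²
(`sum_symm_mem`, `sum_cyclic_mem`, `sum_riemann_mem`). -/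

namespace FrameGravity

/-! ### Monomials in anticommuting elements -/

section Anticommuting

variable {R ι : Type*} [Ring R]

/-- A family of elements that anticommute and have square zero. -/
structure Anticomm (g : ι → R) : Prop where
  sq : ∀ i, g i * g i = 0
  anti : ∀ i j, g i * g j = -(g j * g i)

/-- The ordered monomial in a family of ring elements. -/
noncomputable def mono [LinearOrder ι] (g : ι → R) (S : Finset ι) : R := (S.sort.map g).prod

namespace Anticomm

variable {g : ι → R}

/-- Each adjacent transposition costs a sign. The sign is left undetermined here and below, since
spans and invertibility do not depend on it. -/
theorem prod_perm (hg : Anticomm g) {l l' : List ι} (h : l.Perm l') :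
    (l.map g).prod = (l'.map g).prod ∨ (l.map g).prod = -(l'.map g).prod := by
  induction h with
  | nil => simp
  | cons a _ ih =>
    rcases ih with ih | ih
    · left; simp [ih]
    · right; simp [ih]
  | swap a b l =>
    right
    simp only [List.map_cons, List.prod_cons, ← mul_assoc]
    rw [hg.anti b a, neg_mul]
  | trans _ _ ih ih' =>
    rcases ih with ih | ih <;> rcases ih' with ih' | ih' <;> simp [ih, ih']

/-- A permutation brings two equal factors to the front, where their product is zero. -/
theorem prod_eq_zero (hg : Anticomm g) {l : List ι} (h : ¬ l.Nodup) : (l.map g).prod = 0 := by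
  obtain ⟨a, ha⟩ : ∃ a, List.Duplicate a l := by
    by_contra h'
    push Not at h'
    exact h (List.nodup_iff_forall_not_duplicate.mpr h')
  have h2 : List.Sublist [a, a] l := List.duplicate_iff_sublist.mp ha
  obtain ⟨l', hl'⟩ := h2.exists_perm_append
  rcases hg.prod_perm hl' with h | h <;> rw [h] <;> simp [← mul_assoc, hg.sq]

variable [LinearOrder ι]

theorem prod_eq_mono (hg : Anticomm g) {l : List ι} (h : l.Nodup) :
    (l.map g).prod = mono g l.toFinset ∨ (l.map g).prod = -mono g l.toFinset :=
  hg.prod_perm ((Finset.sort_perm_toList _ _).trans (List.toFinset_toList h)).symm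

theorem mono_mul_mono (hg : Anticomm g) (S T : Finset ι) :
    (¬ Disjoint S T ∧ mono g S * mono g T = 0) ∨
    (Disjoint S T ∧ (mono g S * mono g T = mono g (S ∪ T) ∨
      mono g S * mono g T = -mono g (S ∪ T))) := by
  have h : mono g S * mono g T = ((S.sort ++ T.sort).map g).prod := by
    simp [mono]
  have hd : (S.sort ++ T.sort).Nodup ↔ Disjoint S T := by
    rw [List.nodup_append', Finset.disjoint_left]
    simp [List.Disjoint]
  by_cases hST : Disjoint S T
  · refine Or.inr ⟨hST, ?_⟩
    have := hg.prod_eq_mono (hd.mpr hST)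
    rw [h]
    simpa using this
  · exact Or.inl ⟨hST, h ▸ hg.prod_eq_zero (fun h' => hST (hd.mp h'))⟩

end Anticomm

theorem mono_empty [LinearOrder ι] (g : ι → R) : mono g ∅ = 1 := by simp [mono]

theorem mono_singleton [LinearOrder ι] (g : ι → R) (i : ι) : mono g {i} = g i := by simp [mono]

theorem map_mono {R' : Type*} [Ring R'] {F : Type*} [FunLike F R R'] [MonoidHomClass F R R']
    [LinearOrder ι] (f : F) (g : ι → R) (S : Finset ι) :
    f (mono g S) = mono (fun i => f (g i)) S := by
  simp only [mono, map_list_prod, List.map_map]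
  rfl

end Anticommuting

/-! ### The parity involution, derivations and inclusions -/

namespace SAlg

variable {C : Type} [CommRing C] [Algebra ℝ C] {ev od ev' od' τ : Type}

/-- Identities between additive operations on functions need only be checked on pure tensors, where
they reduce to identities in one tensor factor. -/
theorem mk_induction {P : SAlg C ev od → Prop} (h0 : P 0)
    (hadd : ∀ x y, P x → P y → P (x + y)) (hmk : ∀ f p u, P (mk f p u)) (x : SAlg C ev od) :
    P x := by
  refine TensorProduct.induction_on (motive := P) x h0 (fun f y => ?_) (fun x y => hadd x y)
  refine TensorProduct.induction_on (motive := fun y => P (f ⊗ₜ[ℝ] y)) y ?_ (fun p u => hmk f p u)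
    (fun x y hx hy => ?_)
  · rw [TensorProduct.tmul_zero]; exact h0
  · rw [TensorProduct.tmul_add]; exact hadd _ _ hx hy

/-- The mk map as a linear map in the last argument. -/
theorem mk_neg (f : C) (p : MvPolynomial ev ℝ) (u : ExteriorAlgebra ℝ (od →₀ ℝ)) :
    mk f p (-u) = -mk f p u := by
  rw [eq_neg_iff_add_eq_zero, ← mk_add, neg_add_cancel, mk_zero]

theorem mk_smul (f : C) (p : MvPolynomial ev ℝ) (r : ℝ) (u : ExteriorAlgebra ℝ (od →₀ ℝ)) :
    mk f p (r • u) = r • mk f p u :=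
  (congrArg (fun t => f ⊗ₜ[ℝ] t) (TensorProduct.tmul_smul r p u)).trans
    (TensorProduct.tmul_smul r f _)

theorem mk_add_mid (f : C) (p q : MvPolynomial ev ℝ) (u : ExteriorAlgebra ℝ (od →₀ ℝ)) :
    mk f (p + q) u = mk f p u + mk f q u :=
  (congrArg (fun t => f ⊗ₜ[ℝ] t) (TensorProduct.add_tmul p q u)).trans
    (TensorProduct.tmul_add f _ _)

theorem mk_zero_mid (f : C) (u : ExteriorAlgebra ℝ (od →₀ ℝ)) :
    mk f (0 : MvPolynomial ev ℝ) u = 0 :=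
  (congrArg (fun t => f ⊗ₜ[ℝ] t) (TensorProduct.zero_tmul _ u)).trans
    (TensorProduct.tmul_zero _ f)

theorem mk_add_left (f g : C) (p : MvPolynomial ev ℝ) (u : ExteriorAlgebra ℝ (od →₀ ℝ)) :
    mk (f + g) p u = mk f p u + mk g p u := TensorProduct.add_tmul f g _

theorem mk_zero_left (p : MvPolynomial ev ℝ) (u : ExteriorAlgebra ℝ (od →₀ ℝ)) :
    mk (0 : C) p u = 0 := TensorProduct.zero_tmul _ _

/-- The involution multiplying odd elements by `-1`. -/
noncomputable def par : SAlg C ev od →ₐ[ℝ] SAlg C ev od :=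
  Algebra.TensorProduct.map (AlgHom.id ℝ C) (Algebra.TensorProduct.map (AlgHom.id ℝ _)
    CliffordAlgebra.involute)

theorem par_mk (f : C) (p : MvPolynomial ev ℝ) (u : ExteriorAlgebra ℝ (od →₀ ℝ)) :
    par (mk f p u) = mk f p (CliffordAlgebra.involute u) := rfl

theorem dOdd_mk (j : od) (f : C) (p : MvPolynomial ev ℝ) (u : ExteriorAlgebra ℝ (od →₀ ℝ)) :
    dOdd j (mk f p u) = mk f p (CliffordAlgebra.contractLeft (Finsupp.lapply j) u) := rfl

theorem dOddRight_mk (j : od) (f : C) (p : MvPolynomial ev ℝ)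
    (u : ExteriorAlgebra ℝ (od →₀ ℝ)) :
    dOddRight j (mk f p u) = mk f p (CliffordAlgebra.contractRight u (Finsupp.lapply j)) := rfl

theorem dEven_mk (i : ev) (f : C) (p : MvPolynomial ev ℝ) (u : ExteriorAlgebra ℝ (od →₀ ℝ)) :
    dEven i (mk f p u) = mk f (MvPolynomial.pderiv i p) u := rfl

theorem onCoeff_mk (D : C →ₗ[ℝ] C) (f : C) (p : MvPolynomial ev ℝ)
    (u : ExteriorAlgebra ℝ (od →₀ ℝ)) : onCoeff D (mk f p u) = mk (D f) p u := rfl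

theorem dropTheta_mk (f : C) (p : MvPolynomial ev ℝ) (u : ExteriorAlgebra ℝ (od ⊕ τ →₀ ℝ)) :
    dropTheta (mk f p u) = mk f p (ExteriorAlgebra.map
      (Finsupp.lcomapDomain Sum.inl Sum.inl_injective) u) := rfl

/-! ### Left and right contraction on an exterior algebra. -/

section Exterior

variable {M N : Type*} [AddCommGroup M] [Module ℝ M] [AddCommGroup N] [Module ℝ N]

open CliffordAlgebra in
theorem contractLeft_mul (d : Module.Dual ℝ M) (u v : ExteriorAlgebra ℝ M) :
    contractLeft d (u * v) = contractLeft d u * v + involute u * contractLeft d v := by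
  induction u using CliffordAlgebra.left_induction with
  | algebraMap r => rw [contractLeft_algebraMap_mul, contractLeft_algebraMap, AlgHom.commutes]; simp
  | add x y hx hy => rw [add_mul, map_add, hx, hy, map_add, map_add, add_mul, add_mul]; abel
  | ι_mul x m hx =>
    rw [mul_assoc, contractLeft_ι_mul, hx, contractLeft_ι_mul, map_mul, involute_ι]
    simp only [sub_mul, mul_add, mul_assoc, smul_mul_assoc, neg_mul]
    abel

open CliffordAlgebra in
theorem contractRight_mul (d : Module.Dual ℝ M) (u v : ExteriorAlgebra ℝ M) :
    contractRight (u * v) d = u * contractRight v d + contractRight u d * involute v := by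
  rw [contractRight_eq, reverse.map_mul, contractLeft_mul, map_add, reverse.map_mul,
    reverse.map_mul, contractRight_eq, contractRight_eq, reverse_reverse, reverse_involute,
    reverse_reverse]

open CliffordAlgebra in
theorem contractLeft_involute (d : Module.Dual ℝ M) (u : ExteriorAlgebra ℝ M) :
    contractLeft d (involute u) = -involute (contractLeft d u) := by
  induction u using CliffordAlgebra.left_induction with
  | algebraMap r => rw [AlgHom.commutes, contractLeft_algebraMap]; simp
  | add x y hx hy => simp only [map_add, hx, hy, neg_add]
  | ι_mul x m hx =>
    rw [map_mul, involute_ι, neg_mul, map_neg, contractLeft_ι_mul, hx, contractLeft_ι_mul,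
      map_sub, map_mul, involute_ι, map_smul]
    simp

open CliffordAlgebra in
theorem contractRight_contractLeft (d d' : Module.Dual ℝ M) (u : ExteriorAlgebra ℝ M) :
    contractRight (contractLeft d u) d' = contractLeft d (contractRight u d') := by
  induction u using CliffordAlgebra.right_induction with
  | algebraMap r => simp
  | add x y hx hy => simp only [map_add, LinearMap.add_apply, hx, hy]
  | mul_ι m x hx =>
    rw [contractLeft_mul, contractLeft_ι, contractRight_mul_ι, map_sub, map_smul,
      contractLeft_mul, contractLeft_ι, map_add, LinearMap.add_apply, contractRight_mul_ι,
      contractRight_mul_algebraMap, hx, ← neg_inj, neg_add]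
    have : contractRight (involute x) d' = -involute (contractRight x d') := by
      rw [contractRight_eq, reverse_involute, contractLeft_involute, map_neg, reverse_involute]
      rfl
    rw [this]
    simp only [neg_mul]
    abel

theorem map_ι_mul (f : M →ₗ[ℝ] N) (m : M) (x : CliffordAlgebra (0 : QuadraticForm ℝ M)) :
    ExteriorAlgebra.map f (CliffordAlgebra.ι 0 m * x) =
      (CliffordAlgebra.ι 0 (f m) * ExteriorAlgebra.map f x :
        CliffordAlgebra (0 : QuadraticForm ℝ N)) :=
  (map_mul (ExteriorAlgebra.map f) (ExteriorAlgebra.ι ℝ m) x).trans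
    (congrArg (· * ExteriorAlgebra.map f x) (ExteriorAlgebra.map_apply_ι f m))

open CliffordAlgebra in
theorem contractLeft_map (f : M →ₗ[ℝ] N) (d : Module.Dual ℝ N) (u : ExteriorAlgebra ℝ M) :
    contractLeft d (ExteriorAlgebra.map f u) = ExteriorAlgebra.map f (contractLeft (d ∘ₗ f) u) := by
  induction u using CliffordAlgebra.left_induction with
  | algebraMap r => rw [AlgHom.commutes, contractLeft_algebraMap, contractLeft_algebraMap, map_zero]
  | add x y hx hy => simp only [map_add, hx, hy]
  | ι_mul x m hx =>
    rw [contractLeft_ι_mul, map_sub, map_smul, map_ι_mul, map_ι_mul, ← hx, contractLeft_ι_mul]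
    rfl

open CliffordAlgebra in
theorem involute_map (f : M →ₗ[ℝ] N) (u : ExteriorAlgebra ℝ M) :
    involute (ExteriorAlgebra.map f u) = ExteriorAlgebra.map f (involute u) := by
  induction u using CliffordAlgebra.left_induction with
  | algebraMap r => simp only [AlgHom.commutes]
  | add x y hx hy => simp only [map_add, hx, hy]
  | ι_mul x m hx =>
    rw [map_ι_mul, map_mul, map_mul, hx, involute_ι, involute_ι, neg_mul, neg_mul, map_neg,
      map_ι_mul]

open CliffordAlgebra in
theorem reverse_map (f : M →ₗ[ℝ] N) (u : ExteriorAlgebra ℝ M) :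
    reverse (ExteriorAlgebra.map f u) = ExteriorAlgebra.map f (reverse u) := by
  induction u using CliffordAlgebra.left_induction with
  | algebraMap r => rw [AlgHom.commutes, reverse.commutes, reverse.commutes, AlgHom.commutes]
  | add x y hx hy => simp only [map_add, hx, hy]
  | ι_mul x m hx =>
    rw [map_ι_mul, reverse.map_mul, reverse.map_mul, hx, reverse_ι, reverse_ι]
    exact ((map_mul (ExteriorAlgebra.map f) (reverse x) (ExteriorAlgebra.ι ℝ m)).trans
      (congrArg (ExteriorAlgebra.map f (reverse x) * ·) (ExteriorAlgebra.map_apply_ι f m))).symm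

open CliffordAlgebra in
theorem contractRight_map (f : M →ₗ[ℝ] N) (d : Module.Dual ℝ N) (u : ExteriorAlgebra ℝ M) :
    contractRight (ExteriorAlgebra.map f u) d =
      ExteriorAlgebra.map f (contractRight u (d ∘ₗ f)) := by
  rw [contractRight_eq, reverse_map, contractLeft_map, reverse_map]
  rfl

open CliffordAlgebra in
theorem ι_mul_comm (m : M) (u : ExteriorAlgebra ℝ M) :
    ExteriorAlgebra.ι ℝ m * u = involute u * ExteriorAlgebra.ι ℝ m := by
  induction u using CliffordAlgebra.left_induction with
  | algebraMap r => rw [AlgHom.commutes, Algebra.commutes]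
  | add x y hx hy => simp only [map_add, mul_add, add_mul, hx, hy]
  | ι_mul x a hx =>
    rw [map_mul, involute_ι, mul_assoc, ← hx, ← mul_assoc, ← mul_assoc, neg_mul,
      eq_neg_of_add_eq_zero_left (ExteriorAlgebra.ι_add_mul_swap m a)]

end Exterior

theorem par_par (x : SAlg C ev od) : par (par x) = x := by
  induction x using mk_induction with
  | h0 => simp
  | hadd x y hx hy => simp [hx, hy]
  | hmk f p u => rw [par_mk, par_mk, CliffordAlgebra.involute_involute]

theorem odd_mul (j : od) (x : SAlg C ev od) : odd C ev j * x = par x * odd C ev j := by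
  induction x using mk_induction with
  | h0 => simp
  | hadd x y hx hy => simp [mul_add, add_mul, hx, hy]
  | hmk f p u => rw [par_mk, odd, ofExt, mk_mul_mk, mk_mul_mk, ι_mul_comm, one_mul, one_mul,
      mul_one, mul_one]

theorem even_mul (i : ev) (x : SAlg C ev od) : even C od i * x = x * even C od i := by
  induction x using mk_induction with
  | h0 => simp
  | hadd x y hx hy => simp [mul_add, add_mul, hx, hy]
  | hmk f p u => rw [even, mk_mul_mk, mk_mul_mk, one_mul, one_mul, mul_one, mul_one, mul_comm]

theorem ofCoeff_mul (f : C) (x : SAlg C ev od) : ofCoeff ev od f * x = x * ofCoeff ev od f := by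
  induction x using mk_induction with
  | h0 => simp
  | hadd x y hx hy => simp [mul_add, add_mul, hx, hy]
  | hmk f p u => rw [ofCoeff, mk_mul_mk, mk_mul_mk, one_mul, one_mul, mul_one, mul_one, mul_comm]

theorem par_odd (j : od) : par (odd C ev j) = -odd C ev j := by
  rw [odd, ofExt, par_mk, ← mk_neg]
  congr 1
  exact CliffordAlgebra.involute_ι _

theorem par_even (i : ev) : par (even C od i) = even C od i := by
  rw [even, par_mk, map_one]

theorem par_ofCoeff (f : C) : par (ofCoeff ev od f) = ofCoeff ev od f := by
  rw [ofCoeff, par_mk, map_one]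

theorem ofCoeff_mul_ofCoeff (f g : C) :
    ofCoeff ev od f * ofCoeff ev od g = ofCoeff ev od (f * g) := by
  rw [ofCoeff, ofCoeff, mk_mul_mk, mul_one, mul_one]; rfl

theorem ofCoeff_sum {κ : Type*} (s : Finset κ) (f : κ → C) :
    ofCoeff ev od (∑ i ∈ s, f i) = ∑ i ∈ s, ofCoeff ev od (f i) :=
  TensorProduct.sum_tmul s f _

theorem ofCoeff_one : ofCoeff ev od (1 : C) = 1 := rfl

theorem ofCoeff_zero : ofCoeff ev od (0 : C) = 0 := mk_zero_left _ _

theorem anticomm_odd : Anticomm (odd C ev : od → SAlg C ev od) where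
  sq i := by
    rw [odd, ofExt, mk_mul_mk, ExteriorAlgebra.ι_sq_zero, mk_zero]
  anti i j := by rw [odd_mul, par_odd, neg_mul]

theorem dOdd_mul (j : od) (x y : SAlg C ev od) :
    dOdd j (x * y) = dOdd j x * y + par x * dOdd j y := by
  induction x using mk_induction with
  | h0 => simp
  | hadd x z hx hz => simp only [map_add, add_mul, hx, hz]; abel
  | hmk f p u =>
    induction y using mk_induction with
    | h0 => simp
    | hadd x z hx hz => simp only [map_add, mul_add, hx, hz]; abel
    | hmk g q v =>
      simp only [par_mk, mk_mul_mk, dOdd_mk, contractLeft_mul, mk_add]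

theorem dOddRight_mul (j : od) (x y : SAlg C ev od) :
    dOddRight j (x * y) = x * dOddRight j y + dOddRight j x * par y := by
  induction x using mk_induction with
  | h0 => simp
  | hadd x z hx hz => simp only [map_add, add_mul, hx, hz]; abel
  | hmk f p u =>
    induction y using mk_induction with
    | h0 => simp
    | hadd x z hx hz => simp only [map_add, mul_add, hx, hz]; abel
    | hmk g q v =>
      simp only [par_mk, mk_mul_mk, dOddRight_mk, contractRight_mul, mk_add]

theorem dEven_mul (i : ev) (x y : SAlg C ev od) :
    dEven i (x * y) = dEven i x * y + x * dEven i y := by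
  induction x using mk_induction with
  | h0 => simp
  | hadd x z hx hz => simp only [map_add, add_mul, hx, hz]; abel
  | hmk f p u =>
    induction y using mk_induction with
    | h0 => simp
    | hadd x z hx hz => simp only [map_add, mul_add, hx, hz]; abel
    | hmk g q v =>
      simp only [mk_mul_mk, dEven_mk, Derivation.leibniz, smul_eq_mul, mk_add_mid]
      rw [add_comm, mul_comm q]

theorem onCoeff_mul {D : C →ₗ[ℝ] C} (hD : ∀ f g, D (f * g) = D f * g + f * D g)
    (x y : SAlg C ev od) : onCoeff D (x * y) = onCoeff D x * y + x * onCoeff D y := by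
  induction x using mk_induction with
  | h0 => simp
  | hadd x z hx hz => simp only [map_add, add_mul, hx, hz]; abel
  | hmk f p u =>
    induction y using mk_induction with
    | h0 => simp
    | hadd x z hx hz => simp only [map_add, mul_add, hx, hz]; abel
    | hmk g q v => simp only [mk_mul_mk, onCoeff_mk, hD, mk_add_left]

/-- No sign appears because the two derivatives act from opposite sides. This is why coefficients of
θ, extracted by right derivatives, commute with all the left derivatives used later. -/
theorem dOddRight_dOdd (i j : od) (x : SAlg C ev od) :
    dOddRight j (dOdd i x) = dOdd i (dOddRight j x) := by
  induction x using mk_induction with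
  | h0 => simp
  | hadd x z hx hz => simp only [map_add, hx, hz]
  | hmk f p u => simp only [dOdd_mk, dOddRight_mk, contractRight_contractLeft]

theorem dOddRight_dEven (i : ev) (j : od) (x : SAlg C ev od) :
    dOddRight j (dEven i x) = dEven i (dOddRight j x) := by
  induction x using mk_induction with
  | h0 => simp
  | hadd x z hx hz => simp only [map_add, hx, hz]
  | hmk f p u => rfl

theorem dOddRight_onCoeff (D : C →ₗ[ℝ] C) (j : od) (x : SAlg C ev od) :
    dOddRight j (onCoeff D x) = onCoeff D (dOddRight j x) := by
  induction x using mk_induction with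
  | h0 => simp
  | hadd x z hx hz => simp only [map_add, hx, hz]
  | hmk f p u => rfl

theorem dOddRight_comm (i j : od) (x : SAlg C ev od) :
    dOddRight i (dOddRight j x) = -dOddRight j (dOddRight i x) := by
  induction x using mk_induction with
  | h0 => simp
  | hadd x z hx hz => simp only [map_add, hx, hz, neg_add]
  | hmk f p u => rw [dOddRight_mk, dOddRight_mk, CliffordAlgebra.contractRight_comm, mk_neg,
      dOddRight_mk, dOddRight_mk]

theorem dOdd_odd_self (j : od) : dOdd j (odd C ev j) = 1 := by
  rw [odd, ofExt, dOdd_mk]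
  erw [CliffordAlgebra.contractLeft_ι]
  simp only [Finsupp.lapply_apply, Finsupp.single_eq_same, map_one]
  rfl

theorem dOdd_odd_of_ne {i j : od} (h : i ≠ j) : dOdd j (odd C ev i) = 0 := by
  rw [odd, ofExt, dOdd_mk]
  erw [CliffordAlgebra.contractLeft_ι]
  rw [Finsupp.lapply_apply, Finsupp.single_eq_of_ne h.symm, map_zero, mk_zero]

theorem dOddRight_odd_self (j : od) : dOddRight j (odd C ev j) = 1 := by
  rw [odd, ofExt, dOddRight_mk]
  erw [CliffordAlgebra.contractRight_ι]
  simp only [Finsupp.lapply_apply, Finsupp.single_eq_same, map_one]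
  rfl

theorem dOddRight_odd_of_ne {i j : od} (h : i ≠ j) : dOddRight j (odd C ev i) = 0 := by
  rw [odd, ofExt, dOddRight_mk]
  erw [CliffordAlgebra.contractRight_ι]
  rw [Finsupp.lapply_apply, Finsupp.single_eq_of_ne h.symm, map_zero, mk_zero]

theorem dOdd_even (i : ev) (j : od) : dOdd j (even C od i) = 0 := by
  rw [even, dOdd_mk, CliffordAlgebra.contractLeft_one, mk_zero]

theorem dEven_odd (i : ev) (j : od) : dEven i (odd C ev j) = 0 := by
  rw [odd, ofExt, dEven_mk, Derivation.map_one_eq_zero, mk_zero_mid]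

theorem dEven_even [DecidableEq ev] (i j : ev) :
    dEven i (even C od j) = if i = j then 1 else 0 := by
  rw [even, dEven_mk, MvPolynomial.pderiv_X]
  split_ifs with h
  · subst h; rw [Pi.single_eq_same]; rfl
  · rw [Pi.single_eq_of_ne (Ne.symm h), mk_zero_mid]

end SAlg
namespace SAlg

variable {C : Type} [CommRing C] [Algebra ℝ C] {ev od ev' od' ev'' od'' τ : Type}

/-! ### Naturality under inclusions -/

theorem lapply_comp_lmapDomain {g : od → od'} (hg : Function.Injective g) (j : od) :
    (Finsupp.lapply (g j) : (od' →₀ ℝ) →ₗ[ℝ] ℝ) ∘ₗ Finsupp.lmapDomain ℝ ℝ g =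
      Finsupp.lapply j := by
  ext i
  by_cases h : i = j
  · subst h; simp
  · simp [Finsupp.single_eq_of_ne (Ne.symm h), Finsupp.single_eq_of_ne (hg.ne (Ne.symm h))]

theorem lapply_comp_lmapDomain_of_notMem {g : od → od'} {k : od'} (hk : ∀ j, g j ≠ k) :
    (Finsupp.lapply k : (od' →₀ ℝ) →ₗ[ℝ] ℝ) ∘ₗ Finsupp.lmapDomain ℝ ℝ g = 0 := by
  ext i
  simp [hk]

theorem lapply_comp_lcomapDomain (j : od) :
    (Finsupp.lapply j : (od →₀ ℝ) →ₗ[ℝ] ℝ) ∘ₗ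
      Finsupp.lcomapDomain (Sum.inl : od → od ⊕ τ) Sum.inl_injective =
      Finsupp.lapply (Sum.inl j) := by
  ext i
  simp

theorem dOdd_incl (f : ev → ev') {g : od → od'} (hg : Function.Injective g) (j : od)
    (x : SAlg C ev od) : dOdd (g j) (incl f g x) = incl f g (dOdd j x) := by
  induction x using mk_induction with
  | h0 => simp
  | hadd x z hx hz => simp only [map_add, hx, hz]
  | hmk h p u =>
    rw [dOdd_mk, incl_mk, incl_mk, dOdd_mk, contractLeft_map, lapply_comp_lmapDomain hg]

theorem dOddRight_incl (f : ev → ev') {g : od → od'} (hg : Function.Injective g) (j : od)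
    (x : SAlg C ev od) : dOddRight (g j) (incl f g x) = incl f g (dOddRight j x) := by
  induction x using mk_induction with
  | h0 => simp
  | hadd x z hx hz => simp only [map_add, hx, hz]
  | hmk h p u =>
    rw [dOddRight_mk, incl_mk, incl_mk, dOddRight_mk, contractRight_map, lapply_comp_lmapDomain hg]

theorem dOdd_incl_of_notMem (f : ev → ev') {g : od → od'} {k : od'} (hk : ∀ j, g j ≠ k)
    (x : SAlg C ev od) : dOdd k (incl f g x) = 0 := by
  induction x using mk_induction with
  | h0 => simp
  | hadd x z hx hz => simp only [map_add, hx, hz, add_zero]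
  | hmk h p u =>
    rw [incl_mk, dOdd_mk, contractLeft_map, lapply_comp_lmapDomain_of_notMem hk, map_zero,
      LinearMap.zero_apply, map_zero, mk_zero]

theorem dOddRight_incl_of_notMem (f : ev → ev') {g : od → od'} {k : od'} (hk : ∀ j, g j ≠ k)
    (x : SAlg C ev od) : dOddRight k (incl f g x) = 0 := by
  induction x using mk_induction with
  | h0 => simp
  | hadd x z hx hz => simp only [map_add, hx, hz, add_zero]
  | hmk h p u =>
    rw [incl_mk, dOddRight_mk, contractRight_map, lapply_comp_lmapDomain_of_notMem hk, map_zero,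
      map_zero, mk_zero]

theorem pderiv_rename {f : ev → ev'} (hf : Function.Injective f) (i : ev)
    (p : MvPolynomial ev ℝ) :
    MvPolynomial.pderiv (f i) (MvPolynomial.rename f p) =
      MvPolynomial.rename f (MvPolynomial.pderiv i p) := by
  classical
  induction p using MvPolynomial.induction_on with
  | C a => simp
  | add p q hp hq => simp only [map_add, hp, hq]
  | mul_X p j hp =>
    simp only [map_mul, Derivation.leibniz, hp, MvPolynomial.rename_X, smul_eq_mul, map_add,
      MvPolynomial.pderiv_X, Pi.single_apply, hf.eq_iff]
    split_ifs <;> simp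

theorem pderiv_rename_of_notMem {f : ev → ev'} {k : ev'} (hk : ∀ i, f i ≠ k)
    (p : MvPolynomial ev ℝ) : MvPolynomial.pderiv k (MvPolynomial.rename f p) = 0 := by
  classical
  induction p using MvPolynomial.induction_on with
  | C a => simp
  | add p q hp hq => simp only [map_add, hp, hq, add_zero]
  | mul_X p j hp =>
    simp only [map_mul, Derivation.leibniz, hp, MvPolynomial.rename_X, smul_eq_mul,
      MvPolynomial.pderiv_X, Pi.single_apply, hk, if_false]
    simp

theorem dEven_incl {f : ev → ev'} (hf : Function.Injective f) (g : od → od') (i : ev)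
    (x : SAlg C ev od) : dEven (f i) (incl f g x) = incl f g (dEven i x) := by
  induction x using mk_induction with
  | h0 => simp
  | hadd x z hx hz => simp only [map_add, hx, hz]
  | hmk h p u => rw [dEven_mk, incl_mk, incl_mk, dEven_mk, pderiv_rename hf]

theorem dEven_incl_of_notMem {f : ev → ev'} {k : ev'} (hk : ∀ i, f i ≠ k) (g : od → od')
    (x : SAlg C ev od) : dEven k (incl f g x) = 0 := by
  induction x using mk_induction with
  | h0 => simp
  | hadd x z hx hz => simp only [map_add, hx, hz, add_zero]
  | hmk h p u => rw [incl_mk, dEven_mk, pderiv_rename_of_notMem hk, mk_zero_mid]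

theorem onCoeff_incl (D : C →ₗ[ℝ] C) (f : ev → ev') (g : od → od') (x : SAlg C ev od) :
    onCoeff D (incl f g x) = incl f g (onCoeff D x) := by
  induction x using mk_induction with
  | h0 => simp
  | hadd x z hx hz => simp only [map_add, hx, hz]
  | hmk h p u => rfl

theorem par_incl (f : ev → ev') (g : od → od') (x : SAlg C ev od) :
    par (incl f g x) = incl f g (par x) := by
  induction x using mk_induction with
  | h0 => simp
  | hadd x z hx hz => simp only [map_add, hx, hz]
  | hmk h p u => rw [par_mk, incl_mk, incl_mk, par_mk, involute_map]

theorem incl_incl (f : ev → ev') (g : od → od') (f' : ev' → ev'') (g' : od' → od'')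
    (x : SAlg C ev od) : incl f' g' (incl f g x) = incl (f' ∘ f) (g' ∘ g) x := by
  induction x using mk_induction with
  | h0 => simp
  | hadd x z hx hz => simp only [map_add, hx, hz]
  | hmk h p u =>
    rw [incl_mk, incl_mk, incl_mk, MvPolynomial.rename_rename, ← AlgHom.comp_apply,
      ExteriorAlgebra.map_comp_map, Finsupp.lmapDomain_comp]

theorem incl_odd (f : ev → ev') (g : od → od') (j : od) :
    incl f g (odd C ev j) = odd C ev' (g j) := by
  rw [odd, ofExt, incl_mk, map_one, ExteriorAlgebra.map_apply_ι]
  simp [odd, ofExt]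

theorem incl_even (f : ev → ev') (g : od → od') (i : ev) :
    incl f g (even C od i) = even C od' (f i) := by
  rw [even, incl_mk, map_one, MvPolynomial.rename_X]; rfl

theorem incl_ofCoeff (f : ev → ev') (g : od → od') (h : C) :
    incl f g (ofCoeff ev od h) = ofCoeff ev' od' h := by
  rw [ofCoeff, incl_mk, map_one, map_one]; rfl

theorem incl_injective {f : ev → ev'} (hf : Function.Injective f) {g : od → od'}
    (hg : Function.Injective g) : Function.Injective (incl f g : SAlg C ev od → SAlg C ev' od') := by
  -- A retraction: the variables outside the ranges of the two maps are set to zero.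
  let R : SAlg C ev' od' →ₐ[ℝ] SAlg C ev od :=
    Algebra.TensorProduct.map (AlgHom.id ℝ C) (Algebra.TensorProduct.map
      (MvPolynomial.killCompl hf) (ExteriorAlgebra.map (Finsupp.lcomapDomain g hg)))
  refine Function.LeftInverse.injective (g := R) fun x => ?_
  induction x using mk_induction with
  | h0 => simp
  | hadd x z hx hz => simp only [map_add, hx, hz]
  | hmk h p u =>
    rw [incl_mk]
    change mk h (MvPolynomial.killCompl hf (MvPolynomial.rename f p))
      (ExteriorAlgebra.map (Finsupp.lcomapDomain g hg)
        (ExteriorAlgebra.map (Finsupp.lmapDomain ℝ ℝ g) u)) = _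
    have h1 : (Finsupp.lcomapDomain g hg : (od' →₀ ℝ) →ₗ[ℝ] _) ∘ₗ Finsupp.lmapDomain ℝ ℝ g =
        LinearMap.id := by
      refine LinearMap.ext fun x => ?_
      exact Finsupp.comapDomain_mapDomain g hg x
    rw [MvPolynomial.killCompl_rename_app, ← AlgHom.comp_apply, ExteriorAlgebra.map_comp_map, h1,
      ExteriorAlgebra.map_id, AlgHom.id_apply]

theorem dropTheta_incl_inl (x : SAlg C ev od) :
    dropTheta (incl id (Sum.inl : od → od ⊕ τ) x) = x := by
  induction x using mk_induction with
  | h0 => simp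
  | hadd x z hx hz => simp only [map_add, hx, hz]
  | hmk h p u =>
    have h1 : (Finsupp.lcomapDomain (Sum.inl : od → od ⊕ τ) Sum.inl_injective :
        (od ⊕ τ →₀ ℝ) →ₗ[ℝ] _) ∘ₗ Finsupp.lmapDomain ℝ ℝ Sum.inl = LinearMap.id := by
      refine LinearMap.ext fun x => ?_
      exact Finsupp.comapDomain_mapDomain _ Sum.inl_injective x
    rw [incl_mk, dropTheta_mk, ← AlgHom.comp_apply, ExteriorAlgebra.map_comp_map, h1,
      ExteriorAlgebra.map_id, AlgHom.id_apply, MvPolynomial.rename_id]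
    rfl

theorem dropTheta_theta (t : τ) : dropTheta (odd C ev (Sum.inr t : od ⊕ τ)) = 0 := by
  rw [odd, ofExt, dropTheta_mk, ExteriorAlgebra.map_apply_ι]
  have : (Finsupp.lcomapDomain (Sum.inl : od → od ⊕ τ) Sum.inl_injective :
      (od ⊕ τ →₀ ℝ) →ₗ[ℝ] _) (Finsupp.single (Sum.inr t) (1 : ℝ)) = 0 := by
    ext i; simp
  rw [this, map_zero, mk_zero]

theorem dropTheta_dOdd (j : od) (x : SAlg C ev (od ⊕ τ)) :
    dropTheta (dOdd (Sum.inl j) x) = dOdd j (dropTheta x) := by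
  induction x using mk_induction with
  | h0 => simp
  | hadd x z hx hz => simp only [map_add, hx, hz]
  | hmk h p u =>
    rw [dOdd_mk, dropTheta_mk, dropTheta_mk, dOdd_mk, contractLeft_map, lapply_comp_lcomapDomain]

theorem dropTheta_dEven (i : ev) (x : SAlg C ev (od ⊕ τ)) :
    dropTheta (dEven i x) = dEven i (dropTheta x) := by
  induction x using mk_induction with
  | h0 => simp
  | hadd x z hx hz => simp only [map_add, hx, hz]
  | hmk h p u => rfl

theorem dropTheta_onCoeff (D : C →ₗ[ℝ] C) (x : SAlg C ev (od ⊕ τ)) :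
    dropTheta (onCoeff D x) = onCoeff D (dropTheta x) := by
  induction x using mk_induction with
  | h0 => simp
  | hadd x z hx hz => simp only [map_add, hx, hz]
  | hmk h p u => rfl

theorem dropTheta_incl (f : ev → ev') (g : od → od') (x : SAlg C ev (od ⊕ τ)) :
    dropTheta (incl f (Sum.map g id) x) = incl f g (dropTheta x) := by
  induction x using mk_induction with
  | h0 => simp
  | hadd x z hx hz => simp only [map_add, hx, hz]
  | hmk h p u =>
    rw [incl_mk, dropTheta_mk, dropTheta_mk, incl_mk]
    congr 1
    rw [← AlgHom.comp_apply, ← AlgHom.comp_apply, ExteriorAlgebra.map_comp_map,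
      ExteriorAlgebra.map_comp_map]
    congr 2
    ext i j
    rcases i with i | i
    · simp
    · simp

/-! ### Expansion in the odd variables `θ` -/

theorem par_pow_add (k l : ℕ) (x : SAlg C ev od) :
    (par ^ (k + l)) x = (par ^ k) ((par ^ l) x) := by rw [pow_add]; rfl

theorem par_pow_succ (k : ℕ) (x : SAlg C ev od) : (par ^ (k + 1)) x = (par ^ k) (par x) := by
  rw [pow_succ]; rfl

theorem par_pow_even {k : ℕ} (hk : Even k) (x : SAlg C ev od) : (par ^ k) x = x := by
  obtain ⟨m, rfl⟩ := hk
  rw [← two_mul, pow_mul]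
  have : (par ^ 2 : SAlg C ev od →ₐ[ℝ] SAlg C ev od) = 1 := AlgHom.ext fun x => by
    rw [pow_two]; exact par_par x
  rw [this, one_pow]; rfl

theorem par_pow_odd {k : ℕ} (hk : Odd k) (x : SAlg C ev od) : (par ^ k) x = par x := by
  obtain ⟨m, rfl⟩ := hk
  rw [par_pow_succ, par_pow_even (even_two_mul m)]

theorem odd_list_mul (l : List od) (x : SAlg C ev od) :
    (l.map (odd C ev)).prod * x = (par ^ l.length) x * (l.map (odd C ev)).prod := by
  induction l generalizing x with
  | nil => simp
  | cons a l ih =>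
    rw [List.map_cons, List.prod_cons, mul_assoc, ih, ← mul_assoc, odd_mul, mul_assoc,
      List.length_cons, add_comm, par_pow_add, pow_one]

theorem par_odd_list (l : List od) :
    par (l.map (odd C ev)).prod = (-1 : ℝ) ^ l.length • (l.map (odd C ev)).prod := by
  induction l with
  | nil => simp
  | cons a l ih =>
    rw [List.map_cons, List.prod_cons, map_mul, ih, par_odd, List.length_cons, pow_succ]
    simp

variable {n : ℕ}

/-- The odd variables `θ^μ`. -/
noncomputable def theta (C : Type) [CommRing C] [Algebra ℝ C] (ev od : Type) {n : ℕ} (μ : Fin n) :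
    SAlg C ev (od ⊕ Fin n) := odd C ev (Sum.inr μ)

/-- Functions that do not depend on `θ`. -/
noncomputable abbrev tin (n : ℕ) : SAlg C ev od →ₐ[ℝ] SAlg C ev (od ⊕ Fin n) := incl id Sum.inl

theorem anticomm_theta : Anticomm (theta C ev od : Fin n → _) where
  sq _ := anticomm_odd.sq _
  anti _ _ := anticomm_odd.anti _ _

theorem ofExt_mul (u v : ExteriorAlgebra ℝ (od →₀ ℝ)) :
    ofExt C ev (u * v) = ofExt C ev u * ofExt C ev v := by
  rw [ofExt, ofExt, ofExt, mk_mul_mk, one_mul, one_mul]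

theorem thetaMonomial_eq (S : Finset (Fin n)) :
    thetaMonomial C ev od S = mono (theta C ev od) S := by
  rw [thetaMonomial, mono]
  induction S.sort with
  | nil => rfl
  | cons a l ih =>
    rw [List.map_cons, List.prod_cons, List.map_cons, List.prod_cons, ofExt_mul, ih]; rfl

theorem mono_theta_mul (S : Finset (Fin n)) (x : SAlg C ev (od ⊕ Fin n)) :
    mono (theta C ev od) S * x = (par ^ S.card) x * mono (theta C ev od) S := by
  have := odd_list_mul (S.sort.map (Sum.inr : Fin n → od ⊕ Fin n)) x
  rw [List.map_map, List.length_map, Finset.length_sort] at this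
  exact this

theorem par_mono_theta (S : Finset (Fin n)) :
    par (mono (theta C ev od) S) = (-1 : ℝ) ^ S.card • mono (theta C ev od) S := by
  have := par_odd_list (C := C) (ev := ev) (S.sort.map (Sum.inr : Fin n → od ⊕ Fin n))
  rw [List.map_map, List.length_map, Finset.length_sort] at this
  exact this

theorem par_pow_incl (k : ℕ) (f : ev → ev') (g : od → od') (x : SAlg C ev od) :
    (par ^ k) (incl f g x) = incl f g ((par ^ k) x) := by
  induction k generalizing x with
  | zero => rfl
  | succ k ih => rw [par_pow_succ, par_pow_succ, par_incl, ih]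

/-- Iterated right derivative with respect to `θ`. -/
theorem dList_comm {D' : SAlg C ev (od ⊕ Fin n) → SAlg C ev' (od' ⊕ Fin n)}
    (h : ∀ μ x, dOddRight (Sum.inr μ) (D' x) = D' (dOddRight (Sum.inr μ) x)) (l : List (Fin n))
    (F : SAlg C ev (od ⊕ Fin n)) :
    l.foldr (fun μ G => dOddRight (Sum.inr μ) G) (D' F) =
      D' (l.foldr (fun μ G => dOddRight (Sum.inr μ) G) F) := by
  induction l with
  | nil => rfl
  | cons a l ih => rw [List.foldr_cons, List.foldr_cons, ih, h]

/-- The source of all statements that an operator may be moved through a θ-coefficient or a Berezin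
integral: it suffices to commute with the right θ-derivatives and with setting θ = 0. -/
theorem thetaCoeff_comm {D' : SAlg C ev (od ⊕ Fin n) → SAlg C ev' (od' ⊕ Fin n)}
    {D : SAlg C ev od → SAlg C ev' od'}
    (h : ∀ μ x, dOddRight (Sum.inr μ) (D' x) = D' (dOddRight (Sum.inr μ) x))
    (h' : ∀ x, dropTheta (D' x) = D (dropTheta x)) (S : Finset (Fin n))
    (F : SAlg C ev (od ⊕ Fin n)) : thetaCoeff S (D' F) = D (thetaCoeff S F) := by
  rw [thetaCoeff, dList_comm h, h']; rfl

theorem thetaCoeff_tin_mul (S : Finset (Fin n)) (a : SAlg C ev od) (F : SAlg C ev (od ⊕ Fin n)) :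
    thetaCoeff S (tin n a * F) = a * thetaCoeff S F := by
  refine thetaCoeff_comm (D' := fun F => tin n a * F) (D := fun x => a * x) (fun μ x => ?_)
    (fun x => ?_) S F
  · rw [dOddRight_mul, dOddRight_incl_of_notMem _ (by simp), zero_mul, add_zero]
  · rw [map_mul, dropTheta_incl_inl]

theorem dList_add (l : List (Fin n)) (F G : SAlg C ev (od ⊕ Fin n)) :
    l.foldr (fun μ G => dOddRight (Sum.inr μ) G) (F + G) =
      l.foldr (fun μ G => dOddRight (Sum.inr μ) G) F +
      l.foldr (fun μ G => dOddRight (Sum.inr μ) G) G := by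
  induction l with
  | nil => rfl
  | cons a l ih => simp only [List.foldr_cons, ih, map_add]

theorem thetaCoeff_add (S : Finset (Fin n)) (F G : SAlg C ev (od ⊕ Fin n)) :
    thetaCoeff S (F + G) = thetaCoeff S F + thetaCoeff S G := by
  rw [thetaCoeff, dList_add, map_add]; rfl

theorem thetaCoeff_smul (S : Finset (Fin n)) (r : ℝ) (F : SAlg C ev (od ⊕ Fin n)) :
    thetaCoeff S (r • F) = r • thetaCoeff S F :=
  thetaCoeff_comm (D' := fun F => r • F) (D := fun F => r • F) (fun _ _ => map_smul _ _ _)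
    (fun _ => map_smul _ _ _) S F

/-- The coefficient of `θ^S` as a linear map. -/
noncomputable def thetaCoeffL (S : Finset (Fin n)) :
    SAlg C ev (od ⊕ Fin n) →ₗ[ℝ] SAlg C ev od where
  toFun := thetaCoeff S
  map_add' := thetaCoeff_add S
  map_smul' := thetaCoeff_smul S

theorem thetaCoeff_sum {κ : Type*} (s : Finset κ) (S : Finset (Fin n))
    (F : κ → SAlg C ev (od ⊕ Fin n)) :
    thetaCoeff S (∑ i ∈ s, F i) = ∑ i ∈ s, thetaCoeff S (F i) := map_sum (thetaCoeffL S) F s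

theorem thetaCoeff_zero (S : Finset (Fin n)) :
    thetaCoeff S (0 : SAlg C ev (od ⊕ Fin n)) = 0 := map_zero (thetaCoeffL S)

theorem thetaCoeff_neg (S : Finset (Fin n)) (F : SAlg C ev (od ⊕ Fin n)) :
    thetaCoeff S (-F) = -thetaCoeff S F := map_neg (thetaCoeffL S) F

theorem dOddRight_theta_list {μ : Fin n} {l : List (Fin n)} (h : μ ∉ l) :
    dOddRight (Sum.inr μ) (l.map (theta C ev od)).prod = 0 := by
  induction l with
  | nil => exact (congrArg _ (map_one (incl (C := C) (id : ev → ev)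
      (Sum.inl : od → od ⊕ Fin n))).symm).trans (dOddRight_incl_of_notMem _ (by simp) _)
  | cons a l ih =>
    rw [List.mem_cons, not_or] at h
    rw [List.map_cons, List.prod_cons, dOddRight_mul, ih h.2, theta,
      dOddRight_odd_of_ne (by simpa using Ne.symm h.1)]
    simp

theorem dList_of_ker {μ : Fin n} {x : SAlg C ev (od ⊕ Fin n)}
    (hx : dOddRight (Sum.inr μ) x = 0) (l : List (Fin n)) :
    dOddRight (Sum.inr μ) (l.foldr (fun μ G => dOddRight (Sum.inr μ) G) x) = 0 := by
  induction l with
  | nil => exact hx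
  | cons a l ih => rw [List.foldr_cons, dOddRight_comm, ih, map_zero, neg_zero]

theorem dList_eq_zero {μ : Fin n} {x : SAlg C ev (od ⊕ Fin n)}
    (hx : dOddRight (Sum.inr μ) x = 0) {l : List (Fin n)} (hl : μ ∈ l) :
    l.foldr (fun μ G => dOddRight (Sum.inr μ) G) x = 0 := by
  induction l with
  | nil => simp at hl
  | cons a l ih =>
    rw [List.foldr_cons]
    rcases List.mem_cons.mp hl with rfl | h
    · exact dList_of_ker hx l
    · rw [ih h, map_zero]

theorem dList_theta_self {l : List (Fin n)} (hl : l.Nodup) :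
    l.foldr (fun μ G => dOddRight (Sum.inr μ) G) (l.map (theta C ev od)).prod = 1 := by
  induction l using List.reverseRecOn with
  | nil => rfl
  | append_singleton l a ih =>
    rw [List.nodup_append'] at hl
    have ha : a ∉ l := fun h => hl.2.2 h (List.mem_singleton_self a)
    rw [List.foldr_append, List.foldr_cons, List.foldr_nil, List.map_append, List.prod_append,
      List.map_cons, List.map_nil, List.prod_singleton, dOddRight_mul, dOddRight_theta_list ha,
      zero_mul, add_zero, theta, dOddRight_odd_self, mul_one, ih hl.1]

/-- A right factor θ^μ survives all right derivatives in other directions, up to sign, and is then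
killed by setting θ = 0. -/
theorem dList_mul_theta {μ : Fin n} {l : List (Fin n)} (hl : μ ∉ l)
    (x : SAlg C ev (od ⊕ Fin n)) :
    dropTheta (l.foldr (fun μ G => dOddRight (Sum.inr μ) G) (x * theta C ev od μ)) = 0 := by
  have : ∃ y, l.foldr (fun μ G => dOddRight (Sum.inr μ) G) (x * theta C ev od μ) =
      y * theta C ev od μ := by
    induction l with
    | nil => exact ⟨x, rfl⟩
    | cons a l ih =>
      rw [List.mem_cons, not_or] at hl
      obtain ⟨y, hy⟩ := ih hl.2
      refine ⟨-dOddRight (Sum.inr a) y, ?_⟩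
      rw [List.foldr_cons, hy, dOddRight_mul, theta, dOddRight_odd_of_ne (by simpa using hl.1),
        par_odd]
      simp
  obtain ⟨y, hy⟩ := this
  rw [hy, map_mul, theta, dropTheta_theta, mul_zero]

/-- Two things can go wrong when S ≠ T. If T has an element outside S, that θ remains and vanishes
at θ = 0; if S has an element outside T, the corresponding derivative annihilates the monomial. -/
theorem thetaCoeff_mono [DecidableEq (Finset (Fin n))] (S T : Finset (Fin n)) :
    thetaCoeff S (mono (theta C ev od) T) = if S = T then 1 else 0 := by
  split_ifs with h
  · subst h
    rw [thetaCoeff, mono, dList_theta_self (Finset.sort_nodup S (· ≤ ·)), map_one]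
  · by_cases hST : S ⊆ T
    · obtain ⟨μ, hμT, hμS⟩ : ∃ μ ∈ T, μ ∉ S := by
        by_contra! h'
        exact h (hST.antisymm h')
      have h1 := (anticomm_theta (C := C) (ev := ev) (od := od)).mono_mul_mono (T.erase μ) {μ}
      have h2 : T.erase μ ∪ {μ} = T := by
        ext x; by_cases hx : x = μ <;> simp [hx, hμT]
      have h3 : Disjoint (T.erase μ) {μ} := by simp
      rw [h2, mono_singleton] at h1
      have h4 := dList_mul_theta (C := C) (ev := ev) (od := od) (μ := μ) (l := S.sort) (by simpa)
      rcases h1 with h1 | ⟨-, h1 | h1⟩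
      · exact absurd h3 h1.1
      · rw [← h1, thetaCoeff, h4]
      · rw [← neg_eq_iff_eq_neg.mpr h1, ← neg_mul, thetaCoeff, h4]
    · obtain ⟨μ, hμS, hμT⟩ := Finset.not_subset.mp hST
      rw [thetaCoeff, mono, dList_eq_zero (μ := μ) (dOddRight_theta_list (by simpa)) (by simpa),
        map_zero]

/-- Induction on right multiplication by a generator. A generator independent of θ passes to the
left of θ^S at the cost of |S| parity involutions; a generator θ^μ turns θ^S into zero or a monomial
up to sign. -/
theorem exists_expansion (F : SAlg C ev (od ⊕ Fin n)) :
    ∃ c : Finset (Fin n) → SAlg C ev od, F = ∑ S, tin n (c S) * mono (theta C ev od) S := by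
  classical
  induction F using mk_induction with
  | h0 => exact ⟨0, by simp⟩
  | hadd x y hx hy =>
    obtain ⟨c, rfl⟩ := hx
    obtain ⟨d, rfl⟩ := hy
    exact ⟨c + d, by simp [add_mul, Finset.sum_add_distrib]⟩
  | hmk f p u =>
    induction u using CliffordAlgebra.right_induction with
    | algebraMap r =>
      refine ⟨Pi.single ∅ (r • mk f p 1), ?_⟩
      rw [Finset.sum_eq_single ∅ (fun S _ hS => by rw [Pi.single_eq_of_ne hS, map_zero, zero_mul])
        (by simp), Pi.single_eq_same, mono_empty, mul_one, map_smul, incl_mk, map_one,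
        MvPolynomial.rename_id, Algebra.algebraMap_eq_smul_one, ← mk_smul]
      rfl
    | add x y hx hy =>
      obtain ⟨c, hc⟩ := hx
      obtain ⟨d, hd⟩ := hy
      refine ⟨c + d, ?_⟩
      rw [mk_add]
      erw [hc, hd]
      simp [add_mul, Finset.sum_add_distrib]
    | mul_ι m x hx =>
      obtain ⟨c, hc⟩ := hx
      have key : ∀ j : od ⊕ Fin n, ∃ c : Finset (Fin n) → SAlg C ev od, mk f p x * odd C ev j =
          ∑ S, tin n (c S) * mono (theta C ev od) S := by
        intro j
        have hc' : mk f p x = ∑ S, tin n (c S) * mono (theta C ev od) S := hc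
        rw [hc']
        rcases j with j | μ
        · refine ⟨fun S => c S * (par ^ S.card) (odd C ev j), ?_⟩
          rw [Finset.sum_mul]
          refine Finset.sum_congr rfl fun S _ => ?_
          rw [mul_assoc, mono_theta_mul, ← mul_assoc, map_mul, ← par_pow_incl, incl_odd]
        · have : ∀ S, ∃ d : Finset (Fin n) → SAlg C ev od, tin n (c S) * mono (theta C ev od) S *
              odd C ev (Sum.inr μ) = ∑ T, tin n (d T) * mono (theta C ev od) T := by
            intro S
            have h1 := (anticomm_theta (C := C) (ev := ev) (od := od)).mono_mul_mono S {μ}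
            rw [mono_singleton, theta] at h1
            rw [mul_assoc]
            rcases h1 with ⟨-, h1⟩ | ⟨-, h1 | h1⟩
            · exact ⟨0, by rw [h1]; simp⟩
            · refine ⟨Pi.single (S ∪ {μ}) (c S), ?_⟩
              rw [h1, Finset.sum_eq_single (S ∪ {μ}) (fun S _ hS => by
                rw [Pi.single_eq_of_ne hS, map_zero, zero_mul]) (by simp), Pi.single_eq_same]
            · refine ⟨Pi.single (S ∪ {μ}) (-c S), ?_⟩
              rw [h1, Finset.sum_eq_single (S ∪ {μ}) (fun S _ hS => by
                rw [Pi.single_eq_of_ne hS, map_zero, zero_mul]) (by simp), Pi.single_eq_same,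
                map_neg, neg_mul, mul_neg]
          choose d hd using this
          refine ⟨fun T => ∑ S, d S T, ?_⟩
          rw [Finset.sum_mul, Finset.sum_congr rfl fun S _ => hd S, Finset.sum_comm]
          simp [Finset.sum_mul]
      have key2 : ∀ m : od ⊕ Fin n →₀ ℝ, ∃ c : Finset (Fin n) → SAlg C ev od, mk f p (x * ExteriorAlgebra.ι ℝ m) =
          ∑ S, tin n (c S) * mono (theta C ev od) S := by
        intro m
        induction m using Finsupp.induction_linear with
        | zero => exact ⟨0, by rw [map_zero, mul_zero, mk_zero]; simp⟩
        | add a b ha hb =>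
          obtain ⟨c, hc⟩ := ha
          obtain ⟨d, hd⟩ := hb
          refine ⟨c + d, ?_⟩
          rw [map_add, mul_add, mk_add, hc, hd]
          simp [add_mul, Finset.sum_add_distrib]
        | single j r =>
          obtain ⟨c, hc⟩ := key j
          refine ⟨r • c, ?_⟩
          have : Finsupp.single j r = r • Finsupp.single j (1 : ℝ) := by simp
          rw [this, map_smul, mul_smul_comm, mk_smul]
          have h2 : mk f p (x * ExteriorAlgebra.ι ℝ (Finsupp.single j 1)) =
              mk f p x * odd C ev j := by
            rw [odd, ofExt, mk_mul_mk, mul_one, mul_one]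
          rw [h2, hc, Finset.smul_sum]
          simp
      exact key2 m

theorem thetaCoeff_expansion (S : Finset (Fin n)) (c : Finset (Fin n) → SAlg C ev od) :
    thetaCoeff S (∑ T, tin n (c T) * mono (theta C ev od) T) = c S := by
  classical
  rw [thetaCoeff_sum, Finset.sum_congr rfl fun T _ => by
    rw [thetaCoeff_tin_mul, thetaCoeff_mono]]
  simp

theorem expansion (F : SAlg C ev (od ⊕ Fin n)) :
    ∑ S, tin n (thetaCoeff S F) * mono (theta C ev od) S = F := by
  obtain ⟨c, rfl⟩ := exists_expansion F
  exact Finset.sum_congr rfl fun S _ => by rw [thetaCoeff_expansion]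

theorem ext_thetaCoeff {F G : SAlg C ev (od ⊕ Fin n)}
    (h : ∀ S, thetaCoeff S F = thetaCoeff S G) : F = G := by
  rw [← expansion F, ← expansion G]
  exact Finset.sum_congr rfl fun S _ => by rw [h]

end SAlg
namespace SAlg

variable {C : Type} [CommRing C] [Algebra ℝ C] {ev od : Type}

/-! ### Setting all odd variables equal to zero -/

/-- Setting all odd variables equal to zero. -/
noncomputable def red : SAlg C ev od →ₐ[ℝ] C ⊗[ℝ] MvPolynomial ev ℝ :=
  Algebra.TensorProduct.map (AlgHom.id ℝ C)
    ((Algebra.TensorProduct.rid ℝ ℝ (MvPolynomial ev ℝ)).toAlgHom.comp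
      (Algebra.TensorProduct.map (AlgHom.id ℝ _) ExteriorAlgebra.algebraMapInv))

theorem red_mk (f : C) (p : MvPolynomial ev ℝ) (u : ExteriorAlgebra ℝ (od →₀ ℝ)) :
    red (mk f p u) = f ⊗ₜ[ℝ] (ExteriorAlgebra.algebraMapInv u • p) := rfl

theorem red_par (x : SAlg C ev od) : red (par x) = red x := by
  induction x using mk_induction with
  | h0 => simp
  | hadd x y hx hy => simp only [map_add, hx, hy]
  | hmk f p u =>
    rw [par_mk, red_mk, red_mk]
    have : (ExteriorAlgebra.algebraMapInv (R := ℝ) (M := od →₀ ℝ)).comp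
        CliffordAlgebra.involute = ExteriorAlgebra.algebraMapInv := by
      ext m
      change ExteriorAlgebra.algebraMapInv (CliffordAlgebra.involute (CliffordAlgebra.ι _ _)) = _
      rw [CliffordAlgebra.involute_ι, map_neg]
      erw [ExteriorAlgebra.lift_ι_apply]
      simp
    exact congrArg (fun r : ℝ => f ⊗ₜ[ℝ] (r • p)) (AlgHom.congr_fun this u)

theorem red_par_pow (k : ℕ) (x : SAlg C ev od) : red ((par ^ k) x) = red x := by
  induction k generalizing x with
  | zero => rfl
  | succ k ih => rw [par_pow_succ, ih, red_par]

/-- The embedding of the functions of the even variables. -/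
noncomputable def ofEven : C ⊗[ℝ] MvPolynomial ev ℝ →ₐ[ℝ] SAlg C ev od :=
  Algebra.TensorProduct.map (AlgHom.id ℝ C) Algebra.TensorProduct.includeLeft

theorem ofEven_tmul (f : C) (p : MvPolynomial ev ℝ) :
    (ofEven (f ⊗ₜ[ℝ] p) : SAlg C ev od) = mk f p 1 := rfl

/-- The left ideal spanned by the products of `m` odd variables. -/
noncomputable def oddIdeal (C : Type) [CommRing C] [Algebra ℝ C] (ev od : Type) (m : ℕ) :
    Submodule (SAlg C ev od) (SAlg C ev od) :=
  Submodule.span _ {x | ∃ l : List od, l.length = m ∧ x = (l.map (odd C ev)).prod}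

/-- Although these are left ideals, degrees add: an odd variable can be moved past a coefficient by
applying the parity involution to the latter. -/
theorem mul_mem_oddIdeal {m : ℕ} {x y : SAlg C ev od} (hx : x ∈ oddIdeal C ev od 1)
    (hy : y ∈ oddIdeal C ev od m) : x * y ∈ oddIdeal C ev od (m + 1) := by
  induction hx using Submodule.span_induction with
  | mem x hx =>
    obtain ⟨l, hl, rfl⟩ := hx
    obtain ⟨j, rfl⟩ := List.length_eq_one_iff.mp hl
    induction hy using Submodule.span_induction with
    | mem y hy =>
      obtain ⟨l', hl', rfl⟩ := hy
      refine Submodule.subset_span ⟨j :: l', by simp [hl'], by simp⟩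
    | zero => simp
    | add y z _ _ hy hz => rw [mul_add]; exact Submodule.add_mem _ hy hz
    | smul a y _ hy =>
      have : (List.map (odd C ev) [j]).prod * (a • y) =
          par a • ((List.map (odd C ev) [j]).prod * y) := by
        simp only [List.map_cons, List.map_nil, List.prod_singleton, smul_eq_mul]
        rw [← mul_assoc, odd_mul, mul_assoc]
      rw [this]
      exact Submodule.smul_mem _ _ hy
  | zero => simp
  | add x z _ _ hx hz => rw [add_mul]; exact Submodule.add_mem _ hx hz
  | smul a x _ hx => rw [smul_mul_assoc]; exact Submodule.smul_mem _ _ hx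

/-- By the pigeonhole principle, a product of more odd variables than there are contains a repeated
factor. -/
theorem oddIdeal_eq_bot [Finite od] {m : ℕ} (hm : Nat.card od < m) : oddIdeal C ev od m = ⊥ := by
  have := Fintype.ofFinite od
  rw [oddIdeal, Submodule.span_eq_bot]
  rintro _ ⟨l, hl, rfl⟩
  refine anticomm_odd.prod_eq_zero fun h => ?_
  have := h.length_le_card
  rw [Nat.card_eq_fintype_card] at hm
  omega

theorem sub_ofEven_mem (x : SAlg C ev od) : x - ofEven (red x) ∈ oddIdeal C ev od 1 := by
  induction x using mk_induction with
  | h0 => simp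
  | hadd x y hx hy =>
    rw [map_add, map_add, add_sub_add_comm]
    exact Submodule.add_mem _ hx hy
  | hmk f p u =>
    have key : ∀ m : od →₀ ℝ, ∀ x : SAlg C ev od,
        x * ofExt C ev (ExteriorAlgebra.ι ℝ m) ∈ oddIdeal C ev od 1 := by
      intro m x
      induction m using Finsupp.induction_linear with
      | zero => rw [map_zero, ofExt, mk_zero, mul_zero]; exact Submodule.zero_mem _
      | add a b ha hb =>
        rw [map_add, ofExt, mk_add, mul_add]; exact Submodule.add_mem _ ha hb
      | single j r =>
        have : Finsupp.single j r = r • Finsupp.single j (1 : ℝ) := by simp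
        rw [this, map_smul, ofExt, mk_smul, mul_smul_comm, ← smul_mul_assoc]
        exact Submodule.smul_mem _ (r • x)
          (Submodule.subset_span ⟨[j], rfl, by simp [odd, ofExt]⟩)
    rw [red_mk, ofEven_tmul]
    have hs : ∀ r : ℝ, (mk f (r • p) 1 : SAlg C ev od) = mk f p (algebraMap ℝ _ r) := by
      intro r
      rw [Algebra.algebraMap_eq_smul_one, mk_smul]
      refine (congrArg (fun t => f ⊗ₜ[ℝ] t) (TensorProduct.smul_tmul' r p _).symm).trans
        (TensorProduct.tmul_smul r f _)
    rw [hs]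
    induction u using CliffordAlgebra.right_induction with
    | algebraMap r =>
      have : ExteriorAlgebra.algebraMapInv (M := od →₀ ℝ)
          (algebraMap ℝ (CliffordAlgebra (0 : QuadraticForm ℝ (od →₀ ℝ))) r) = r :=
        ExteriorAlgebra.algebraMap_leftInverse _ r
      rw [this]
      erw [sub_self]
      exact Submodule.zero_mem _
    | add x y hx hy =>
      have : ExteriorAlgebra.algebraMapInv (x + y) = ExteriorAlgebra.algebraMapInv x +
        ExteriorAlgebra.algebraMapInv y := map_add _ _ _
      rw [this, mk_add, map_add, mk_add, add_sub_add_comm]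
      exact Submodule.add_mem _ hx hy
    | mul_ι m x hx =>
      have : ExteriorAlgebra.algebraMapInv (x * CliffordAlgebra.ι 0 m) = 0 := by
        refine (map_mul ExteriorAlgebra.algebraMapInv x (ExteriorAlgebra.ι ℝ m)).trans ?_
        rw [ExteriorAlgebra.algebraMapInv, ExteriorAlgebra.lift_ι_apply, LinearMap.zero_apply,
          mul_zero]
      rw [this, map_zero, mk_zero, sub_zero]
      have h := key m (mk f p x)
      rw [ofExt, mk_mul_mk, mul_one, mul_one] at h
      exact h

/-! ### Invertibility of matrices modulo the odd variables. -/

section Matrix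

variable {ι : Type} [Fintype ι] [DecidableEq ι]

/-- The entries of 1 - M lie in the ideal of the odd variables, so those of its powers lie in ever
higher powers of that ideal. Hence 1 - M is nilpotent. -/
theorem isUnit_of_map_red_eq_one [Finite od] {M : Matrix ι ι (SAlg C ev od)}
    (hM : M.map red = 1) : IsUnit M := by
  have h1 : ∀ i j, (1 - M) i j ∈ oddIdeal C ev od 1 := by
    intro i j
    have h2 := sub_ofEven_mem ((1 - M) i j)
    have h3 : red ((1 - M) i j) = 0 := by
      have h4 : red (M i j) = (1 : Matrix ι ι (C ⊗[ℝ] MvPolynomial ev ℝ)) i j := by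
        rw [← hM]; rfl
      rw [Matrix.sub_apply, map_sub, h4, Matrix.one_apply, Matrix.one_apply]
      split_ifs <;> simp
    rwa [h3, map_zero, sub_zero] at h2
  have h2 : ∀ m i j, ((1 - M) ^ (m + 1)) i j ∈ oddIdeal C ev od (m + 1) := by
    intro m
    induction m with
    | zero => simpa using h1
    | succ m ih =>
      intro i j
      rw [pow_succ', Matrix.mul_apply]
      exact Submodule.sum_mem _ fun k _ => mul_mem_oddIdeal (h1 i k) (ih k j)
  have h3 : IsNilpotent (1 - M) := by
    refine ⟨Nat.card od + 1, ?_⟩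
    ext i j
    have := h2 (Nat.card od) i j
    rw [oddIdeal_eq_bot (Nat.lt_succ_self _)] at this
    exact (Submodule.mem_bot _).mp this
  have h4 := h3.isUnit_one_sub
  rwa [sub_sub_cancel] at h4

/-- The reduced ring is commutative, so the reductions are inverse to each other on both sides. Then
M N and N M are both units, which yields a right and a left inverse of M. -/
theorem isUnit_of_map_red_mul [Finite od] {M N : Matrix ι ι (SAlg C ev od)}
    (h : M.map red * N.map red = 1) : IsUnit M := by
  have h1 : IsUnit (M * N) := isUnit_of_map_red_eq_one (by rw [← h]; exact Matrix.map_mul)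
  have h2 : IsUnit (N * M) := isUnit_of_map_red_eq_one (by
    rw [← mul_eq_one_comm.mp h]; exact Matrix.map_mul)
  obtain ⟨u, hu⟩ := h1
  obtain ⟨v, hv⟩ := h2
  refine isUnit_iff_exists_and_exists.mpr ⟨⟨N * (u⁻¹).val, ?_⟩, ⟨(v⁻¹).val * N, ?_⟩⟩
  · rw [← mul_assoc, ← hu, Units.mul_inv]
  · rw [mul_assoc, ← hv, Units.inv_mul]

theorem isUnit_of_mul_eq_one [Finite od] {M N : Matrix ι ι (SAlg C ev od)}
    (h : M * N = 1) : IsUnit N := by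
  have h1 : M.map red * N.map red = 1 := by
    rw [← Matrix.map_mul, h]
    exact Matrix.map_one _ (map_zero _) (map_one _)
  exact isUnit_of_map_red_mul (N := M) (mul_eq_one_comm.mp h1)

/-- Transposition does not reverse products over a noncommutative ring, so the transposition is
carried out after reduction. -/
theorem isUnit_of_mul_transpose_eq_one [Finite od] {M N : Matrix ι ι (SAlg C ev od)}
    (h : M * N.transpose = 1) : IsUnit N := by
  have h1 : M.map red * (N.map red).transpose = 1 := by
    rw [← Matrix.transpose_map, ← Matrix.map_mul, h]
    exact Matrix.map_one _ (map_zero _) (map_one _)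
  refine isUnit_of_map_red_mul (N := M.transpose) ?_
  have h2 := congrArg Matrix.transpose h1
  rw [Matrix.transpose_mul, Matrix.transpose_transpose, Matrix.transpose_one] at h2
  rwa [Matrix.transpose_map]

end Matrix

end SAlg

/-! ### Contraction with the presymplectic forms -/

variable {n : ℕ}

/-- Coefficients `Q_{AB}` of `𝒱_{abc} dξ^a dρ^{bc} = ∑ Q_{AB} dψ^A dψ^B`. -/
noncomputable def qCoeff : TIdx n → TIdx n → TFun n
  | Sum.inl a, Sum.inr p => calV [a, p.1.1, p.1.2] - calV [a, p.1.2, p.1.1]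
  | _, _ => 0

/-- The symmetric matrix of the presymplectic form. -/
noncomputable def sCoeff (A B : TIdx n) : TFun n := qCoeff A B + qCoeff B A

/-- The components of the contraction of a vector field with the presymplectic form. -/
noncomputable def contr (X : TVec n) (B : TIdx n) : TFun n := ∑ A, X A * sCoeff A B

/-- Passage from sums over all pairs of indices to the independent coordinates ρ^{bc} with b < c. -/
theorem sum_mul_rhoComp {R : Type} [Ring R] (F : Fin n → Fin n → R) (y : TIdx n → R) :
    ∑ b, ∑ c, F b c * rhoComp y b c =
      ∑ p : {p : Fin n × Fin n // p.1 < p.2}, (F p.1.1 p.1.2 - F p.1.2 p.1.1) * y (Sum.inr p) := by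
  classical
  let f : Fin n × Fin n → R := fun q => if h : q.1 < q.2 then y (Sum.inr ⟨q, h⟩) else 0
  have h1 : ∀ b c, F b c * rhoComp y b c = F b c * f (b, c) - F b c * f (c, b) := by
    intro b c
    simp only [rhoComp, f]
    rcases lt_trichotomy b c with h | h | h
    · simp [h, h.not_gt]
    · simp [h]
    · simp [h, h.not_gt]
  have h2 : ∀ G : Fin n × Fin n → R, ∑ q, G q * f q =
      ∑ p : {p : Fin n × Fin n // p.1 < p.2}, G p.1 * y (Sum.inr p) := by
    intro G
    have h3 : ∑ q, G q * f q = ∑ q with q.1 < q.2, G q * f q :=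
      (Finset.sum_filter_of_ne fun q _ hq => by
        by_contra h
        exact hq (by simp [f, h])).symm
    rw [h3, Finset.sum_subtype _ (p := fun q : Fin n × Fin n => q.1 < q.2) (by simp)]
    exact Finset.sum_congr rfl fun p _ => by simp [f, p.2]
  simp only [h1, Finset.sum_sub_distrib, sub_mul]
  rw [← h2 (fun q => F q.1 q.2), ← h2 (fun q => F q.2 q.1), Fintype.sum_prod_type,
    Fintype.sum_prod_type]
  congr 1
  exact Finset.sum_comm

theorem sum_sum_ite_add_ite {I M : Type*} [Fintype I] [DecidableEq I] [AddCommMonoid M]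
    (X Y : I → I → M) (k : I) :
    ∑ i, ∑ j, ((if k = i then X i j else 0) + (if k = j then Y i j else 0)) =
      ∑ j, (X k j + Y j k) := by
  simp only [Finset.sum_add_distrib, Finset.sum_ite_eq, Finset.mem_univ, if_true]
  rw [Finset.sum_comm]
  simp

/-- The ring and the additive map are arbitrary so that one computation covers the form on 𝔤[1] and
the integrand of the form on M. -/
theorem sum_calV_eq {R : Type} [Ring R] (h : TFun n →+ R) (y : TIdx n → R) :
    ∑ a, ∑ b, ∑ c, h (calV [a, b, c]) * y (Sum.inl a) * rhoComp y b c =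
      ∑ A, ∑ B, h (qCoeff A B) * y A * y B := by
  rw [Fintype.sum_sum_type]
  have h0 : ∀ p, ∑ B, h (qCoeff (Sum.inr p) B) * y (Sum.inr p) * y B = 0 := by
    intro p
    refine Finset.sum_eq_zero fun B _ => ?_
    rcases B with B | B <;> simp [qCoeff]
  simp only [h0, Finset.sum_const_zero, add_zero]
  refine Finset.sum_congr rfl fun a _ => ?_
  rw [sum_mul_rhoComp (fun b c => h (calV [a, b, c]) * y (Sum.inl a)), Fintype.sum_sum_type]
  simp [qCoeff, sub_mul]

/-- Elements of the exterior algebra as functions, as a ring homomorphism. -/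
noncomputable def SAlg.ofExtHom (C : Type) [CommRing C] [Algebra ℝ C] (ev od : Type) :
    ExteriorAlgebra ℝ (od →₀ ℝ) →+* SAlg C ev od where
  toFun := SAlg.ofExt C ev
  map_one' := rfl
  map_mul' := SAlg.ofExt_mul
  map_zero' := SAlg.mk_zero _ _
  map_add' := SAlg.mk_add _ _

theorem SAlg.ofExt_eq_zero {ev od : Type} {u : ExteriorAlgebra ℝ (od →₀ ℝ)}
    (h : SAlg.ofExt ℝ ev u = 0) : u = 0 := by
  let R : SAlg ℝ ev od →ₐ[ℝ] ExteriorAlgebra ℝ (od →₀ ℝ) :=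
    (Algebra.TensorProduct.lid ℝ _).toAlgHom.comp (Algebra.TensorProduct.map (AlgHom.id ℝ ℝ)
      ((Algebra.TensorProduct.lid ℝ _).toAlgHom.comp (Algebra.TensorProduct.map
        (MvPolynomial.aeval (fun _ => 0)) (AlgHom.id ℝ _))))
  have h1 : R (SAlg.ofExt ℝ ev u) =
      (1 : ℝ) • (MvPolynomial.aeval (fun _ : ev => (0 : ℝ)) (1 : MvPolynomial ev ℝ)) • u := rfl
  rw [h, map_zero, map_one, one_smul, one_smul] at h1
  exact h1.symm

theorem SAlg.dEven_ofExt {C : Type} [CommRing C] [Algebra ℝ C] {ev od : Type} (i : ev)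
    (u : ExteriorAlgebra ℝ (od →₀ ℝ)) : SAlg.dEven i (SAlg.ofExt C ev u) = 0 := by
  rw [ofExt, dEven_mk, Derivation.map_one_eq_zero, mk_zero_mid]

/-- The differentials dψ^A are even, so both factors of dψ^A dψ^B contribute with the same sign and
the coefficients are symmetrised into `sCoeff`. -/
theorem tIota_omegaT (X : TVec n) :
    tIota X (omegaT n) = ∑ B, SAlg.ofExt ℝ (TIdx n) (contr X B) * tD B := by
  classical
  have h1 : omegaT n = ∑ A, ∑ B, SAlg.ofExt ℝ (TIdx n) (qCoeff A B) * tD A * tD B :=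
    sum_calV_eq (SAlg.ofExtHom ℝ (TIdx n) (TIdx n)).toAddMonoidHom tD
  have h2 : ∀ C A B : TIdx n, SAlg.dEven C (SAlg.ofExt ℝ (TIdx n) (qCoeff A B) * tD A * tD B) =
      (if C = A then SAlg.ofExt ℝ (TIdx n) (qCoeff A B) * tD B else 0) +
      (if C = B then SAlg.ofExt ℝ (TIdx n) (qCoeff A B) * tD A else 0) := by
    intro C A B
    rw [SAlg.dEven_mul, SAlg.dEven_mul, SAlg.dEven_ofExt, tD, tD, SAlg.dEven_even,
      SAlg.dEven_even]
    split_ifs <;> simp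
  have h3 : ∀ B, SAlg.ofExt ℝ (TIdx n) (contr X B) =
      ∑ A, (SAlg.ofExt ℝ (TIdx n) (X A) * SAlg.ofExt ℝ (TIdx n) (qCoeff A B) +
        SAlg.ofExt ℝ (TIdx n) (X A) * SAlg.ofExt ℝ (TIdx n) (qCoeff B A)) := by
    intro B
    have := map_sum (SAlg.ofExtHom ℝ (TIdx n) (TIdx n)) (fun A => X A * sCoeff A B) Finset.univ
    refine this.trans (Finset.sum_congr rfl fun A _ => ?_)
    rw [sCoeff, mul_add, map_add, map_mul, map_mul]; rfl
  rw [tIota, h1]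
  simp only [h3, map_sum, h2, sum_sum_ite_add_ite, Finset.mul_sum, Finset.sum_mul, mul_add, add_mul,
    ← mul_assoc]
  exact Finset.sum_comm

theorem tIota_omegaT_eq_zero_iff (X : TVec n) : tIota X (omegaT n) = 0 ↔ ∀ B, contr X B = 0 := by
  classical
  rw [tIota_omegaT]
  constructor
  · intro h B
    -- The coefficient of dψ^B is read off by differentiating with respect to it.
    have h1 := congrArg (SAlg.dEven B) h
    simp only [map_sum, SAlg.dEven_mul, SAlg.dEven_ofExt, tD, SAlg.dEven_even, zero_mul, zero_add,
      mul_ite, mul_one, mul_zero, Finset.sum_ite_eq, Finset.mem_univ, if_true, map_zero] at h1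
    exact SAlg.ofExt_eq_zero h1
  · intro h
    refine Finset.sum_eq_zero fun B _ => ?_
    rw [h B, SAlg.ofExt, SAlg.mk_zero, zero_mul]

/-! ### Berezin integration is nondegenerate -/

namespace SAlg

variable {C : Type} [CommRing C] [Algebra ℝ C] {ev od : Type}

theorem thetaCoeff_univ_mono_mul (S T : Finset (Fin n)) :
    (T ≠ Sᶜ ∧ thetaCoeff Finset.univ (mono (theta C ev od) S * mono (theta C ev od) T) = 0) ∨
    (T = Sᶜ ∧ (thetaCoeff Finset.univ (mono (theta C ev od) S * mono (theta C ev od) T) = 1 ∨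
      thetaCoeff Finset.univ (mono (theta C ev od) S * mono (theta C ev od) T) = -1)) := by
  have h1 : T = Sᶜ ↔ Disjoint S T ∧ S ∪ T = Finset.univ := by
    constructor
    · rintro rfl; exact ⟨disjoint_compl_right, by simp⟩
    · rintro ⟨h, h'⟩
      exact (IsCompl.of_eq (Finset.disjoint_iff_inter_eq_empty.mp h) h').compl_eq.symm
  rcases (anticomm_theta (C := C) (ev := ev) (od := od)).mono_mul_mono S T with
    ⟨h, h2⟩ | ⟨h, h2⟩
  · exact Or.inl ⟨fun h' => h (h1.mp h').1, by rw [h2, thetaCoeff_zero]⟩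
  · by_cases h3 : S ∪ T = Finset.univ
    · refine Or.inr ⟨h1.mpr ⟨h, h3⟩, ?_⟩
      rw [h3] at h2
      rcases h2 with h2 | h2
      · left; rw [h2, thetaCoeff_mono, if_pos rfl]
      · right; rw [h2, thetaCoeff_neg, thetaCoeff_mono, if_pos rfl]
    · refine Or.inl ⟨fun h' => h3 (h1.mp h').2, ?_⟩
      rcases h2 with h2 | h2
      · rw [h2, thetaCoeff_mono, if_neg (Ne.symm h3)]
      · rw [h2, thetaCoeff_neg, thetaCoeff_mono, if_neg (Ne.symm h3), neg_zero]

theorem thetaCoeff_mono_mul (S T : Finset (Fin n)) (F : SAlg C ev (od ⊕ Fin n)) :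
    thetaCoeff T (mono (theta C ev od) S * F) =
      ∑ R, (par ^ S.card) (thetaCoeff R F) *
        thetaCoeff T (mono (theta C ev od) S * mono (theta C ev od) R) := by
  conv_lhs => rw [← expansion F]
  rw [Finset.mul_sum, thetaCoeff_sum]
  refine Finset.sum_congr rfl fun R _ => ?_
  rw [← mul_assoc, mono_theta_mul, par_pow_incl, mul_assoc, thetaCoeff_tin_mul]

/-- Integration against the complementary monomial isolates the coefficient of θ^T, up to a sign and
a power of the parity involution, neither of which has a kernel. -/
theorem eq_zero_of_berezin {F : SAlg C ev (od ⊕ Fin n)}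
    (h : ∀ S, berezin (mono (theta C ev od) S * F) = 0) : F = 0 := by
  refine ext_thetaCoeff fun T => ?_
  rw [thetaCoeff_zero]
  have h1 := h Tᶜ
  rw [berezin, thetaCoeff_mono_mul, Finset.sum_eq_single T] at h1
  · have h3 : (par ^ Tᶜ.card) (thetaCoeff T F) = 0 := by
      rcases thetaCoeff_univ_mono_mul (C := C) (ev := ev) (od := od) Tᶜ T with
        ⟨h2, -⟩ | ⟨-, h2 | h2⟩
      · simp at h2
      · rwa [h2, mul_one] at h1
      · rwa [h2, mul_neg, mul_one, neg_eq_zero] at h1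
    rcases Nat.even_or_odd Tᶜ.card with h4 | h4
    · rwa [par_pow_even h4] at h3
    · rw [par_pow_odd h4] at h3
      rw [← par_par (thetaCoeff T F), h3, map_zero]
  · intro R _ hR
    rcases thetaCoeff_univ_mono_mul (C := C) (ev := ev) (od := od) Tᶜ R with ⟨-, h2⟩ | ⟨h2, -⟩
    · rw [h2, mul_zero]
    · exact absurd (by simpa using h2) hR
  · simp

end SAlg

/-! ### Derivatives of forms with respect to differentials -/

open SAlg

variable {U : Opens (BodySpace n)}

theorem par_dCoord (c : Coord n) : par (dCoord U c) = (-1 : ℝ) ^ c.2.card • dCoord U c := by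
  unfold dCoord
  split_ifs with h
  · rw [par_odd, h.neg_one_pow, neg_one_smul]
  · rw [par_even, (Nat.not_odd_iff_even.mp h).neg_one_pow, one_smul]

theorem dCoord_incl_mul {ev' od' : Type} (f : EvIdx n ⊕ OdIdx n → ev')
    (g : OdIdx n ⊕ EvIdxAll n → od') (c : Coord n) (x : SAlg (Smooth U) ev' od') :
    incl f g (dCoord U c) * x = (par ^ c.2.card) x * incl f g (dCoord U c) := by
  unfold dCoord
  split_ifs with h
  · rw [incl_odd, odd_mul, par_pow_odd h]
  · rw [incl_even, even_mul, par_pow_even (Nat.not_odd_iff_even.mp h)]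

theorem partialD_dCoord (c c' : Coord n) [Decidable (c = c')] :
    partialD c (dCoord U c') = if c = c' then 1 else 0 := by
  classical
  unfold partialD dCoord
  by_cases h : Odd c.2.card <;> by_cases h' : Odd c'.2.card
  · rw [dif_pos h, dif_pos h']
    split_ifs with hc
    · subst hc; exact dOdd_odd_self _
    · exact dOdd_odd_of_ne (by simpa using Ne.symm hc)
  · rw [dif_pos h, dif_neg h', dOdd_even, if_neg (by rintro rfl; exact h' h)]
  · rw [dif_neg h, dif_pos h', dEven_odd, if_neg (by rintro rfl; exact h h')]
  · rw [dif_neg h, dif_neg h', dEven_even]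
    simp

theorem partialD_toForm (c : Coord n) (f : Fn U) : partialD c (Fn.toForm U f) = 0 := by
  unfold partialD
  split_ifs with h
  · exact dOdd_incl_of_notMem _ (by simp) _
  · exact dEven_incl_of_notMem (by simp) _ _

theorem partialD_mul (c : Coord n) (x y : Form U) :
    partialD c (x * y) = partialD c x * y + (par ^ c.2.card) x * partialD c y := by
  unfold partialD
  split_ifs with h
  · rw [dOdd_mul, par_pow_odd h]
  · rw [dEven_mul, par_pow_even (Nat.not_odd_iff_even.mp h)]

/-- The derivative of a `θ`-dependent form with respect to the differential of a coordinate. -/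
noncomputable def partialDTheta (c : Coord n) : FormTheta U →ₗ[ℝ] FormTheta U :=
  if h : Odd c.2.card then dOdd (Sum.inl (Sum.inr ⟨c, h⟩))
  else dEven (Sum.inr ⟨c, Nat.not_odd_iff_even.mp h⟩)

theorem partialDTheta_mul (c : Coord n) (x y : FormTheta U) :
    partialDTheta c (x * y) = partialDTheta c x * y + (par ^ c.2.card) x * partialDTheta c y := by
  unfold partialDTheta
  split_ifs with h
  · rw [dOdd_mul, par_pow_odd h]
  · rw [dEven_mul, par_pow_even (Nat.not_odd_iff_even.mp h)]

theorem thetaCoeff_partialDTheta (S : Finset (Fin n)) (c : Coord n) (F : FormTheta U) :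
    thetaCoeff S (partialDTheta c F) = partialD c (thetaCoeff S F) := by
  unfold partialDTheta partialD
  split_ifs with h
  · exact thetaCoeff_comm (fun μ x => dOddRight_dOdd _ _ _) (fun x => dropTheta_dOdd _ _) _ _
  · exact thetaCoeff_comm (fun μ x => dOddRight_dEven _ _ _) (fun x => dropTheta_dEven _ _) _ _

theorem partialDTheta_toForm (c : Coord n) (F : FnTheta U) :
    partialDTheta c (FnTheta.toForm U F) = 0 := by
  unfold partialDTheta
  split_ifs with h
  · exact dOdd_incl_of_notMem _ (by simp) _
  · exact dEven_incl_of_notMem (by simp) _ _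

theorem partialDTheta_tin (c : Coord n) (x : Form U) :
    partialDTheta c (tin n x) = tin n (partialD c x) := by
  unfold partialDTheta partialD
  split_ifs with h
  · exact dOdd_incl _ Sum.inl_injective _ _
  · exact dEven_incl Function.injective_id _ _ _

theorem thetaCoeff_toForm (S : Finset (Fin n)) (F : FnTheta U) :
    thetaCoeff S (FnTheta.toForm U F) = Fn.toForm U (thetaCoeff S F) := by
  refine thetaCoeff_comm (fun μ x => ?_) (fun x => dropTheta_incl _ _ _) S F
  exact dOddRight_incl _ (Function.Injective.sumMap Sum.inl_injective Function.injective_id)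
    (Sum.inr μ) x

theorem toForm_theta (μ : Fin n) :
    FnTheta.toForm U (theta _ _ _ μ) = theta _ _ _ μ := incl_odd _ _ _

theorem toForm_mono_theta (S : Finset (Fin n)) :
    FnTheta.toForm U (mono (theta _ _ _) S) = mono (theta _ _ _) S := by
  rw [map_mono]
  simp only [toForm_theta]

theorem toForm_tin (f : Fn U) : FnTheta.toForm U (tin n f) = tin n (Fn.toForm U f) :=
  (incl_incl id Sum.inl Sum.inl (Sum.map Sum.inl id) f).trans
    (incl_incl Sum.inl Sum.inl id Sum.inl f).symm

theorem Fn.toForm_injective : Function.Injective (Fn.toForm U) :=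
  incl_injective Sum.inl_injective Sum.inl_injective

theorem dPsiTheta_eq (A : TIdx n) :
    dPsiTheta U A = ∑ S, tin n (dCoord U (A, S)) * mono (theta _ _ _) S := by
  simp only [dPsiTheta, thetaMonomial_eq]

/-- The differential of ψ^A_S has the parity of |S|, as does θ^S, so every term of the generating
function is even. -/
theorem par_dPsiTheta (A : TIdx n) : par (dPsiTheta U A) = dPsiTheta U A := by
  rw [dPsiTheta_eq, map_sum]
  refine Finset.sum_congr rfl fun S _ => ?_
  rw [map_mul, par_incl, par_dCoord, par_mono_theta, map_smul, smul_mul_assoc, mul_smul_comm,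
    smul_smul, ← mul_pow]
  simp

theorem par_pow_dPsiTheta (k : ℕ) (A : TIdx n) : (par ^ k) (dPsiTheta U A) = dPsiTheta U A := by
  induction k with
  | zero => rfl
  | succ k ih => rw [par_pow_succ, par_dPsiTheta, ih]

/-- Moving θ^S and then the differential past x applies the parity involution 2|S| times, so dψ^A(θ)
is central. -/
theorem dPsiTheta_mul (A : TIdx n) (x : FormTheta U) : dPsiTheta U A * x = x * dPsiTheta U A := by
  rw [dPsiTheta_eq, Finset.sum_mul, Finset.mul_sum]
  refine Finset.sum_congr rfl fun S _ => ?_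
  rw [mul_assoc, mono_theta_mul, ← mul_assoc, dCoord_incl_mul, mul_assoc, ← par_pow_add,
    par_pow_even ⟨_, rfl⟩]

theorem partialDTheta_dPsiTheta (c : Coord n) (A : TIdx n) [Decidable (c.1 = A)] :
    partialDTheta c (dPsiTheta U A) = if c.1 = A then mono (theta _ _ _) c.2 else 0 := by
  classical
  rw [dPsiTheta_eq, map_sum]
  have h : ∀ S, partialDTheta c (tin n (dCoord U (A, S)) * mono (theta _ _ _) S) =
      if c = (A, S) then mono (theta _ _ _) S else 0 := by
    intro S
    rw [partialDTheta_mul, partialDTheta_tin, partialD_dCoord, ← toForm_mono_theta,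
      partialDTheta_toForm]
    split_ifs <;> simp
  simp only [h, Prod.ext_iff]
  split_ifs with hA
  · simp [hA]
  · simp [hA]

/-- The generating function `V^A(θ)` of the components of a vector field. -/
noncomputable def vTheta (V : Vec U) (A : TIdx n) : FnTheta U :=
  ∑ S, tin n (V (A, S)) * mono (theta _ _ _) S

/-- The 1-form `∫ dⁿθ ∑ F_B(θ) dψ^B(θ)`. -/
noncomputable def intForm (F : TIdx n → FnTheta U) : Form U :=
  berezin (∑ B, FnTheta.toForm U (F B) * dPsiTheta U B)

theorem partialD_intForm (c : Coord n) (F : TIdx n → FnTheta U) :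
    partialD c (intForm F) = Fn.toForm U (berezin (mono (theta _ _ _) c.2 * F c.1)) := by
  classical
  rw [intForm, berezin, ← thetaCoeff_partialDTheta, berezin, ← thetaCoeff_toForm, map_sum]
  congr 1
  simp only [partialDTheta_mul, partialDTheta_toForm, zero_mul, zero_add, partialDTheta_dPsiTheta,
    mul_ite, mul_zero, Finset.sum_ite_eq, Finset.mem_univ, if_true]
  rw [map_mul, toForm_mono_theta, mono_theta_mul]

theorem iota_intForm (W : Vec U) (F : TIdx n → FnTheta U) :
    iota W (intForm F) = Fn.toForm U (berezin (∑ B, vTheta W B * F B)) := by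
  simp only [iota, partialD_intForm, ← map_mul, ← map_sum]
  congr 1
  rw [berezin, thetaCoeff_sum, Fintype.sum_prod_type]
  refine Finset.sum_congr rfl fun B _ => ?_
  rw [vTheta, Finset.sum_mul, thetaCoeff_sum]
  refine Finset.sum_congr rfl fun S _ => ?_
  rw [mul_assoc, thetaCoeff_tin_mul]; rfl

/-- Differentiation with respect to dψ^B_S produces ∫dⁿθ θ^S F_B(θ), and these integrals over all S
determine F_B. -/
theorem intForm_eq_zero_iff (F : TIdx n → FnTheta U) : intForm F = 0 ↔ ∀ B, F B = 0 := by
  constructor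
  · intro h B
    refine eq_zero_of_berezin fun S => Fn.toForm_injective ?_
    rw [map_zero, ← partialD_intForm (B, S) F, h, map_zero]
  · intro h
    rw [intForm, Finset.sum_eq_zero fun B _ => by rw [h B, map_zero, zero_mul], berezin,
      thetaCoeff_zero]

theorem omegaM_eq : omegaM U = berezin (∑ A, ∑ B, FnTheta.toForm U (subst U (qCoeff A B)) *
    dPsiTheta U A * dPsiTheta U B) :=
  congrArg berezin (sum_calV_eq
    ((FnTheta.toForm U).comp (subst U) : TFun n →+* FormTheta U).toAddMonoidHom (dPsiTheta U))

/-- The contraction of a vector field with the presymplectic form, as functions of `θ`. -/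
noncomputable def contrTheta (V : Vec U) (B : TIdx n) : FnTheta U :=
  ∑ A, vTheta V A * subst U (sCoeff A B)

/-- The analogue of `tIota_omegaT` under the integral. The monomial θ^S produced by ∂/∂(dψ^A_S)
joins V^A_S to form V^A(θ), placed to the left of the coefficient S_{AB}(ξ(θ)). -/
theorem iota_omegaM (V : Vec U) : iota V (omegaM U) = intForm (contrTheta V) := by
  classical
  have h1 : ∀ c : Coord n, ∀ A B, partialDTheta c (FnTheta.toForm U (subst U (qCoeff A B)) *
      dPsiTheta U A * dPsiTheta U B) =
      (if c.1 = A then FnTheta.toForm U (mono (theta _ _ _) c.2 * subst U (qCoeff A B)) *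
        dPsiTheta U B else 0) +
      (if c.1 = B then FnTheta.toForm U (mono (theta _ _ _) c.2 * subst U (qCoeff A B)) *
        dPsiTheta U A else 0) := by
    intro c A B
    have h0 : FnTheta.toForm U (mono (theta _ _ _) c.2 * subst U (qCoeff A B)) =
        (par ^ c.2.card) (FnTheta.toForm U (subst U (qCoeff A B))) * mono (theta _ _ _) c.2 := by
      rw [map_mul, toForm_mono_theta, mono_theta_mul]
    rw [partialDTheta_mul, partialDTheta_mul, partialDTheta_toForm, zero_mul, zero_add,
      partialDTheta_dPsiTheta, partialDTheta_dPsiTheta, h0, map_mul, par_pow_dPsiTheta]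
    split_ifs <;> simp [mul_assoc, dPsiTheta_mul]
  rw [iota, omegaM_eq, intForm]
  have h2 : ∀ c : Coord n, Fn.toForm U (V c) * partialD c (berezin (∑ A, ∑ B,
      FnTheta.toForm U (subst U (qCoeff A B)) * dPsiTheta U A * dPsiTheta U B)) =
      berezin (∑ B, FnTheta.toForm U (tin n (V c) * mono (theta _ _ _) c.2 *
        subst U (sCoeff c.1 B)) * dPsiTheta U B) := by
    intro c
    rw [berezin, ← thetaCoeff_partialDTheta, ← thetaCoeff_tin_mul]
    unfold berezin
    congr 1
    simp only [map_sum, h1, sum_sum_ite_add_ite, Finset.mul_sum]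
    refine Finset.sum_congr rfl fun B _ => ?_
    rw [sCoeff, map_add, mul_assoc, map_mul (FnTheta.toForm U) (tin n (V c)), toForm_tin]
    simp only [mul_add, map_add, add_mul, mul_assoc]
  rw [Finset.sum_congr rfl fun c _ => h2 c]
  unfold berezin
  rw [← thetaCoeff_sum, Finset.sum_comm]
  congr 1
  refine Finset.sum_congr rfl fun B _ => ?_
  rw [← Finset.sum_mul, ← map_sum, Fintype.sum_prod_type]
  congr 2
  refine Finset.sum_congr rfl fun A _ => ?_
  rw [vTheta, Finset.sum_mul]


open SAlg

variable {n : ℕ}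

/-! ### Derivatives of `𝒱` -/

/-- The sum defining `𝒱`, without the normalising factor. -/
noncomputable def epsSum (m : ℕ) (l : List (Fin n)) : TFun n :=
  ∑ b : Fin m → Fin n, eps (l ++ List.ofFn b) • (List.ofFn fun i => xi (b i)).prod

theorem calV_eq (l : List (Fin n)) :
    calV l = (1 / (Nat.factorial (n - l.length) : ℝ)) • epsSum (n - l.length) l := rfl

/-- Exchanging two neighbouring indices exchanges two rows of the determinant defining ε. -/
theorem eps_swap {l : List (Fin n)} (hl : l.length + 1 < n) (a b : Fin n) (r : List (Fin n)) :
    eps (l ++ a :: b :: r) = -eps (l ++ b :: a :: r) := by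
  classical
  let i : Fin n := ⟨l.length, by omega⟩
  let j : Fin n := ⟨l.length + 1, hl⟩
  have hij : i ≠ j := by simp [i, j, Fin.ext_iff]
  have h := Matrix.det_permute (Equiv.swap i j) (Matrix.of fun i j : Fin n =>
    if (l ++ b :: a :: r)[(i : ℕ)]? = some j then (1 : ℝ) else 0)
  rw [Equiv.Perm.sign_swap hij] at h
  simp only [Units.val_neg, Units.val_one, Int.cast_neg, Int.cast_one, neg_one_mul] at h
  rw [eps, eps, ← h]
  congr 1
  ext k m
  have : (l ++ a :: b :: r)[(k : ℕ)]? = (l ++ b :: a :: r)[((Equiv.swap i j k : Fin n) : ℕ)]? := by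
    by_cases hi : k = i
    · subst hi
      simp [i, j]
    · by_cases hj : k = j
      · subst hj
        simp [i, j]
      · rw [Equiv.swap_apply_of_ne_of_ne hi hj]
        rcases lt_or_ge (k : ℕ) l.length with hk | hk
        · rw [List.getElem?_append_left hk, List.getElem?_append_left hk]
        · have hk2 : l.length + 2 ≤ k := by
            simp only [i, j, Fin.ext_iff] at hi hj
            omega
          rw [List.getElem?_append_right hk, List.getElem?_append_right hk]
          obtain ⟨q, hq⟩ : ∃ q, (k : ℕ) - l.length = q + 2 := ⟨k - l.length - 2, by omega⟩
          simp [hq]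
  simp only [Matrix.of_apply, this, Matrix.submatrix_apply, id]

theorem epsSum_swap (m : ℕ) {l : List (Fin n)} (hl : l.length + 1 < n) (a b : Fin n) :
    epsSum m (l ++ [a, b]) = -epsSum m (l ++ [b, a]) := by
  rw [epsSum, epsSum, ← Finset.sum_neg_distrib]
  refine Finset.sum_congr rfl fun c _ => ?_
  rw [List.append_assoc, List.append_assoc, ← neg_smul]
  congr 1
  exact eps_swap hl a b _

theorem epsSum_succ (m : ℕ) (l : List (Fin n)) :
    epsSum (m + 1) l = ∑ c, xi c * epsSum m (l ++ [c]) := by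
  rw [epsSum, ← (Fin.consEquiv fun _ => Fin n).sum_comp, Fintype.sum_prod_type]
  refine Finset.sum_congr rfl fun c _ => ?_
  rw [epsSum, Finset.mul_sum]
  refine Finset.sum_congr rfl fun b _ => ?_
  simp [List.ofFn_succ, Fin.consEquiv]

/-- The left derivative `∂/∂ψ^A` on the target. -/
noncomputable abbrev dT (A : TIdx n) : TFun n →ₗ[ℝ] TFun n :=
  CliffordAlgebra.contractLeft (Finsupp.lapply A)

theorem dT_tCoord_mul (A B : TIdx n) [Decidable (A = B)] (x : TFun n) :
    dT A (tCoord B * x) = (if A = B then x else 0) - tCoord B * dT A x := by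
  have h := CliffordAlgebra.contractLeft_ι_mul (Q := (0 : QuadraticForm ℝ (TIdx n →₀ ℝ)))
    (Finsupp.lapply A) (Finsupp.single B 1) x
  refine h.trans ?_
  congr 1
  split_ifs with h
  · subst h; simp
  · simp [Finsupp.single_eq_of_ne h]

theorem dT_one (A : TIdx n) : dT A 1 = 0 := CliffordAlgebra.contractLeft_one _ _

theorem dT_rho_epsSum (p) (m : ℕ) (l : List (Fin n)) : dT (Sum.inr p) (epsSum m l) = 0 := by
  classical
  induction m generalizing l with
  | zero => simp [epsSum]
  | succ m ih =>
    rw [epsSum_succ, map_sum]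
    refine Finset.sum_eq_zero fun c _ => ?_
    rw [xi, dT_tCoord_mul, ih, if_neg (by simp)]
    simp

/-- Split off the leading ξ^c. Differentiating it gives one copy of the result. In the other term,
the sign from passing ξ^c cancels the sign from exchanging c and a in ε, so the induction adds m + 1
equal contributions. -/
theorem dT_xi_epsSum (a : Fin n) (m : ℕ) (l : List (Fin n)) (hl : l.length + m + 1 = n) :
    dT (Sum.inl a) (epsSum (m + 1) l) = (m + 1 : ℝ) • epsSum m (l ++ [a]) := by
  classical
  induction m generalizing l with
  | zero =>
    rw [epsSum_succ, map_sum]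
    have : ∀ l : List (Fin n), dT (Sum.inl a) (epsSum 0 l) = 0 := fun l => by simp [epsSum]
    simp only [xi, dT_tCoord_mul, this]
    simp
  | succ m ih =>
    rw [epsSum_succ, map_sum]
    have h1 : ∀ c, dT (Sum.inl a) (xi c * epsSum (m + 1) (l ++ [c])) =
        (if a = c then epsSum (m + 1) (l ++ [c]) else 0) +
          (m + 1 : ℝ) • (xi c * epsSum m ((l ++ [a]) ++ [c])) := by
      intro c
      rw [xi, dT_tCoord_mul, ih (l ++ [c]) (by simp; omega), List.append_assoc, List.append_assoc,
        List.singleton_append, List.singleton_append, epsSum_swap m (by omega) c a]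
      simp
    rw [Finset.sum_congr rfl fun c _ => h1 c, Finset.sum_add_distrib, ← Finset.smul_sum,
      ← epsSum_succ]
    simp only [Finset.sum_ite_eq, Finset.mem_univ, if_true]
    push_cast
    module

theorem dT_rho_calV (p) (l : List (Fin n)) : dT (Sum.inr p) (calV l) = 0 := by
  rw [calV_eq, map_smul, dT_rho_epsSum, smul_zero]

/-- The factorial normalisation of 𝒱 absorbs the factor from `dT_xi_epsSum`. Thus every 𝒱 with
indices is an iterated derivative of 𝒱 without indices. -/
theorem dT_xi_calV (a : Fin n) {l : List (Fin n)} (hl : l.length < n) :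
    dT (Sum.inl a) (calV l) = calV (l ++ [a]) := by
  obtain ⟨m, hm⟩ : ∃ m, n - l.length = m + 1 := ⟨n - l.length - 1, by omega⟩
  rw [calV_eq, calV_eq, map_smul, List.length_append, List.length_singleton, ← Nat.sub_sub, hm,
    dT_xi_epsSum a m l (by omega), smul_smul, Nat.add_sub_cancel]
  congr 1
  rw [Nat.factorial_succ]
  have := Nat.factorial_ne_zero m
  push_cast
  field_simp

theorem dT_comm (A B : TIdx n) (x : TFun n) : dT A (dT B x) = -dT B (dT A x) :=
  CliffordAlgebra.contractLeft_comm _ _ _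

theorem calV_three (hn : 3 ≤ n) (a b c : Fin n) :
    calV [a, b, c] = dT (Sum.inl c) (dT (Sum.inl b) (dT (Sum.inl a) (calV []))) := by
  rw [dT_xi_calV a (by simp; omega), List.nil_append, dT_xi_calV b (by simp; omega),
    dT_xi_calV c (by simp; omega)]
  rfl

/-- Closedness of the form on 𝔤[1]. The coefficients are third derivatives of one function, and
exchanging two anticommuting odd derivatives changes the sign. -/
theorem dT_qCoeff (hn : 3 ≤ n) (A B C : TIdx n) :
    dT C (qCoeff A B) + dT A (qCoeff C B) = 0 := by
  have h0 : ∀ (p) (A B : TIdx n), dT (Sum.inr p) (qCoeff A B) = 0 := by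
    intro p A B
    rcases A with a | a <;> rcases B with b | b <;> simp [qCoeff, dT_rho_calV]
  have h1 : ∀ p (B : TIdx n), qCoeff (Sum.inr p) B = 0 := fun p B => by cases B <;> rfl
  rcases A with a | a <;> rcases C with c | c
  · rcases B with b | b
    · simp [qCoeff]
    · simp only [qCoeff, map_sub, calV_three hn]
      have h2 : ∀ b b' : TIdx n, ∀ x : TFun n, dT (Sum.inl c) (dT b (dT b' (dT (Sum.inl a) x))) +
          dT (Sum.inl a) (dT b (dT b' (dT (Sum.inl c) x))) = 0 := by
        intro b b' x
        rw [dT_comm _ b, dT_comm _ b', dT_comm (Sum.inl c) (Sum.inl a), dT_comm (Sum.inl a) b,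
          dT_comm (Sum.inl a) b']
        simp
      rw [sub_add_sub_comm, h2, h2, sub_zero]
  · rw [h0, h1, map_zero, add_zero]
  · rw [h0, h1, map_zero, add_zero]
  · rw [h1, h1, map_zero, map_zero, add_zero]

/-! ### Coordinate derivatives and the de Rham differential -/

variable {U : Opens (BodySpace n)}

theorem bodyDeriv_mul (b : BodyIdx n) (f g : Smooth U) :
    bodyDeriv b (f * g) = bodyDeriv b f * g + f * bodyDeriv b g := by
  ext x
  have h : ext0 (f * g).1 = ext0 f.1 * ext0 g.1 := by
    funext y
    by_cases hy : y ∈ U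
    · rw [Pi.mul_apply, ext0_apply _ hy, ext0_apply _ hy, ext0_apply _ hy]; rfl
    · have : ¬ ∃ a : U, a.1 = y := fun ⟨a, ha⟩ => hy (ha ▸ a.2)
      simp [ext0, Function.extend_apply' _ _ _ this]
  change fderiv ℝ (ext0 (f * g).1) x.1 _ = fderiv ℝ (ext0 f.1) x.1 _ * g.1 x +
    f.1 x * fderiv ℝ (ext0 g.1) x.1 _
  rw [h, fderiv_mul (ext0_differentiableAt f x.2) (ext0_differentiableAt g x.2),
    ext0_apply _ x.2, ext0_apply _ x.2]
  simp only [add_apply, smul_apply, smul_eq_mul]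
  ring

/-- `D` is a derivation. -/
def IsDeriv {C : Type} [CommRing C] [Algebra ℝ C] (D : C →ₗ[ℝ] C) : Prop :=
  ∀ f g, D (f * g) = D f * g + f * D g

theorem IsDeriv.map_one {C : Type} [CommRing C] [Algebra ℝ C] {D : C →ₗ[ℝ] C} (hD : IsDeriv D) :
    D 1 = 0 := by
  have h := hD 1 1
  simpa using h

/-- The linear endomorphisms of an algebra. -/
abbrev LinEnd (C : Type) [CommRing C] [Algebra ℝ C] : Type := C →ₗ[ℝ] C

/-- The derivative with respect to a coordinate of degree `0`, for the module structure that comes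
from the algebra structure. -/
noncomputable def bodyD (U : Opens (BodySpace n)) (b : BodyIdx n) : LinEnd (Smooth U) :=
  bodyDeriv b

theorem isDeriv_bodyD (b : BodyIdx n) : IsDeriv (bodyD U b) := bodyDeriv_mul b

theorem bodyD_bodyCoord_self (b : BodyIdx n) : bodyD U b (bodyCoord U b) = 1 := by
  ext x
  have h : ext0 (bodyCoord U b).1 =ᶠ[nhds x.1] fun y => y b := by
    filter_upwards [U.isOpen.mem_nhds x.2] with y hy
    rw [ext0_apply _ hy]; rfl
  change fderiv ℝ (ext0 (bodyCoord U b).1) x.1 (Pi.single b 1) = 1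
  rw [h.fderiv_eq, fderiv_apply differentiableAt_fun_id, fderiv_fun_id]
  simp

theorem bodyD_bodyCoord_of_ne {b b' : BodyIdx n} (hb : b ≠ b') :
    bodyD U b (bodyCoord U b') = 0 := by
  ext x
  have h : ext0 (bodyCoord U b').1 =ᶠ[nhds x.1] fun y => y b' := by
    filter_upwards [U.isOpen.mem_nhds x.2] with y hy
    rw [ext0_apply _ hy]; rfl
  change fderiv ℝ (ext0 (bodyCoord U b').1) x.1 (Pi.single b 1) = 0
  rw [h.fderiv_eq, fderiv_apply differentiableAt_fun_id, fderiv_fun_id]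
  simp [Pi.single_eq_of_ne (Ne.symm hb)]

/-- The left partial derivative of a function with respect to a coordinate. -/
noncomputable def partialFn (c : Coord n) : Fn U →ₗ[ℝ] Fn U :=
  if h₁ : c.2.card = 1 then SAlg.onCoeff (bodyD U ⟨c, h₁⟩)
  else if h₂ : Odd c.2.card then SAlg.dEven ⟨c, h₂, h₁⟩
  else SAlg.dOdd ⟨c, Nat.not_odd_iff_even.mp h₂⟩

/-- The left partial derivative of a `θ`-dependent form with respect to a coordinate. -/
noncomputable def partialCoordTheta (c : Coord n) : FormTheta U →ₗ[ℝ] FormTheta U :=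
  if h₁ : c.2.card = 1 then SAlg.onCoeff (bodyD U ⟨c, h₁⟩)
  else if h₂ : Odd c.2.card then SAlg.dEven (Sum.inl ⟨c, h₂, h₁⟩)
  else SAlg.dOdd (Sum.inl (Sum.inl ⟨c, Nat.not_odd_iff_even.mp h₂⟩))

theorem partialCoord_eq (c : Coord n) : (partialCoord c : Form U →ₗ[ℝ] Form U) =
    if h₁ : c.2.card = 1 then SAlg.onCoeff (bodyD U ⟨c, h₁⟩)
    else if h₂ : Odd c.2.card then SAlg.dEven (Sum.inl ⟨c, h₂, h₁⟩)
    else SAlg.dOdd (Sum.inl ⟨c, Nat.not_odd_iff_even.mp h₂⟩) := rfl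

/-- The coordinate ψ^A_S has the parity of |S| + 1, which accounts for the exponent of the
involution. -/
theorem partialFn_mul (c : Coord n) (x y : Fn U) :
    partialFn c (x * y) = partialFn c x * y + (par ^ (c.2.card + 1)) x * partialFn c y := by
  unfold partialFn
  split_ifs with h₁ h₂
  · have he : Even (c.2.card + 1) := by rw [h₁]; decide
    rw [onCoeff_mul (isDeriv_bodyD _), par_pow_even he]
  · rw [dEven_mul, par_pow_even h₂.add_one]
  · rw [dOdd_mul, par_pow_odd (Nat.not_odd_iff_even.mp h₂).add_one]

theorem partialCoordTheta_mul (c : Coord n) (x y : FormTheta U) :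
    partialCoordTheta c (x * y) =
      partialCoordTheta c x * y + (par ^ (c.2.card + 1)) x * partialCoordTheta c y := by
  unfold partialCoordTheta
  split_ifs with h₁ h₂
  · have he : Even (c.2.card + 1) := by rw [h₁]; decide
    rw [onCoeff_mul (isDeriv_bodyD _), par_pow_even he]
  · rw [dEven_mul, par_pow_even h₂.add_one]
  · rw [dOdd_mul, par_pow_odd (Nat.not_odd_iff_even.mp h₂).add_one]

theorem onCoeff_even {C : Type} [CommRing C] [Algebra ℝ C] {ev od : Type} {D : C →ₗ[ℝ] C}
    (hD : D 1 = 0) (i : ev) : SAlg.onCoeff D (SAlg.even C od i) = 0 := by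
  rw [SAlg.even, onCoeff_mk, hD, mk_zero_left]

theorem onCoeff_odd {C : Type} [CommRing C] [Algebra ℝ C] {ev od : Type} {D : C →ₗ[ℝ] C}
    (hD : D 1 = 0) (j : od) : SAlg.onCoeff D (SAlg.odd C ev j) = 0 := by
  rw [SAlg.odd, SAlg.ofExt, onCoeff_mk, hD, mk_zero_left]

theorem dEven_ofCoeff {C : Type} [CommRing C] [Algebra ℝ C] {ev od : Type} (f : C) (i : ev) :
    SAlg.dEven i (SAlg.ofCoeff ev od f) = 0 := by
  rw [SAlg.ofCoeff, dEven_mk, Derivation.map_one_eq_zero, mk_zero_mid]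

theorem dOdd_ofCoeff {C : Type} [CommRing C] [Algebra ℝ C] {ev od : Type} (f : C) (j : od) :
    SAlg.dOdd j (SAlg.ofCoeff ev od f) = 0 := by
  rw [SAlg.ofCoeff, dOdd_mk, CliffordAlgebra.contractLeft_one, mk_zero]

theorem partialFn_coordFn (c c' : Coord n) [Decidable (c = c')] :
    partialFn c (coordFn U c') = if c = c' then 1 else 0 := by
  classical
  by_cases hc : c = c'
  · subst hc
    rw [if_pos rfl]
    unfold partialFn coordFn
    split_ifs with h₁ h₂
    · rw [ofCoeff, onCoeff_mk, bodyD_bodyCoord_self]; rfl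
    · rw [dEven_even, if_pos rfl]
    · rw [dOdd_odd_self]
  · rw [if_neg hc]
    unfold partialFn coordFn
    split_ifs with h₁ h₂ h₃ h₄ h₅ h₆ h₇ h₈
    · rw [ofCoeff, onCoeff_mk, bodyD_bodyCoord_of_ne (by simpa using hc), mk_zero_left]
    · exact onCoeff_even (isDeriv_bodyD _).map_one _
    · exact onCoeff_odd (isDeriv_bodyD _).map_one _
    · exact dEven_ofCoeff _ _
    · rw [dEven_even, if_neg (by simpa using hc)]
    · exact dEven_odd _ _
    · exact dOdd_ofCoeff _ _
    · exact dOdd_even _ _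
    · exact dOdd_odd_of_ne (by simpa using Ne.symm hc)

theorem partialCoord_toForm (c : Coord n) (f : Fn U) :
    partialCoord c (Fn.toForm U f) = Fn.toForm U (partialFn c f) := by
  rw [partialCoord_eq, partialFn]
  split_ifs with h₁ h₂
  · exact onCoeff_incl _ _ _ _
  · exact dEven_incl Sum.inl_injective _ _ _
  · exact dOdd_incl _ Sum.inl_injective _ _

theorem partialCoord_dCoord (c c' : Coord n) : partialCoord c (dCoord U c') = 0 := by
  classical
  rw [partialCoord_eq, dCoord]
  split_ifs
  · exact onCoeff_odd (isDeriv_bodyD _).map_one _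
  · exact onCoeff_even (isDeriv_bodyD _).map_one _
  · exact dEven_odd _ _
  · rw [dEven_even, if_neg (by simp)]
  · exact dOdd_odd_of_ne (by simp)
  · exact dOdd_even _ _

theorem partialCoordTheta_tin (c : Coord n) (x : Form U) :
    partialCoordTheta c (tin n x) = tin n (partialCoord c x) := by
  rw [partialCoord_eq, partialCoordTheta]
  split_ifs with h₁ h₂
  · exact onCoeff_incl _ _ _ _
  · exact dEven_incl Function.injective_id _ _ _
  · exact dOdd_incl _ Sum.inl_injective _ _

theorem partialCoordTheta_theta (c : Coord n) (μ : Fin n) :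
    partialCoordTheta c (theta _ _ _ μ : FormTheta U) = 0 := by
  unfold partialCoordTheta theta
  split_ifs
  · exact onCoeff_odd (isDeriv_bodyD _).map_one _
  · exact dEven_odd _ _
  · exact dOdd_odd_of_ne (by simp)

theorem partialCoordTheta_mono (c : Coord n) (S : Finset (Fin n)) :
    partialCoordTheta c (mono (theta _ _ _) S : FormTheta U) = 0 := by
  have h1 : partialCoordTheta c (1 : FormTheta U) = 0 := by
    have := partialCoordTheta_mul c (1 : FormTheta U) 1
    simpa using this
  rw [mono]
  induction S.sort with
  | nil => exact h1
  | cons a l ih =>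
    rw [List.map_cons, List.prod_cons, partialCoordTheta_mul, ih, partialCoordTheta_theta]
    simp

theorem thetaCoeff_partialCoordTheta (S : Finset (Fin n)) (c : Coord n) (F : FormTheta U) :
    thetaCoeff S (partialCoordTheta c F) = partialCoord c (thetaCoeff S F) := by
  rw [partialCoord_eq, partialCoordTheta]
  split_ifs with h₁ h₂
  · exact thetaCoeff_comm (fun μ x => dOddRight_onCoeff _ _ _) (fun x => dropTheta_onCoeff _ _) _ _
  · exact thetaCoeff_comm (fun μ x => dOddRight_dEven _ _ _) (fun x => dropTheta_dEven _ _) _ _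
  · exact thetaCoeff_comm (fun μ x => dOddRight_dOdd _ _ _) (fun x => dropTheta_dOdd _ _) _ _

/-- The de Rham differential of forms depending on `θ`. -/
noncomputable def deRhamTheta : FormTheta U →ₗ[ℝ] FormTheta U :=
  ∑ c : Coord n, LinearMap.mulLeft ℝ (tin n (dCoord U c)) ∘ₗ partialCoordTheta c

theorem deRhamTheta_apply (F : FormTheta U) :
    deRhamTheta F = ∑ c : Coord n, tin n (dCoord U c) * partialCoordTheta c F := by
  simp [deRhamTheta]

theorem thetaCoeff_deRhamTheta (S : Finset (Fin n)) (F : FormTheta U) :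
    thetaCoeff S (deRhamTheta F) = deRham (thetaCoeff S F) := by
  rw [deRhamTheta_apply, thetaCoeff_sum, deRham]
  exact Finset.sum_congr rfl fun c _ => by rw [thetaCoeff_tin_mul, thetaCoeff_partialCoordTheta]

/-- For each coordinate the parities |S| of its differential and |S| + 1 of the derivative add up to
an odd number, so d is an odd derivation. -/
theorem deRhamTheta_mul (x y : FormTheta U) :
    deRhamTheta (x * y) = deRhamTheta x * y + par x * deRhamTheta y := by
  simp only [deRhamTheta_apply, partialCoordTheta_mul, mul_add, Finset.sum_add_distrib,
    Finset.sum_mul, Finset.mul_sum, mul_assoc]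
  congr 1
  refine Finset.sum_congr rfl fun c _ => ?_
  rw [← mul_assoc, dCoord_incl_mul, ← par_pow_add, ← add_assoc, par_pow_odd (by simp), mul_assoc]

theorem deRhamTheta_mono (S : Finset (Fin n)) :
    deRhamTheta (mono (theta _ _ _) S : FormTheta U) = 0 := by
  simp [deRhamTheta_apply, partialCoordTheta_mono]

theorem deRhamTheta_tin (x : Form U) : deRhamTheta (tin n x) = tin n (deRham x) := by
  simp [deRhamTheta_apply, deRham, partialCoordTheta_tin]

theorem deRham_dCoord (c : Coord n) : deRham (dCoord U c) = 0 := by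
  simp [deRham, partialCoord_dCoord]

theorem deRham_coordFn (c : Coord n) : deRham (Fn.toForm U (coordFn U c)) = dCoord U c := by
  classical
  simp [deRham, partialCoord_toForm, partialFn_coordFn]

theorem psiTheta_eq (A : TIdx n) :
    psiTheta U A = ∑ S, tin n (coordFn U (A, S)) * mono (theta _ _ _) S := by
  simp only [psiTheta, thetaMonomial_eq]

theorem deRhamTheta_psiTheta (A : TIdx n) :
    deRhamTheta (FnTheta.toForm U (psiTheta U A)) = dPsiTheta U A := by
  rw [psiTheta_eq, dPsiTheta_eq, map_sum, map_sum]
  refine Finset.sum_congr rfl fun S _ => ?_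
  rw [map_mul, toForm_tin, toForm_mono_theta, deRhamTheta_mul, deRhamTheta_mono, deRhamTheta_tin,
    deRham_coordFn, mul_zero, add_zero]

theorem deRhamTheta_dPsiTheta (A : TIdx n) : deRhamTheta (dPsiTheta U A) = 0 := by
  rw [dPsiTheta_eq, map_sum]
  refine Finset.sum_eq_zero fun S _ => ?_
  rw [deRhamTheta_mul, deRhamTheta_mono, deRhamTheta_tin, deRham_dCoord, map_zero, mul_zero,
    zero_mul, add_zero]

theorem par_coordFn (c : Coord n) :
    par (coordFn U c) = -((-1 : ℝ) ^ c.2.card • coordFn U c) := by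
  unfold coordFn
  split_ifs with h₁ h₂
  · rw [par_ofCoeff, h₁, pow_one, neg_one_smul, neg_neg]
  · rw [par_even, h₂.neg_one_pow, neg_one_smul, neg_neg]
  · rw [par_odd, (Nat.not_odd_iff_even.mp h₂).neg_one_pow, one_smul]

theorem par_psiTheta (A : TIdx n) : par (psiTheta U A) = -psiTheta U A := by
  rw [psiTheta_eq, map_sum, ← Finset.sum_neg_distrib]
  refine Finset.sum_congr rfl fun S _ => ?_
  rw [map_mul, par_incl, par_coordFn, par_mono_theta, map_neg, map_smul, neg_mul, smul_mul_assoc,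
    mul_smul_comm, smul_smul, ← mul_pow]
  simp

theorem subst_tCoord (A : TIdx n) : subst U (tCoord A) = psiTheta U A := by
  rw [subst, tCoord, ExteriorAlgebra.lift_ι_apply]
  simp

theorem TFun.induction {P : TFun n → Prop} (one : P 1) (smul : ∀ (r : ℝ) x, P x → P (r • x))
    (add : ∀ x y, P x → P y → P (x + y)) (coord_mul : ∀ A x, P x → P (tCoord A * x))
    (x : TFun n) : P x := by
  have zero : P 0 := by simpa using smul 0 1 one
  refine CliffordAlgebra.left_induction (P := P) _ (fun r => ?_) add (fun x m hx => ?_) x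
  · have := smul r 1 one
    rwa [← Algebra.algebraMap_eq_smul_one] at this
  · change P (ExteriorAlgebra.ι ℝ m * x)
    induction m using Finsupp.induction_linear with
    | zero => rw [map_zero, zero_mul]; exact zero
    | add a b ha hb => rw [map_add, add_mul]; exact add _ _ ha hb
    | single A r =>
      have h : Finsupp.single A r = r • Finsupp.single A (1 : ℝ) := by simp
      rw [h, map_smul, smul_mul_assoc]
      exact smul _ _ (coord_mul A x hx)

/-- The chain rule for f(ψ(θ)): both sides satisfy the same odd Leibniz rule under multiplication by
a coordinate, and they agree on constants. -/
theorem deRhamTheta_subst (f : TFun n) :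
    deRhamTheta (FnTheta.toForm U (subst U f)) =
      ∑ A, dPsiTheta U A * FnTheta.toForm U (subst U (dT A f)) := by
  classical
  induction f using TFun.induction with
  | one =>
    have := deRhamTheta_mono (U := U) ∅
    rw [mono_empty] at this
    simp only [dT_one, map_one, this, map_zero, mul_zero, Finset.sum_const_zero]
  | smul r x hx => simp only [map_smul, hx, mul_smul_comm, Finset.smul_sum]
  | add x y hx hy => simp only [map_add, hx, hy, mul_add, Finset.sum_add_distrib]
  | coord_mul B x hx =>
    simp only [dT_tCoord_mul, map_mul, map_sub, subst_tCoord, deRhamTheta_mul,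
      deRhamTheta_psiTheta, hx, mul_sub, Finset.sum_sub_distrib]
    have h1 : par (FnTheta.toForm U (psiTheta U B)) = -FnTheta.toForm U (psiTheta U B) := by
      rw [← map_neg, ← par_psiTheta]; exact par_incl _ _ _
    rw [h1, neg_mul, ← sub_eq_add_neg, Finset.mul_sum]
    congr 1
    · rw [Finset.sum_eq_single B (fun A _ hA => by rw [if_neg hA, map_zero, map_zero, mul_zero])
        (by simp), if_pos rfl]
    · refine Finset.sum_congr rfl fun A _ => ?_
      rw [← mul_assoc, ← mul_assoc, dPsiTheta_mul]

/-- By the chain rule, dω^M is the integral of ∂_C Q_{AB} dψ^C dψ^A dψ^B. The coefficient is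
antisymmetric in A and C, while the differentials commute. -/
theorem deRham_omegaM (hn : 3 ≤ n) : deRham (omegaM U) = 0 := by
  rw [omegaM_eq, berezin, ← thetaCoeff_deRhamTheta]
  have h1 : ∀ A B, deRhamTheta (FnTheta.toForm U (subst U (qCoeff A B)) *
      dPsiTheta U A * dPsiTheta U B) = ∑ C, FnTheta.toForm U (subst U (dT C (qCoeff A B))) *
        (dPsiTheta U C * dPsiTheta U A) * dPsiTheta U B := by
    intro A B
    rw [deRhamTheta_mul, deRhamTheta_mul, deRhamTheta_dPsiTheta, deRhamTheta_dPsiTheta,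
      mul_zero, mul_zero, add_zero, add_zero, deRhamTheta_subst, Finset.sum_mul, Finset.sum_mul]
    exact Finset.sum_congr rfl fun C _ => by rw [dPsiTheta_mul, mul_assoc (FnTheta.toForm U _)]
  have h2 : deRhamTheta (∑ A, ∑ B, FnTheta.toForm U (subst U (qCoeff A B)) *
      dPsiTheta U A * dPsiTheta U B) = 0 := by
    simp only [map_sum, h1]
    set s := ∑ A, ∑ B, ∑ C, FnTheta.toForm U (subst U (dT C (qCoeff A B))) *
        (dPsiTheta U C * dPsiTheta U A) * dPsiTheta U B with hs
    -- Renaming the summation indices A and C changes the sign of the summand.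
    have h3 : s = -s := by
      have h5 : s = ∑ B, ∑ A, ∑ C, FnTheta.toForm U (subst U (dT C (qCoeff A B))) *
          (dPsiTheta U C * dPsiTheta U A) * dPsiTheta U B := Finset.sum_comm
      rw [h5, ← Finset.sum_neg_distrib]
      refine Finset.sum_congr rfl fun B _ => Finset.sum_comm.trans ?_
      rw [← Finset.sum_neg_distrib]
      refine Finset.sum_congr rfl fun C _ => ?_
      rw [← Finset.sum_neg_distrib]
      refine Finset.sum_congr rfl fun A _ => ?_
      rw [eq_neg_of_add_eq_zero_left (dT_qCoeff hn A B C), dPsiTheta_mul C]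
      simp
    have h4 : (2 : ℝ) • s = 0 := by rw [two_smul]; nth_rewrite 2 [h3]; exact add_neg_cancel s
    exact (smul_eq_zero.mp h4).resolve_left two_ne_zero
  rw [h2, thetaCoeff_zero]

/-! ### Homogeneous functions -/

theorem coordFn_mul (c : Coord n) (x : Fn U) :
    coordFn U c * x = (par ^ (c.2.card + 1)) x * coordFn U c := by
  unfold coordFn
  split_ifs with h₁ h₂
  · rw [ofCoeff_mul, par_pow_even (by rw [h₁]; decide)]
  · rw [even_mul, par_pow_even h₂.add_one]
  · rw [odd_mul, par_pow_odd (Nat.not_odd_iff_even.mp h₂).add_one]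

theorem iota_deRham_toForm (V : Vec U) (f : Fn U) :
    iota V (deRham (Fn.toForm U f)) = Fn.toForm U (∑ c, V c * partialFn c f) := by
  classical
  simp only [iota, deRham, map_sum, partialD_mul, partialCoord_toForm, partialD_toForm, mul_zero,
    add_zero, partialD_dCoord, ite_mul, one_mul, zero_mul, Finset.sum_ite_eq, Finset.mem_univ,
    if_true, map_mul]

/-- The action of the Euler vector field on functions. -/
noncomputable def eulerOp : Fn U →ₗ[ℝ] Fn U :=
  ∑ c : Coord n, LinearMap.mulLeft ℝ (euler U c) ∘ₗ partialFn c

theorem eulerOp_apply (f : Fn U) : eulerOp f = ∑ c, euler U c * partialFn c f := by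
  simp [eulerOp]

theorem isHomogeneous_iff (f : Fn U) (k : ℤ) : Fn.IsHomogeneous f k ↔ eulerOp f = k • f := by
  rw [Fn.IsHomogeneous, iota_deRham_toForm, ← eulerOp_apply, ← map_zsmul,
    Fn.toForm_injective.eq_iff]

/-- A coordinate and the derivative with respect to it have the same parity, so their product acts
as an even derivation. -/
theorem eulerOp_mul (x y : Fn U) : eulerOp (x * y) = eulerOp x * y + x * eulerOp y := by
  simp only [eulerOp_apply, partialFn_mul, mul_add, Finset.sum_add_distrib, Finset.sum_mul,
    Finset.mul_sum, mul_assoc]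
  congr 1
  refine Finset.sum_congr rfl fun c _ => ?_
  rw [euler, smul_mul_assoc, smul_mul_assoc, mul_smul_comm, ← mul_assoc, coordFn_mul,
    ← par_pow_add, par_pow_even ⟨_, rfl⟩, mul_assoc]

theorem isHomogeneous_coordFn (c : Coord n) : Fn.IsHomogeneous (coordFn U c) c.deg := by
  classical
  rw [isHomogeneous_iff, eulerOp_apply]
  simp [partialFn_coordFn, euler]

theorem Fn.IsHomogeneous.mul {f g : Fn U} {k l : ℤ} (hf : f.IsHomogeneous k)
    (hg : g.IsHomogeneous l) : Fn.IsHomogeneous (f * g) (k + l) := by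
  rw [isHomogeneous_iff] at *
  rw [eulerOp_mul, hf, hg, add_smul, smul_mul_assoc, mul_smul_comm]

theorem Fn.IsHomogeneous.smul {f : Fn U} {k : ℤ} (hf : f.IsHomogeneous k) (r : ℝ) :
    Fn.IsHomogeneous (r • f) k := by
  rw [isHomogeneous_iff] at *
  rw [map_smul, hf, smul_comm]

theorem isHomogeneous_zero (k : ℤ) : Fn.IsHomogeneous (0 : Fn U) k := by
  rw [isHomogeneous_iff, map_zero, smul_zero]

theorem isHomogeneous_sum {κ : Type*} {s : Finset κ} {f : κ → Fn U} {k : ℤ}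
    (hf : ∀ i ∈ s, (f i).IsHomogeneous k) : Fn.IsHomogeneous (∑ i ∈ s, f i) k := by
  rw [isHomogeneous_iff, map_sum, Finset.smul_sum]
  exact Finset.sum_congr rfl fun i hi => (isHomogeneous_iff _ _).mp (hf i hi)

theorem isHomogeneous_one : Fn.IsHomogeneous (1 : Fn U) 0 := by
  rw [isHomogeneous_iff]
  have h := eulerOp_mul (1 : Fn U) 1
  simpa using h

theorem thetaCoeff_mono_mul_mono {C : Type} [CommRing C] [Algebra ℝ C] {ev od : Type}
    (S T R : Finset (Fin n)) :
    thetaCoeff S (mono (theta C ev od) T * mono (theta C ev od) R) = 0 ∨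
      (S.card = T.card + R.card ∧
        (thetaCoeff S (mono (theta C ev od) T * mono (theta C ev od) R) = 1 ∨
          thetaCoeff S (mono (theta C ev od) T * mono (theta C ev od) R) = -1)) := by
  rcases (anticomm_theta (C := C) (ev := ev) (od := od)).mono_mul_mono T R with
    ⟨-, h⟩ | ⟨hd, h⟩
  · left; rw [h, thetaCoeff_zero]
  · by_cases hS : S = T ∪ R
    · right
      refine ⟨by rw [hS, Finset.card_union_of_disjoint hd], ?_⟩
      rcases h with h | h
      · left; rw [h, thetaCoeff_mono, if_pos hS]
      · right; rw [h, thetaCoeff_neg, thetaCoeff_mono, if_pos hS]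
    · left
      rcases h with h | h
      · rw [h, thetaCoeff_mono, if_neg hS]
      · rw [h, thetaCoeff_neg, thetaCoeff_mono, if_neg hS, neg_zero]

theorem par_pow_coordFn (k : ℕ) (c : Coord n) :
    ∃ r : ℝ, (par ^ k) (coordFn U c) = r • coordFn U c := by
  induction k with
  | zero => exact ⟨1, by simp⟩
  | succ k ih =>
    obtain ⟨r, hr⟩ := ih
    refine ⟨-((-1 : ℝ) ^ c.2.card * r), ?_⟩
    rw [par_pow_succ, par_coordFn, map_neg, map_smul, hr, smul_smul, neg_smul]

/-- If θ is given degree 1, then ψ^A(θ) has total degree 1. A further factor therefore raises the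
total degree m by one, and the coefficient of θ^S has |S| less. -/
theorem isHomogeneous_thetaCoeff_mul_psiTheta {F : FnTheta U} {m : ℤ}
    (hF : ∀ S, Fn.IsHomogeneous (thetaCoeff S F) (m - S.card)) (A : TIdx n) (S : Finset (Fin n)) :
    Fn.IsHomogeneous (thetaCoeff S (F * psiTheta U A)) (m + 1 - S.card) := by
  rw [← expansion F, psiTheta_eq, Finset.sum_mul_sum, thetaCoeff_sum]
  refine isHomogeneous_sum fun T _ => ?_
  rw [thetaCoeff_sum]
  refine isHomogeneous_sum fun R _ => ?_
  obtain ⟨r, hr⟩ := par_pow_coordFn (U := U) T.card (A, R)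
  have h1 : tin n (thetaCoeff T F) * mono (theta _ _ _) T *
      (tin n (coordFn U (A, R)) * mono (theta _ _ _) R) =
      tin n (thetaCoeff T F * r • coordFn U (A, R)) *
        (mono (theta _ _ _) T * mono (theta _ _ _) R) := by
    rw [mul_assoc, ← mul_assoc (mono _ T), mono_theta_mul, par_pow_incl, hr, map_mul]
    simp only [mul_assoc]
  rw [h1, thetaCoeff_tin_mul]
  have h2 := (hF T).mul ((isHomogeneous_coordFn (U := U) (A, R)).smul r)
  rcases thetaCoeff_mono_mul_mono (C := Smooth U) (ev := EvIdx n) (od := OdIdx n) S T R with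
    h | ⟨hc, h⟩
  · rw [h, mul_zero]; exact isHomogeneous_zero _
  · have h3 : m - T.card + Coord.deg (A, R) = m + 1 - S.card := by
      rw [hc, Coord.deg]; push_cast; ring
    rw [h3] at h2
    rcases h with h | h
    · rw [h, mul_one]; exact h2
    · rw [h, mul_neg, mul_one, ← neg_one_smul ℝ]; exact h2.smul _

theorem isHomogeneous_thetaCoeff_prod (l : List (TIdx n)) (S : Finset (Fin n)) :
    Fn.IsHomogeneous (thetaCoeff S (l.map (psiTheta U)).prod) (l.length - S.card) := by
  induction l using List.reverseRecOn generalizing S with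
  | nil =>
    rw [List.map_nil, List.prod_nil, ← mono_empty (theta (Smooth U) (EvIdx n) (OdIdx n)),
      thetaCoeff_mono]
    split_ifs with h
    · subst h; simpa using isHomogeneous_one
    · exact isHomogeneous_zero _
  | append_singleton l A ih =>
    rw [List.map_append, List.prod_append, List.map_singleton, List.prod_singleton,
      List.length_append, List.length_singleton]
    exact_mod_cast isHomogeneous_thetaCoeff_mul_psiTheta ih A S


open SAlg

variable {n : ℕ} {U : Opens (BodySpace n)}

/-! ### The functions `ξ(θ)^S` form a basis of the functions of `θ` -/

/-- Functions on `M` as functions of `θ`. -/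
noncomputable abbrev fnIn (U : Opens (BodySpace n)) : Fn U →ₐ[ℝ] FnTheta U := tin n

/-- The variables `θ^μ` as functions of `θ`. -/
noncomputable abbrev thetaFn (U : Opens (BodySpace n)) (μ : Fin n) : FnTheta U := theta _ _ _ μ

/-- The generating functions `ξ^a(θ)`. -/
noncomputable abbrev xiFn (U : Opens (BodySpace n)) (a : Fin n) : FnTheta U :=
  psiTheta U (Sum.inl a)

theorem coordFn_incl_mul (c : Coord n) (x : FnTheta U) :
    fnIn U (coordFn U c) * x = (par ^ (c.2.card + 1)) x * fnIn U (coordFn U c) := by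
  unfold coordFn
  split_ifs with h₁ h₂
  · have he : Even (c.2.card + 1) := by rw [h₁]; decide
    rw [incl_ofCoeff, ofCoeff_mul, par_pow_even he]
  · rw [incl_even, even_mul, par_pow_even h₂.add_one]
  · rw [incl_odd, odd_mul, par_pow_odd (Nat.not_odd_iff_even.mp h₂).add_one]

theorem psiTheta_mul (A : TIdx n) (x : FnTheta U) :
    psiTheta U A * x = par x * psiTheta U A := by
  rw [psiTheta_eq, Finset.sum_mul, Finset.mul_sum]
  refine Finset.sum_congr rfl fun S _ => ?_
  rw [mul_assoc, mono_theta_mul, ← mul_assoc, coordFn_incl_mul, mul_assoc, ← par_pow_add]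
  have : (A, S).2.card + 1 + S.card = 2 * S.card + 1 := by simp only; ring
  rw [this, par_pow_odd ⟨S.card, rfl⟩]

theorem anticomm_psiTheta : Anticomm (psiTheta U) where
  sq A := mul_self_eq_zero_of_odd (psiTheta_mem_oddPart U A)
  anti A B := eq_neg_of_add_eq_zero_left
    (mul_add_mul_eq_zero_of_odd (psiTheta_mem_oddPart U A) (psiTheta_mem_oddPart U B))

theorem anticomm_xiFn : Anticomm (xiFn U) where
  sq _ := anticomm_psiTheta.sq _
  anti _ _ := anticomm_psiTheta.anti _ _

theorem subst_mono_xi (S : Finset (Fin n)) : subst U (mono xi S) = mono (xiFn U) S := by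
  rw [map_mono]
  simp only [xi, subst_tCoord]

/-- The span of the monomials in `ξ(θ)` over the functions on `M`. -/
def InXiSpan (F : FnTheta U) : Prop :=
  ∃ a : Finset (Fin n) → Fn U, F = ∑ S, fnIn U (a S) * mono (xiFn U) S

namespace InXiSpan

theorem zero : InXiSpan (0 : FnTheta U) := ⟨0, by simp⟩

theorem add {F G : FnTheta U} (hF : InXiSpan F) (hG : InXiSpan G) : InXiSpan (F + G) := by
  obtain ⟨a, rfl⟩ := hF
  obtain ⟨b, rfl⟩ := hG
  exact ⟨a + b, by simp [add_mul, Finset.sum_add_distrib]⟩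

theorem sum {κ : Type*} {s : Finset κ} {F : κ → FnTheta U} (hF : ∀ i ∈ s, InXiSpan (F i)) :
    InXiSpan (∑ i ∈ s, F i) :=
  Finset.sum_induction F InXiSpan (fun _ _ => add) zero hF

theorem fnIn_mul (f : Fn U) {F : FnTheta U} (hF : InXiSpan F) : InXiSpan (fnIn U f * F) := by
  obtain ⟨a, rfl⟩ := hF
  refine ⟨fun S => f * a S, ?_⟩
  rw [Finset.mul_sum]
  exact Finset.sum_congr rfl fun S _ => by rw [map_mul, mul_assoc]

theorem neg {F : FnTheta U} (hF : InXiSpan F) : InXiSpan (-F) := by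
  have := hF.fnIn_mul (-1)
  rwa [map_neg, map_one, neg_one_mul] at this

theorem sub {F G : FnTheta U} (hF : InXiSpan F) (hG : InXiSpan G) : InXiSpan (F - G) := by
  rw [sub_eq_add_neg]
  exact hF.add hG.neg

theorem mono (S : Finset (Fin n)) : InXiSpan (mono (xiFn U) S) := by
  classical
  refine ⟨Pi.single S 1, ?_⟩
  rw [Finset.sum_eq_single S (fun T _ hT => by rw [Pi.single_eq_of_ne hT, map_zero, zero_mul])
    (by simp), Pi.single_eq_same, map_one, one_mul]

theorem one : InXiSpan (1 : FnTheta U) := by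
  rw [← mono_empty (xiFn U)]; exact mono ∅

/-- Coefficients must stay on the left, so ξ^a(θ) is moved past them with the parity involution and
then absorbed into the monomial. -/
theorem xi_mul (a : Fin n) {F : FnTheta U} (hF : InXiSpan F) : InXiSpan (xiFn U a * F) := by
  obtain ⟨c, rfl⟩ := hF
  rw [Finset.mul_sum]
  refine sum fun S _ => ?_
  rw [← mul_assoc, psiTheta_mul, mul_assoc, par_incl]
  refine fnIn_mul _ ?_
  have h := (anticomm_xiFn (U := U)).mono_mul_mono {a} S
  rw [mono_singleton] at h
  rcases h with ⟨-, h⟩ | ⟨-, h | h⟩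
  · rw [h]; exact zero
  · rw [h]; exact mono _
  · rw [h]; exact (mono _).neg

end InXiSpan

/-- Functions all of whose terms have degree at least `k` in `θ`. -/
def ThetaOrder (k : ℕ) (F : FnTheta U) : Prop := ∀ S : Finset (Fin n), S.card < k → thetaCoeff S F = 0

theorem thetaCoeff_mul (S : Finset (Fin n)) (F G : FnTheta U) :
    thetaCoeff S (F * G) = ∑ T, ∑ R, thetaCoeff T F * (par ^ T.card) (thetaCoeff R G) *
      thetaCoeff S (mono (thetaFn U) T * mono (thetaFn U) R) := by
  conv_lhs => rw [← expansion F, ← expansion G, Finset.sum_mul_sum, thetaCoeff_sum]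
  refine Finset.sum_congr rfl fun T _ => ?_
  rw [thetaCoeff_sum]
  refine Finset.sum_congr rfl fun R _ => ?_
  rw [← thetaCoeff_tin_mul, map_mul, mul_assoc, ← mul_assoc (mono _ T), mono_theta_mul,
    par_pow_incl]
  simp only [mul_assoc]

namespace ThetaOrder

theorem add {k : ℕ} {F G : FnTheta U} (hF : ThetaOrder k F) (hG : ThetaOrder k G) :
    ThetaOrder k (F + G) := fun S hS => by rw [thetaCoeff_add, hF S hS, hG S hS, add_zero]

theorem mul {k l : ℕ} {F G : FnTheta U} (hF : ThetaOrder k F) (hG : ThetaOrder l G) :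
    ThetaOrder (k + l) (F * G) := by
  intro S hS
  rw [thetaCoeff_mul]
  refine Finset.sum_eq_zero fun T _ => Finset.sum_eq_zero fun R _ => ?_
  rcases thetaCoeff_mono_mul_mono (C := Smooth U) (ev := EvIdx n) (od := OdIdx n) S T R with
    h | ⟨h, -⟩
  · rw [h, mul_zero]
  · rcases lt_or_ge T.card k with hT | hT
    · rw [hF T hT, zero_mul, zero_mul]
    · rw [hG R (by omega), map_zero, mul_zero, zero_mul]

theorem mono (S : Finset (Fin n)) : ThetaOrder S.card (mono (thetaFn U) S) := by
  intro T hT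
  rw [thetaCoeff_mono, if_neg (by rintro rfl; exact lt_irrefl _ hT)]

theorem theta (μ : Fin n) : ThetaOrder 1 (thetaFn U μ) := by
  have := mono (U := U) {μ}
  rwa [mono_singleton, Finset.card_singleton] at this

theorem of_le {k l : ℕ} (h : k ≤ l) {F : FnTheta U} (hF : ThetaOrder l F) : ThetaOrder k F :=
  fun S hS => hF S (hS.trans_le h)

theorem one : ThetaOrder 0 (1 : FnTheta U) := fun _ hS => absurd hS (Nat.not_lt_zero _)

theorem prod_theta (l : List (Fin n)) : ThetaOrder l.length (l.map (thetaFn U)).prod := by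
  induction l with
  | nil => exact one
  | cons a l ih =>
    rw [List.map_cons, List.prod_cons, List.length_cons, add_comm]
    exact (theta a).mul ih

theorem prod_sub {y : Fin n → FnTheta U} (hy : ∀ μ, ThetaOrder 2 (y μ - thetaFn U μ))
    (l : List (Fin n)) :
    ThetaOrder (l.length + 1) ((l.map y).prod - (l.map (thetaFn U)).prod) := by
  induction l with
  | nil => intro S _; rw [List.map_nil, List.map_nil, sub_self, thetaCoeff_zero]
  | cons a l ih =>
    have h1 : ThetaOrder 1 (y a) := by
      have := ((hy a).of_le one_le_two).add (theta a)
      rwa [sub_add_cancel] at this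
    have h2 := (h1.mul ih).add (((hy a).mul (prod_theta l)).of_le
      (show 1 + (l.length + 1) ≤ 2 + l.length by omega))
    rw [List.map_cons, List.map_cons, List.prod_cons, List.prod_cons, List.length_cons]
    have h3 : y a * ((l.map y).prod - (l.map (thetaFn U)).prod) +
        (y a - thetaFn U a) * (l.map (thetaFn U)).prod =
        y a * (l.map y).prod - thetaFn U a * (l.map (thetaFn U)).prod := by
      rw [mul_sub, sub_mul]; abel
    rw [h3] at h2
    exact h2.of_le (by omega)

end ThetaOrder

/-- Descending induction on |S|. The product of the y^μ over S lies in the span and differs from θ^S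
only in terms of degree above |S|, which lie in the span by induction; the process stops at degree
n. -/
theorem inXiSpan_mono_theta {y : Fin n → FnTheta U} (hy : ∀ μ, ThetaOrder 2 (y μ - thetaFn U μ))
    (hy' : ∀ μ F, InXiSpan F → InXiSpan (y μ * F)) (S : Finset (Fin n)) :
    InXiSpan (mono (thetaFn U) S) := by
  induction hk : n - S.card using Nat.strong_induction_on generalizing S with
  | _ k ih =>
    have h1 : ∀ l : List (Fin n), InXiSpan (l.map y).prod := by
      intro l
      induction l with
      | nil => exact InXiSpan.one
      | cons a l ih' => rw [List.map_cons, List.prod_cons]; exact hy' a _ ih'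
    have h2 := ThetaOrder.prod_sub hy S.sort
    rw [Finset.length_sort] at h2
    have h3 : ∀ D : FnTheta U, ThetaOrder (S.card + 1) D → InXiSpan D := by
      intro D hD
      rw [← expansion D]
      refine InXiSpan.sum fun T _ => ?_
      rcases lt_or_ge T.card (S.card + 1) with hT | hT
      · rw [hD T hT, map_zero, zero_mul]
        exact InXiSpan.zero
      · have h5 : T.card ≤ n := by simpa using Finset.card_le_univ T
        exact InXiSpan.fnIn_mul _ (ih (n - T.card) (by omega) T rfl)
    have h4 := (h1 S.sort).sub (h3 _ h2)
    rwa [sub_sub_cancel] at h4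

theorem isUnit_smooth {f : Smooth U} (hf : ∀ x, f.1 x ≠ 0) : IsUnit f := by
  refine IsUnit.of_mul_eq_one ⟨fun x => (f.1 x)⁻¹, ?_⟩ ?_
  · refine (ContDiffOn.inv f.2 fun x hx => ?_).congr fun x hx => ?_
    · rw [ext0_apply _ hx]; exact hf _
    · rw [ext0_apply _ hx, Pi.inv_apply, ext0_apply _ hx]
  · ext x
    exact mul_inv_cancel₀ (hf x)

/-- The frame `e^a_μ` as a matrix of functions. -/
noncomputable def frameFn (U : Opens (BodySpace n)) : Matrix (Fin n) (Fin n) (Smooth U) :=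
  Matrix.of fun a μ => bodyCoord U ⟨(Sum.inl a, {μ}), Finset.card_singleton μ⟩

theorem isUnit_det_frameFn (hU : U ≤ body n) : IsUnit (frameFn U).det := by
  refine isUnit_smooth fun x => ?_
  have h1 : (frameFn U).det.1 x = (frame x.1).det := by
    let φ : Smooth U →+* ℝ := (Pi.evalRingHom (fun _ : U => ℝ) x).comp (Smooth U).subtype
    exact RingHom.map_det φ (frameFn U)
  rw [h1]
  exact (hU x.2 : IsUnit (frame x.1).det).ne_zero

/-- The only use of the invertible frame: y^μ = (e⁻¹)^μ_a (ξ^a(θ) - ξ^a_∅). Subtracting ξ^a_∅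
removes the constant term, and e⁻¹ e = 1 makes the linear term θ^μ. Both operations preserve the
span of the ξ(θ)^S. -/
theorem exists_theta_approx (hU : U ≤ body n) : ∃ y : Fin n → FnTheta U,
    (∀ μ, ThetaOrder 2 (y μ - thetaFn U μ)) ∧ ∀ μ F, InXiSpan F → InXiSpan (y μ * F) := by
  classical
  let E := frameFn U
  have hE : E⁻¹ * E = 1 := Matrix.nonsing_inv_mul E (isUnit_det_frameFn hU)
  refine ⟨fun μ => ∑ a, fnIn U (ofCoeff _ _ (E⁻¹ μ a)) *
    (xiFn U a - fnIn U (coordFn U (Sum.inl a, ∅))), fun μ S hS => ?_, fun μ F hF => ?_⟩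
  · rw [sub_eq_add_neg, thetaCoeff_add, thetaCoeff_neg, thetaCoeff_sum]
    have h1 : ∀ a, thetaCoeff S (fnIn U (ofCoeff _ _ (E⁻¹ μ a)) *
        (xiFn U a - fnIn U (coordFn U (Sum.inl a, ∅)))) =
        ofCoeff _ _ (E⁻¹ μ a) * (coordFn U (Sum.inl a, S) -
          if S = ∅ then coordFn U (Sum.inl a, ∅) else 0) := by
      intro a
      have h2 : thetaCoeff S (fnIn U (coordFn U (Sum.inl a, ∅))) =
          if S = ∅ then coordFn U (Sum.inl a, ∅) else 0 := by
        have := thetaCoeff_tin_mul S (coordFn U (Sum.inl a, ∅)) (mono (thetaFn U) ∅)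
        rw [mono_empty, mul_one] at this
        rw [this, ← mono_empty (thetaFn U), thetaCoeff_mono]
        split_ifs <;> simp
      rw [thetaCoeff_tin_mul, sub_eq_add_neg, thetaCoeff_add, thetaCoeff_neg, h2, xiFn,
        psiTheta_eq, thetaCoeff_expansion, sub_eq_add_neg]
    rw [Finset.sum_congr rfl fun a _ => h1 a]
    rcases Nat.lt_succ_iff_lt_or_eq.mp hS with h | h
    · have h3 : S = ∅ := Finset.card_eq_zero.mp (by omega)
      subst h3
      rw [ThetaOrder.theta μ ∅ (by simp)]
      simp
    · obtain ⟨ν, rfl⟩ := Finset.card_eq_one.mp h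
      have h4 : ∀ a, coordFn U (Sum.inl a, {ν}) = ofCoeff _ _ (E a ν) := by
        intro a
        rw [coordFn, dif_pos (Finset.card_singleton ν)]; rfl
      have h5 : ∑ a, E⁻¹ μ a * E a ν = if μ = ν then 1 else 0 := by
        rw [← Matrix.mul_apply, hE, Matrix.one_apply]
      simp only [Finset.singleton_ne_empty, if_false, sub_zero, h4, ofCoeff_mul_ofCoeff]
      rw [← ofCoeff_sum, h5, ← mono_singleton (thetaFn U), thetaCoeff_mono]
      by_cases hμ : μ = ν
      · subst hμ
        rw [if_pos rfl, if_pos rfl, ofCoeff_one, add_neg_cancel]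
      · rw [if_neg hμ, if_neg (by simpa using Ne.symm hμ), ofCoeff_zero, neg_zero, add_zero]
  · rw [Finset.sum_mul]
    refine InXiSpan.sum fun a _ => ?_
    rw [mul_assoc]
    refine InXiSpan.fnIn_mul _ ?_
    rw [sub_mul]
    exact (hF.xi_mul a).sub (hF.fnIn_mul _)

/-- The matrix of the components of the monomials in `ξ(θ)`. -/
noncomputable def xiMatrix (U : Opens (BodySpace n)) :
    Matrix (Finset (Fin n)) (Finset (Fin n)) (Fn U) :=
  Matrix.of fun S T => thetaCoeff T (mono (xiFn U) S)

/-- The rows of the left inverse are the coefficients of θ^S in terms of the ξ(θ)^R. -/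
theorem exists_mul_xiMatrix (hU : U ≤ body n) :
    ∃ N : Matrix (Finset (Fin n)) (Finset (Fin n)) (Fn U), N * xiMatrix U = 1 := by
  obtain ⟨y, hy, hy'⟩ := exists_theta_approx hU
  choose a ha using inXiSpan_mono_theta hy hy'
  refine ⟨Matrix.of a, ?_⟩
  ext S T
  have h := congrArg (thetaCoeff T) (ha S)
  rw [thetaCoeff_mono, thetaCoeff_sum] at h
  rw [Matrix.mul_apply, Matrix.one_apply]
  simp only [Matrix.of_apply, xiMatrix]
  rw [Finset.sum_congr rfl fun R _ => (thetaCoeff_tin_mul T (a S R) _).symm, ← h]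
  simp only [eq_comm]

theorem isUnit_xiMatrix (hU : U ≤ body n) : IsUnit (xiMatrix U) := by
  obtain ⟨N, hN⟩ := exists_mul_xiMatrix hU
  exact isUnit_of_mul_eq_one hN


/-! ### Berezin duality for the monomials in ξ(θ), and prolongations. -/

open SAlg

variable {n : ℕ} {U : Opens (BodySpace n)}

/-- The sign in `∫ dⁿθ θ^{Sᶜ} θ^S`. -/
noncomputable def complSign (U : Opens (BodySpace n)) (S : Finset (Fin n)) : Fn U :=
  berezin (mono (thetaFn U) Sᶜ * mono (thetaFn U) S)

theorem complSign_mul_self (S : Finset (Fin n)) : complSign U S * complSign U S = 1 := by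
  rcases thetaCoeff_univ_mono_mul (C := Smooth U) (ev := EvIdx n) (od := OdIdx n) Sᶜ S with
    ⟨h, -⟩ | ⟨-, h⟩
  · simp at h
  · rw [complSign, berezin]
    rcases h with h | h <;> rw [h] <;> simp

theorem berezin_mono_compl_mul (S : Finset (Fin n)) (F : FnTheta U) :
    berezin (mono (thetaFn U) Sᶜ * F) =
      (par ^ Sᶜ.card) (thetaCoeff S F) * complSign U S := by
  rw [berezin, thetaCoeff_mono_mul, Finset.sum_eq_single S]
  · rfl
  · intro R _ hR
    rcases thetaCoeff_univ_mono_mul (C := Smooth U) (ev := EvIdx n) (od := OdIdx n) Sᶜ R with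
      ⟨-, h⟩ | ⟨h, -⟩
    · rw [h, mul_zero]
    · exact absurd (by simpa using h) hR
  · simp

/-- The matrix of the Berezin integrals `∫ dⁿθ θ^{Tᶜ} ξ(θ)^S`. -/
noncomputable def pairingMatrix (U : Opens (BodySpace n)) :
    Matrix (Finset (Fin n)) (Finset (Fin n)) (Fn U) :=
  Matrix.of fun T S => berezin (mono (thetaFn U) Tᶜ * mono (xiFn U) S)

/-- The integral of θ^{Tᶜ} ξ(θ)^S is the θ^T-component of ξ(θ)^S up to a sign and the parity
involution. The involution disappears modulo odd variables, leaving a signed transpose of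
`xiMatrix`. -/
theorem isUnit_pairingMatrix (hU : U ≤ body n) : IsUnit (pairingMatrix U) := by
  obtain ⟨N, hN⟩ := exists_mul_xiMatrix hU
  refine isUnit_of_map_red_mul (N := Matrix.of fun S T => N T S * complSign U T) ?_
  ext T T'
  have h1 : ∑ S, red (N T' S) * red (xiMatrix U S T) = if T' = T then 1 else 0 := by
    have := congrArg red (congrFun (congrFun hN T') T)
    rw [Matrix.mul_apply, map_sum, Matrix.one_apply] at this
    simp only [map_mul] at this
    rw [this]
    split_ifs <;> simp
  have h2 : ∀ S, red (pairingMatrix U T S) * red (N T' S * complSign U T') =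
      red (N T' S) * red (xiMatrix U S T) * (red (complSign U T) * red (complSign U T')) := by
    intro S
    rw [pairingMatrix, Matrix.of_apply, berezin_mono_compl_mul, map_mul, map_mul, red_par_pow]
    simp only [xiMatrix, Matrix.of_apply]
    ring
  rw [Matrix.mul_apply, Matrix.one_apply]
  simp only [Matrix.map_apply, Matrix.of_apply, h2]
  rw [← Finset.sum_mul, h1]
  by_cases h : T = T'
  · subst h
    rw [if_pos rfl, ← map_mul, complSign_mul_self, map_one, one_mul]
  · rw [if_neg h, if_neg (Ne.symm h), zero_mul]

/-- The functions `ξ(θ)^S` have a dual basis with respect to Berezin integration. -/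
theorem exists_dual_mono_xi (hU : U ≤ body n) : ∃ Y : Finset (Fin n) → FnTheta U,
    ∀ S T, berezin (Y S * mono (xiFn U) T) = if S = T then 1 else 0 := by
  obtain ⟨u, hu⟩ := isUnit_pairingMatrix hU
  have h1 : (u⁻¹).val * pairingMatrix U = 1 := by rw [← hu, Units.inv_mul]
  refine ⟨fun S => ∑ R, fnIn U ((u⁻¹).val S R) * mono (thetaFn U) Rᶜ, fun S T => ?_⟩
  have h2 := congrFun (congrFun h1 S) T
  rw [Matrix.mul_apply, Matrix.one_apply] at h2
  rw [← h2, Finset.sum_mul, berezin, thetaCoeff_sum]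
  refine Finset.sum_congr rfl fun R _ => ?_
  rw [mul_assoc, thetaCoeff_tin_mul]
  rfl

theorem eq_zero_of_sum_mono_xi (hU : U ≤ body n) {a : Finset (Fin n) → Fn U}
    (h : ∑ S, fnIn U (a S) * mono (xiFn U) S = 0) : a = 0 := by
  obtain ⟨u, hu⟩ := isUnit_xiMatrix hU
  have h1 : Matrix.vecMul a (xiMatrix U) = 0 := by
    funext R
    have := congrArg (thetaCoeff R) h
    rw [thetaCoeff_sum, thetaCoeff_zero] at this
    simp only [thetaCoeff_tin_mul] at this
    exact this
  have h2 := congrArg (fun v => Matrix.vecMul v (u⁻¹).val) h1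
  rwa [Matrix.vecMul_vecMul, ← hu, Units.mul_inv, Matrix.vecMul_one, Matrix.zero_vecMul] at h2

theorem exists_eq_sum_mono_xi (hU : U ≤ body n) (F : FnTheta U) :
    ∃ a : Finset (Fin n) → Fn U, F = ∑ S, fnIn U (a S) * mono (xiFn U) S := by
  obtain ⟨y, hy, hy'⟩ := exists_theta_approx hU
  have h : InXiSpan F := by
    rw [← expansion F]
    exact InXiSpan.sum fun S _ => InXiSpan.fnIn_mul _ (inXiSpan_mono_theta hy hy' S)
  exact h

/-! ### Prolongations -/

theorem vTheta_thetaCoeff (F : TIdx n → FnTheta U) (A : TIdx n) :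
    vTheta (fun c => thetaCoeff c.2 (F c.1)) A = F A := expansion (F A)

theorem vTheta_prolong (X : TVec n) (A : TIdx n) : vTheta (prolong U X) A = subst U (X A) :=
  vTheta_thetaCoeff (fun A => subst U (X A)) A

/-- Substitution is an algebra homomorphism and S_{AB} is substituted with the components, so
contraction commutes with prolongation. In particular the kernel on 𝔤[1] prolongs into the kernel on
M. -/
theorem contrTheta_prolong (X : TVec n) (B : TIdx n) :
    contrTheta (prolong U X) B = subst U (contr X B) := by
  simp only [contrTheta, vTheta_prolong, contr, map_sum, map_mul]

theorem prolong_add (X Y : TVec n) : prolong U (X + Y) = prolong U X + prolong U Y := by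
  funext c
  rw [prolong, Pi.add_apply, map_add, thetaCoeff_add]; rfl

theorem prolong_smul (r : ℝ) (X : TVec n) :
    prolong U (r • X) = algebraMap ℝ (Fn U) r • prolong U X := by
  funext c
  rw [prolong, Pi.smul_apply, map_smul, thetaCoeff_smul, Algebra.smul_def]; rfl

theorem iota_add (V W : Vec U) (α : Form U) : iota (V + W) α = iota V α + iota W α := by
  simp only [iota, Pi.add_apply, map_add, add_mul, Finset.sum_add_distrib]

theorem iota_smul (f : Fn U) (V : Vec U) (α : Form U) :
    iota (f • V) α = Fn.toForm U f * iota V α := by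
  simp only [iota, Pi.smul_apply, smul_eq_mul, map_mul, Finset.mul_sum, mul_assoc]

theorem iota_zero (α : Form U) : iota (0 : Vec U) α = 0 := by
  simp [iota]

theorem iota_omegaM_eq_zero_iff (V : Vec U) : iota V (omegaM U) = 0 ↔ ∀ B, contrTheta V B = 0 := by
  rw [iota_omegaM, intForm_eq_zero_iff]

theorem iota_prolong {X : TVec n} (hX : tIota X (omegaT n) = 0) :
    iota (prolong U X) (omegaM U) = 0 := by
  rw [iota_omegaM_eq_zero_iff]
  intro B
  rw [contrTheta_prolong, (tIota_omegaT_eq_zero_iff X).mp hX B, map_zero]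

/-- Linear combinations of prolongations of vector fields in the kernel lie in the kernel. -/
theorem iota_of_mem_span {s : Set (Vec U)} (hs : ∀ W ∈ s, iota W (omegaM U) = 0) {V : Vec U}
    (hV : V ∈ Submodule.span (Fn U) s) : iota V (omegaM U) = 0 := by
  induction hV using Submodule.span_induction with
  | mem W hW => exact hs W hW
  | zero => exact iota_zero _
  | add V W _ _ hV hW => rw [iota_add, hV, hW, add_zero]
  | smul f V _ hV => rw [iota_smul, hV, mul_zero]

theorem vTheta_sum_smul {κ : Type*} (s : Finset κ) (v : κ → Fn U) (E : κ → Vec U) (A : TIdx n) :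
    vTheta (∑ i ∈ s, v i • E i) A = ∑ i ∈ s, fnIn U (v i) * vTheta (E i) A := by
  simp only [vTheta, Finset.sum_apply, Pi.smul_apply, smul_eq_mul, map_sum, map_mul,
    Finset.sum_mul, Finset.mul_sum, mul_assoc]
  exact Finset.sum_comm

theorem contrTheta_sum_smul {κ : Type*} (s : Finset κ) (v : κ → Fn U) (E : κ → Vec U)
    (B : TIdx n) :
    contrTheta (∑ i ∈ s, v i • E i) B = ∑ i ∈ s, fnIn U (v i) * contrTheta (E i) B := by
  simp only [contrTheta, vTheta_sum_smul, Finset.sum_mul, Finset.mul_sum, mul_assoc]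
  exact Finset.sum_comm


open SAlg

variable {n : ℕ} {U : Opens (BodySpace n)}

/-! ### Polynomials in the variables `ξ` -/

theorem anticomm_xi : Anticomm (xi : Fin n → TFun n) where
  sq _ := ExteriorAlgebra.ι_sq_zero _
  anti _ _ := eq_neg_of_add_eq_zero_left (ExteriorAlgebra.ι_add_mul_swap _ _)

/-- The homomorphism ξ ↦ θ, ρ ↦ 0 carries monomials to monomials, so the θ-coefficients, already
available, yield the coefficient functionals. -/
theorem exists_xiCoeff (S : Finset (Fin n)) : ∃ φ : TFun n →ₗ[ℝ] ℝ,
    ∀ T, φ (mono xi T) = if T = S then 1 else 0 := by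
  let y : TIdx n → SAlg ℝ Empty (Empty ⊕ Fin n) :=
    Sum.elim (theta ℝ Empty Empty) (fun _ => 0)
  have hsq : ∀ m : TIdx n →₀ ℝ, Finsupp.linearCombination ℝ y m *
      Finsupp.linearCombination ℝ y m = 0 := by
    intro m
    refine mul_self_eq_zero_of_odd ?_
    rw [Finsupp.linearCombination_apply]
    refine Submodule.sum_mem _ fun A _ => Submodule.smul_mem _ _ ?_
    rcases A with a | p
    · exact Submodule.subset_span ⟨1, 1, _, CliffordAlgebra.ι_mem_evenOdd_one _ _, rfl⟩
    · exact Submodule.zero_mem _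
  let Φ : TFun n →ₐ[ℝ] SAlg ℝ Empty (Empty ⊕ Fin n) :=
    ExteriorAlgebra.lift ℝ ⟨Finsupp.linearCombination ℝ y, hsq⟩
  let ev : SAlg ℝ Empty Empty →ₐ[ℝ] ℝ :=
    (Algebra.TensorProduct.lift (AlgHom.id ℝ ℝ) (MvPolynomial.aeval fun _ => 0)
      fun _ _ => Commute.all _ _).comp red
  refine ⟨ev.toLinearMap ∘ₗ thetaCoeffL S ∘ₗ Φ.toLinearMap, fun T => ?_⟩
  have h1 : Φ (mono xi T) = mono (theta ℝ Empty Empty) T := by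
    rw [map_mono]
    congr 1
    funext a
    change ExteriorAlgebra.lift ℝ _ (ExteriorAlgebra.ι ℝ _) = _
    rw [ExteriorAlgebra.lift_ι_apply]
    simp [y]
  change ev (thetaCoeff S (Φ (mono xi T))) = _
  rw [h1, thetaCoeff_mono]
  simp only [eq_comm (a := S)]
  split_ifs
  · exact map_one ev
  · exact map_zero ev

/-- The coefficient of `ξ^S`. -/
noncomputable def xiCoeff (S : Finset (Fin n)) : TFun n →ₗ[ℝ] ℝ := (exists_xiCoeff S).choose

theorem xiCoeff_mono (S T : Finset (Fin n)) :
    xiCoeff S (mono xi T) = if T = S then 1 else 0 := (exists_xiCoeff S).choose_spec T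

/-- The polynomials in `ξ` that are homogeneous of degree `m`. -/
noncomputable def xiHom (n m : ℕ) : Submodule ℝ (TFun n) :=
  Submodule.span ℝ {f | ∃ l : List (Fin n), l.length = m ∧ f = (l.map xi).prod}

theorem mono_mem_xiHom (S : Finset (Fin n)) : mono xi S ∈ xiHom n S.card :=
  Submodule.subset_span ⟨S.sort, S.length_sort _, rfl⟩

theorem xiHom_mul {m k : ℕ} {f g : TFun n} (hf : f ∈ xiHom n m) (hg : g ∈ xiHom n k) :
    f * g ∈ xiHom n (m + k) := by
  have h := Submodule.mul_mem_mul hf hg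
  rw [xiHom, xiHom, Submodule.span_mul_span] at h
  refine Submodule.span_mono ?_ h
  rintro _ ⟨_, ⟨l, hl, rfl⟩, _, ⟨l', hl', rfl⟩, rfl⟩
  exact ⟨l ++ l', by simp [hl, hl'], by simp⟩

theorem list_prod_xi (l : List (Fin n)) : (l.map xi).prod = (0 : TFun n) ∨
    ∃ S : Finset (Fin n), S.card = l.length ∧
      ((l.map xi).prod = mono xi S ∨ (l.map xi).prod = -mono xi S) := by
  by_cases h : l.Nodup
  · exact Or.inr ⟨l.toFinset, List.toFinset_card_of_nodup h, anticomm_xi.prod_eq_mono h⟩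
  · exact Or.inl (anticomm_xi.prod_eq_zero h)

theorem eq_sum_of_mem_xiHom {m : ℕ} {f : TFun n} (hf : f ∈ xiHom n m) :
    f = ∑ S, xiCoeff S f • mono xi S := by
  induction hf using Submodule.span_induction with
  | mem f hf =>
    obtain ⟨l, -, rfl⟩ := hf
    have h1 : ∀ T : Finset (Fin n), mono xi T = ∑ S, xiCoeff S (mono xi T) • mono xi S := by
      intro T
      simp [xiCoeff_mono]
    rcases list_prod_xi l with h | ⟨T, -, h | h⟩
    · simp [h]
    · rw [h]; exact h1 T
    · rw [h]
      conv_lhs => rw [h1 T]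
      simp
  | zero => simp
  | add f g _ _ hf hg => simp only [map_add, add_smul, Finset.sum_add_distrib, ← hf, ← hg]
  | smul r f _ hf => simp only [map_smul, smul_assoc, ← Finset.smul_sum, ← hf]

theorem xiCoeff_of_mem_xiHom {m : ℕ} {f : TFun n} (hf : f ∈ xiHom n m) {S : Finset (Fin n)}
    (hS : S.card ≠ m) : xiCoeff S f = 0 := by
  induction hf using Submodule.span_induction with
  | mem f hf =>
    obtain ⟨l, hl, rfl⟩ := hf
    rcases list_prod_xi l with h | ⟨T, hT, h | h⟩
    · rw [h, map_zero]
    · rw [h, xiCoeff_mono, if_neg (by rintro rfl; omega)]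
    · rw [h, map_neg, xiCoeff_mono, if_neg (by rintro rfl; omega), neg_zero]
  | zero => simp
  | add f g _ _ hf hg => rw [map_add, hf, hg, add_zero]
  | smul r f _ hf => rw [map_smul, hf, smul_zero]

theorem mem_xiHom_of_sum {m : ℕ} {a : Finset (Fin n) → ℝ} (ha : ∀ S, a S ≠ 0 → S.card = m) :
    ∑ S, a S • mono xi S ∈ xiHom n m := by
  refine Submodule.sum_mem _ fun S _ => ?_
  by_cases h : a S = 0
  · rw [h, zero_smul]; exact Submodule.zero_mem _
  · exact Submodule.smul_mem _ _ (ha S h ▸ mono_mem_xiHom S)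

theorem xiCoeff_sum (a : Finset (Fin n) → ℝ) (S : Finset (Fin n)) :
    xiCoeff S (∑ T, a T • mono xi T) = a S := by
  simp [xiCoeff_mono]

/-- Homogeneous polynomials in `ξ` commute in the graded sense. -/
theorem xiHom_mul_comm {m k : ℕ} {f g : TFun n} (hf : f ∈ xiHom n m) (hg : g ∈ xiHom n k) :
    f * g = (-1 : ℝ) ^ (m * k) • (g * f) := by
  induction hf, hg using Submodule.span_induction₂ with
  | mem_mem f g hf hg =>
    obtain ⟨l, rfl, rfl⟩ := hf
    obtain ⟨l', rfl, rfl⟩ := hg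
    have h1 : ∀ (a : Fin n) (l : List (Fin n)), xi a * (l.map xi).prod =
        (-1 : ℝ) ^ l.length • ((l.map xi).prod * xi a) := by
      intro a l
      induction l with
      | nil => simp
      | cons b l ih =>
        rw [List.map_cons, List.prod_cons, ← mul_assoc, anticomm_xi.anti a b, neg_mul, mul_assoc,
          ih, mul_smul_comm, List.length_cons, pow_succ, mul_neg_one, neg_smul, mul_assoc]
    induction l with
    | nil => simp
    | cons a l ih =>
      rw [List.map_cons, List.prod_cons, mul_assoc, ih, mul_smul_comm, ← mul_assoc, h1,
        smul_mul_assoc, smul_smul, ← pow_add, mul_assoc, List.length_cons, add_mul, one_mul]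
  | zero_left g hg => simp
  | zero_right f hf => simp
  | add_left f f' g _ _ _ h₁ h₂ => rw [add_mul, mul_add, smul_add, h₁, h₂]
  | add_right f g g' _ _ _ h₁ h₂ => rw [add_mul, mul_add, smul_add, h₁, h₂]
  | smul_left r f g _ _ h => rw [smul_mul_assoc, mul_smul_comm, h, smul_comm]
  | smul_right r f g _ _ h => rw [smul_mul_assoc, mul_smul_comm, h, smul_comm]

theorem adjoin_xi_eq_sum {f : TFun n} (hf : f ∈ Algebra.adjoin ℝ (Set.range (xi : Fin n → TFun n))) :
    f = ∑ S, xiCoeff S f • mono xi S := by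
  have h : f ∈ Submodule.span ℝ {f : TFun n | ∃ l : List (Fin n), f = (l.map xi).prod} := by
    induction hf using Algebra.adjoin_induction with
    | mem f hf =>
      obtain ⟨a, rfl⟩ := hf
      exact Submodule.subset_span ⟨[a], by simp⟩
    | algebraMap r =>
      rw [Algebra.algebraMap_eq_smul_one]
      exact Submodule.smul_mem _ _ (Submodule.subset_span ⟨[], rfl⟩)
    | add f g _ _ hf hg => exact Submodule.add_mem _ hf hg
    | mul f g _ _ hf hg =>
      have h := Submodule.mul_mem_mul hf hg
      rw [Submodule.span_mul_span] at h
      refine Submodule.span_mono ?_ h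
      rintro _ ⟨_, ⟨l, rfl⟩, _, ⟨l', rfl⟩, rfl⟩
      exact ⟨l ++ l', by simp⟩
  clear hf
  induction h using Submodule.span_induction with
  | mem f hf =>
    obtain ⟨l, rfl⟩ := hf
    exact eq_sum_of_mem_xiHom (Submodule.subset_span ⟨l, rfl, rfl⟩)
  | zero => simp
  | add f g _ _ hf hg => simp only [map_add, add_smul, Finset.sum_add_distrib, ← hf, ← hg]
  | smul r f _ hf => simp only [map_smul, smul_assoc, ← Finset.smul_sum, ← hf]

theorem mono_xi_mem_adjoin (S : Finset (Fin n)) :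
    mono xi S ∈ Algebra.adjoin ℝ (Set.range (xi : Fin n → TFun n)) := by
  refine Subalgebra.list_prod_mem _ fun f hf => ?_
  obtain ⟨a, -, rfl⟩ := List.mem_map.mp hf
  exact Algebra.subset_adjoin ⟨a, rfl⟩

theorem calV_mem_xiHom (l : List (Fin n)) : calV l ∈ xiHom n (n - l.length) := by
  refine Submodule.smul_mem _ _ (Submodule.sum_mem _ fun b _ => Submodule.smul_mem _ _
    (Submodule.subset_span ⟨List.ofFn b, by simp, ?_⟩))
  rw [List.map_ofFn]; rfl

theorem sCoeff_mem_xiHom (A B : TIdx n) : sCoeff A B ∈ xiHom n (n - 3) := by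
  have h : ∀ A B : TIdx n, qCoeff A B ∈ xiHom n (n - 3) := by
    intro A B
    rcases A with a | a <;> rcases B with b | b
    · exact Submodule.zero_mem _
    · exact Submodule.sub_mem _ (calV_mem_xiHom [_, _, _]) (calV_mem_xiHom [_, _, _])
    · exact Submodule.zero_mem _
    · exact Submodule.zero_mem _
  exact Submodule.add_mem _ (h A B) (h B A)

/-! ### Vector fields with components depending on `ξ` only -/

/-- The `ρ`-independent vector field with given coefficients. -/
noncomputable def xiVec (n : ℕ) : (Coord n → ℝ) →ₗ[ℝ] TVec n where
  toFun w A := ∑ S, w (A, S) • mono xi S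
  map_add' v w := by
    funext A
    simp only [Pi.add_apply, add_smul, Finset.sum_add_distrib]
  map_smul' r w := by
    funext A
    simp only [Pi.smul_apply, smul_eq_mul, mul_smul, ← Finset.smul_sum, RingHom.id_apply]

theorem xiVec_apply (w : Coord n → ℝ) (A : TIdx n) : xiVec n w A = ∑ S, w (A, S) • mono xi S := rfl

theorem isRhoIndependent_xiVec (w : Coord n → ℝ) : IsRhoIndependent (xiVec n w) := by
  intro A
  rw [xiVec_apply]
  exact Subalgebra.sum_mem _ fun S _ => Subalgebra.smul_mem _ (mono_xi_mem_adjoin S) _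

/-- Coefficients that are supported on monomials of degree `p`. -/
def HomCoeff (p : ℕ) (w : Coord n → ℝ) : Prop := ∀ c, w c ≠ 0 → c.2.card = p

theorem HomCoeff.xiVec_mem {p : ℕ} {w : Coord n → ℝ} (hw : HomCoeff p w) (A : TIdx n) :
    xiVec n w A ∈ xiHom n p := mem_xiHom_of_sum fun S hS => hw (A, S) hS

/-- The contraction with the presymplectic form in terms of coefficients. -/
noncomputable def contrCoeff (n : ℕ) : (Coord n → ℝ) →ₗ[ℝ] (Coord n → ℝ) :=
  LinearMap.pi fun c => xiCoeff c.2 ∘ₗ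
    ∑ A, LinearMap.mulRight ℝ (sCoeff A c.1) ∘ₗ LinearMap.proj A ∘ₗ xiVec n

theorem contrCoeff_apply (w : Coord n → ℝ) (c : Coord n) :
    contrCoeff n w c = xiCoeff c.2 (contr (xiVec n w) c.1) := by
  simp [contrCoeff, contr]

theorem contr_mem_xiHom {p : ℕ} {X : TVec n} (hX : ∀ A, X A ∈ xiHom n p) (B : TIdx n) :
    contr X B ∈ xiHom n (p + (n - 3)) :=
  Submodule.sum_mem _ fun A _ => xiHom_mul (hX A) (sCoeff_mem_xiHom A B)

/-- The part of degree `p`. -/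
noncomputable def homPart (p : ℕ) : (Coord n → ℝ) →ₗ[ℝ] (Coord n → ℝ) :=
  LinearMap.pi fun c => if c.2.card = p then LinearMap.proj c else 0

theorem homPart_apply (p : ℕ) (w : Coord n → ℝ) (c : Coord n) :
    homPart p w c = if c.2.card = p then w c else 0 := by
  rw [homPart, LinearMap.pi_apply]
  split_ifs <;> rfl

theorem homCoeff_homPart (p : ℕ) (w : Coord n → ℝ) : HomCoeff p (homPart p w) := by
  intro c hc
  rw [homPart_apply] at hc
  by_contra h
  exact hc (if_neg h)

theorem sum_homPart (w : Coord n → ℝ) : ∑ p ∈ Finset.range (n + 1), homPart p w = w := by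
  funext c
  have : c.2.card < n + 1 := Nat.lt_succ_of_le (by simpa using Finset.card_le_univ c.2)
  simp [Finset.sum_apply, homPart_apply, this]

theorem contrCoeff_homCoeff {p : ℕ} {w : Coord n → ℝ} (hw : HomCoeff p w) :
    HomCoeff (p + (n - 3)) (contrCoeff n w) := by
  intro c hc
  by_contra h
  exact hc (by rw [contrCoeff_apply, xiCoeff_of_mem_xiHom (contr_mem_xiHom hw.xiVec_mem _) h])

/-- Contraction is homogeneous of degree n - 3 because the entries of S_{AB} are. Hence the
homogeneous parts of a kernel element lie in the kernel. -/
theorem contrCoeff_homPart (p : ℕ) (w : Coord n → ℝ) :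
    contrCoeff n (homPart p w) = homPart (p + (n - 3)) (contrCoeff n w) := by
  funext c
  rw [homPart_apply]
  conv_rhs => rw [← sum_homPart w, map_sum, Finset.sum_apply]
  have h : ∀ q, c.2.card ≠ q + (n - 3) → contrCoeff n (homPart q w) c = 0 := fun q hq => by
    by_contra h
    exact hq (contrCoeff_homCoeff (homCoeff_homPart q w) c h)
  split_ifs with h1
  · by_cases hp : p < n + 1
    · rw [Finset.sum_eq_single p (fun q _ hq => h q (by omega))
        (fun h => absurd (Finset.mem_range.mpr hp) h)]
    · rw [Finset.sum_eq_zero fun q hq => h q (by rw [Finset.mem_range] at hq; omega)]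
      -- A degree p > n is not among the summands, but then the homogeneous part itself vanishes.
      have : homPart p w = 0 := by
        funext c
        have : c.2.card < n + 1 := Nat.lt_succ_of_le (by simpa using Finset.card_le_univ c.2)
        rw [homPart_apply, if_neg (by omega), Pi.zero_apply]
      rw [this, map_zero, Pi.zero_apply]
  · exact h p h1

theorem contr_sum {κ : Type*} (s : Finset κ) (X : κ → TVec n) (B : TIdx n) :
    contr (∑ i ∈ s, X i) B = ∑ i ∈ s, contr (X i) B := by
  simp only [contr, Finset.sum_apply, Finset.sum_mul]
  exact Finset.sum_comm

/-- Contraction keeps the components polynomial in ξ alone, so on ρ-independent fields it is a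
constant real matrix. The proof splits into homogeneous parts, for which the monomial expansion of
the contraction is known. -/
theorem contr_xiVec (w : Coord n → ℝ) : contr (xiVec n w) = xiVec n (contrCoeff n w) := by
  funext B
  rw [xiVec_apply]
  simp only [contrCoeff_apply]
  have h : ∀ p, contr (xiVec n (homPart p w)) B =
      ∑ S, xiCoeff S (contr (xiVec n (homPart p w)) B) • mono xi S := fun p =>
    eq_sum_of_mem_xiHom (contr_mem_xiHom (homCoeff_homPart p w).xiVec_mem B)
  conv_lhs => rw [← sum_homPart w, map_sum, contr_sum, Finset.sum_congr rfl fun p _ => h p]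
  rw [Finset.sum_comm]
  refine Finset.sum_congr rfl fun S _ => ?_
  rw [← Finset.sum_smul, ← map_sum, ← contr_sum, ← map_sum, sum_homPart]

theorem xiVec_injective : Function.Injective (xiVec n) := by
  intro v w h
  funext c
  have := congrArg (xiCoeff c.2) (congrFun h c.1)
  rwa [xiVec_apply, xiVec_apply, xiCoeff_sum, xiCoeff_sum] at this

theorem tIota_xiVec_eq_zero_iff (w : Coord n → ℝ) :
    tIota (xiVec n w) (omegaT n) = 0 ↔ contrCoeff n w = 0 := by
  rw [tIota_omegaT_eq_zero_iff, contr_xiVec, ← (xiVec_injective (n := n)).eq_iff, map_zero]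
  exact funext_iff.symm

/-- The pairing of two homogeneous `ρ`-independent vector fields vanishes if one of them is in the
kernel. -/
theorem sum_mul_contr_eq_zero {p q : ℕ} {X Y : TVec n} (hX : ∀ A, X A ∈ xiHom n p)
    (hY : ∀ A, Y A ∈ xiHom n q) (h : contr Y = 0) : ∑ B, Y B * contr X B = 0 := by
  have h1 : ∀ A B, Y B * (X A * sCoeff A B) =
      (-1 : ℝ) ^ (q * p) • (X A * (Y B * sCoeff B A)) := by
    intro A B
    have : sCoeff A B = sCoeff B A := add_comm _ _
    rw [← mul_assoc, xiHom_mul_comm (hY B) (hX A), smul_mul_assoc, mul_assoc, this]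
  simp only [contr, Finset.mul_sum, h1]
  rw [Finset.sum_comm]
  simp only [← Finset.smul_sum, ← Finset.mul_sum]
  have h2 : ∀ A, ∑ B, Y B * sCoeff B A = 0 := fun A => congrFun h A
  simp [h2]


open SAlg

variable {n : ℕ} {U : Opens (BodySpace n)}

/-! ### A homogeneous basis adapted to the kernel -/

/-- A linearly independent family has a dual family of linear functionals. -/
theorem exists_dual_of_linearIndependent {ι V : Type*} [AddCommGroup V] [Module ℝ V]
    {v : ι → V} (hv : LinearIndependent ℝ v) [DecidableEq ι] :
    ∃ φ : ι → V →ₗ[ℝ] ℝ, ∀ i j, φ i (v j) = if i = j then 1 else 0 := by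
  obtain ⟨g, hg⟩ := LinearMap.exists_leftInverse_of_injective
    (Finsupp.linearCombination ℝ v) (LinearMap.ker_eq_bot.mpr hv)
  refine ⟨fun i => Finsupp.lapply i ∘ₗ g, fun i j => ?_⟩
  have h := LinearMap.congr_fun hg (Finsupp.single j 1)
  simp only [LinearMap.comp_apply, Finsupp.linearCombination_single, one_smul,
    LinearMap.id_apply] at h
  simp [h, Finsupp.single_apply, eq_comm]

/-- Start from an independent set of homogeneous kernel vectors spanning all homogeneous kernel
vectors, and extend it within the homogeneous vectors. It spans the whole kernel because contraction
is graded, so contraction is injective on the span of the added vectors. -/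
theorem exists_adapted_basis (n : ℕ) : ∃ (b : Module.Basis (Coord n) ℝ (Coord n → ℝ))
    (K : Finset (Coord n)) (p : Coord n → ℕ), (∀ i, HomCoeff (p i) (b i)) ∧
      (∀ i ∈ K, contrCoeff n (b i) = 0) ∧
      LinearIndependent ℝ fun i : {i // i ∉ K} => contrCoeff n (b i) := by
  classical
  let H : Set (Coord n → ℝ) := {w | ∃ p, HomCoeff p w}
  let N : Submodule ℝ (Coord n → ℝ) := LinearMap.ker (contrCoeff n)
  obtain ⟨B₀, hB₀, hspan, hli⟩ := exists_linearIndependent ℝ (H ∩ N)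
  have hli' : LinearIndepOn ℝ id B₀ := hli
  have hB₀H : B₀ ⊆ H := hB₀.trans Set.inter_subset_left
  let B := hli'.extend hB₀H
  have hBH : B ⊆ H := hli'.extend_subset hB₀H
  have hBspan : ⊤ ≤ Submodule.span ℝ (Set.range ((↑) : B → Coord n → ℝ)) := by
    rw [Subtype.range_coe, hli'.span_extend_eq_span]
    intro w _
    rw [← sum_homPart w]
    exact Submodule.sum_mem _ fun p _ => Submodule.subset_span ⟨p, homCoeff_homPart p w⟩
  have hBli : LinearIndependent ℝ ((↑) : B → Coord n → ℝ) := hli'.linearIndepOn_extend hB₀H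
  let β : Module.Basis B ℝ (Coord n → ℝ) := Module.Basis.mk hBli hBspan
  let e : B ≃ Coord n := β.indexEquiv (Pi.basisFun ℝ (Coord n))
  have hb : ∀ i, β.reindex e i = (e.symm i).1 := fun i => by
    rw [Module.Basis.reindex_apply, Module.Basis.mk_apply]
  choose p hp using fun x : B => hBH x.2
  let K : Finset (Coord n) := Finset.univ.filter fun i => (e.symm i).1 ∈ B₀
  have hN : N ≤ Submodule.span ℝ B₀ := by
    rw [hspan]
    intro w hw
    rw [← sum_homPart w]
    refine Submodule.sum_mem _ fun p _ => Submodule.subset_span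
      ⟨⟨p, homCoeff_homPart p w⟩, ?_⟩
    have : contrCoeff n w = 0 := hw
    change contrCoeff n (homPart p w) = 0
    rw [contrCoeff_homPart, this, map_zero]
  refine ⟨β.reindex e, K, fun i => p (e.symm i), fun i => ?_, fun i hi => ?_, ?_⟩
  · rw [hb]; exact hp _
  · rw [hb]
    exact (hB₀ (Finset.mem_filter.mp hi).2).2
  · have h1 : LinearIndependent ℝ fun i : {i // i ∉ K} => β.reindex e i :=
      (β.reindex e).linearIndependent.comp _ Subtype.val_injective
    refine h1.map (f := contrCoeff n) ?_
    -- The kernel lies in the span of the vectors indexed by K, which meets the span of the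
    -- remaining ones only in zero.
    have h2 := (β.reindex e).linearIndependent.disjoint_span_image
      (s := {i | i ∉ K}) (t := {i | i ∈ K})
      (Set.disjoint_left.mpr fun i hi hi' => hi hi')
    refine h2.mono (Submodule.span_mono ?_) (hN.trans (Submodule.span_mono ?_))
    · rintro _ ⟨i, rfl⟩
      exact ⟨i.1, i.2, rfl⟩
    · intro w hw
      have hwB : w ∈ B := hli'.subset_extend hB₀H hw
      refine ⟨e ⟨w, hwB⟩, ?_, ?_⟩
      · simp [K, hw]
      · rw [hb, Equiv.symm_apply_apply]

/-! ### The frame of prolongations -/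

theorem subst_xiVec (w : Coord n → ℝ) (A : TIdx n) :
    subst U (xiVec n w A) = ∑ S, w (A, S) • mono (xiFn U) S := by
  rw [xiVec_apply, map_sum]
  exact Finset.sum_congr rfl fun S _ => by rw [map_smul, subst_mono_xi]

theorem isHomogeneous_prolong {p : ℕ} {w : Coord n → ℝ} (hw : HomCoeff p w) :
    (prolong U (xiVec n w)).IsHomogeneous (p - 1) := by
  intro c
  rw [prolong, subst_xiVec, thetaCoeff_sum]
  refine isHomogeneous_sum fun S _ => ?_
  rw [thetaCoeff_smul]
  by_cases h : w (c.1, S) = 0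
  · rw [h, zero_smul]; exact isHomogeneous_zero _
  · refine Fn.IsHomogeneous.smul ?_ _
    have h1 := isHomogeneous_thetaCoeff_prod (U := U) (S.sort.map Sum.inl) c.2
    rw [List.length_map, Finset.length_sort, List.map_map] at h1
    have h2 : ((S.card : ℕ) : ℤ) - c.2.card = (p : ℤ) - 1 + c.deg := by
      rw [show S.card = p from hw _ h, Coord.deg]; ring
    rw [← h2]
    exact h1

theorem contrTheta_prolong_xiVec (w : Coord n → ℝ) (B : TIdx n) :
    contrTheta (prolong U (xiVec n w)) B = ∑ S, contrCoeff n w (B, S) • mono (xiFn U) S := by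
  rw [contrTheta_prolong, contr_xiVec, subst_xiVec]

theorem fnIn_smul_mul (r : ℝ) (f : Fn U) (F : FnTheta U) :
    fnIn U f * (r • F) = fnIn U (r • f) * F := by
  rw [mul_smul_comm, map_smul, smul_mul_assoc]

theorem sum_smul_mono_eq {κ : Type*} [Fintype κ] (v : κ → Fn U) (w : κ → Coord n → ℝ)
    (A : TIdx n) :
    ∑ i, fnIn U (v i) * ∑ S, w i (A, S) • mono (xiFn U) S =
      ∑ S, fnIn U (∑ i, w i (A, S) • v i) * mono (xiFn U) S := by
  simp only [Finset.mul_sum, map_sum, Finset.sum_mul, fnIn_smul_mul]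
  exact Finset.sum_comm

theorem eq_sum_single {φ : (Coord n → ℝ) →ₗ[ℝ] ℝ} (w : Coord n → ℝ) :
    φ w = ∑ c, φ (Pi.single c 1) * w c := by
  classical
  have h : w = ∑ c, w c • (Pi.single c 1 : Coord n → ℝ) := by
    funext c
    simp [Finset.sum_apply, Pi.single_apply]
  conv_lhs => rw [h, map_sum]
  exact Finset.sum_congr rfl fun c _ => by rw [map_smul, smul_eq_mul, mul_comm]

/-- Real linear independence persists with coefficients in 𝒪(U): a dual family of real functionals
can be applied to the relation, being finite real combinations of its components. -/
theorem eq_zero_of_sum_smul {κ : Type*} [Fintype κ] {w : κ → Coord n → ℝ}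
    (hw : LinearIndependent ℝ w) {v : κ → Fn U} (h : ∀ c, ∑ i, w i c • v i = 0) (i : κ) :
    v i = 0 := by
  classical
  obtain ⟨φ, hφ⟩ := exists_dual_of_linearIndependent hw
  have h1 : ∑ j, φ i (w j) • v j = 0 := by
    have h2 : ∀ j, φ i (w j) • v j = ∑ c, φ i (Pi.single c 1) • (w j c • v j) := by
      intro j
      rw [eq_sum_single (φ := φ i) (w j), Finset.sum_smul]
      exact Finset.sum_congr rfl fun c _ => mul_smul _ _ _
    simp only [h2]
    rw [Finset.sum_comm]
    simp only [← Finset.smul_sum, h, smul_zero, Finset.sum_const_zero]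
  simpa [hφ] using h1

theorem eq_zero_of_sum_fnIn_mul (hU : U ≤ body n) {κ : Type*} [Fintype κ] {w : κ → Coord n → ℝ}
    (hw : LinearIndependent ℝ w) {v : κ → Fn U}
    (h : ∀ A, ∑ i, fnIn U (v i) * ∑ S, w i (A, S) • mono (xiFn U) S = 0) (i : κ) : v i = 0 := by
  refine eq_zero_of_sum_smul hw (fun c => ?_) i
  have h1 := h c.1
  rw [sum_smul_mono_eq] at h1
  exact congrFun (eq_zero_of_sum_mono_xi hU h1) c.2

theorem vec_ext {V W : Vec U} (h : ∀ A, vTheta V A = vTheta W A) : V = W := by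
  funext c
  have := congrArg (thetaCoeff c.2) (h c.1)
  rwa [vTheta, vTheta, thetaCoeff_expansion, thetaCoeff_expansion] at this

/-- The ξ(θ)^S are a basis of the functions of θ, so the prolongations of ξ^S ∂/∂ψ^A are a basis of
the vector fields; a constant real change of basis preserves this. -/
theorem exists_prolong_basis (hU : U ≤ body n) (b : Module.Basis (Coord n) ℝ (Coord n → ℝ)) :
    ∃ E : Module.Basis (Coord n) (Fn U) (Vec U), ∀ i, E i = prolong U (xiVec n (b i)) := by
  classical
  have hv : ∀ (v : Coord n → Fn U) A, vTheta (∑ i, v i • prolong U (xiVec n (b i))) A =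
      ∑ i, fnIn U (v i) * ∑ S, b i (A, S) • mono (xiFn U) S := by
    intro v A
    rw [vTheta_sum_smul]
    exact Finset.sum_congr rfl fun i _ => by rw [vTheta_prolong, subst_xiVec]
  have hli : LinearIndependent (Fn U) fun i => prolong U (xiVec n (b i)) := by
    rw [Fintype.linearIndependent_iff]
    intro v h
    refine eq_zero_of_sum_fnIn_mul hU b.linearIndependent fun A => ?_
    rw [← hv, h]
    simp [vTheta]
  refine ⟨Module.Basis.mk hli fun V _ => ?_, fun i => Module.Basis.mk_apply _ _ i⟩
  choose a ha using fun A => exists_eq_sum_mono_xi hU (vTheta V A)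
  -- The coefficients arise from re-expanding each unit vector ξ^S ∂/∂ψ^A in the basis b.
  have h1 : V = ∑ i, (∑ c : Coord n, b.repr (Pi.single c 1) i • a c.1 c.2) •
      prolong U (xiVec n (b i)) := by
    refine vec_ext fun A => ?_
    rw [hv, sum_smul_mono_eq, ha A]
    refine Finset.sum_congr rfl fun S _ => ?_
    congr 2
    have h2 : ∀ c c' : Coord n, ∑ i, b i c' * b.repr (Pi.single c 1) i =
        if c' = c then 1 else 0 := by
      intro c c'
      have := congrFun (b.sum_repr (Pi.single c (1 : ℝ))) c'
      rw [Finset.sum_apply, Pi.single_apply] at this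
      rw [← this]
      exact Finset.sum_congr rfl fun i _ => mul_comm _ _
    simp only [Finset.smul_sum, smul_smul]
    rw [Finset.sum_comm]
    simp [← Finset.sum_smul, h2]
  rw [h1]
  exact Submodule.sum_mem _ fun i _ => Submodule.smul_mem _ _ (Submodule.subset_span ⟨i, rfl⟩)

theorem sum_notMem {κ M : Type*} [Fintype κ] [AddCommMonoid M] (K : Finset κ)
    [Fintype {i // i ∉ K}] (f : κ → M) (hf : ∀ i ∈ K, f i = 0) :
    ∑ i : {i // i ∉ K}, f i = ∑ i, f i := by
  classical
  rw [← Finset.sum_filter_of_ne (s := Finset.univ) (p := fun i => i ∉ K)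
    fun i _ h hi => h (hf i hi)]
  exact (Finset.sum_subtype _ (by simp) f).symm

/-- Over an open subset of the body, the kernel of the presymplectic form is spanned by
prolongations. -/
theorem mem_span_prolong (hU : U ≤ body n) {V : Vec U} (hV : iota V (omegaM U) = 0) :
    V ∈ Submodule.span (Fn U) {W | ∃ X : TVec n, IsRhoIndependent X ∧
      tIota X (omegaT n) = 0 ∧ W = prolong U X} := by
  classical
  obtain ⟨b, K, p, -, hK, hli⟩ := exists_adapted_basis n
  obtain ⟨E, hE⟩ := exists_prolong_basis hU b
  -- Contraction removes the terms with index in K, and the contractions of the others are linearly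
  -- independent, so their coefficients vanish.
  have h1 : ∀ i : {i // i ∉ K}, E.repr V i = 0 := by
    refine eq_zero_of_sum_fnIn_mul hU hli fun A => ?_
    have h2 := (iota_omegaM_eq_zero_iff V).mp hV A
    rw [← E.sum_repr V, contrTheta_sum_smul] at h2
    simp only [hE, contrTheta_prolong_xiVec] at h2
    rw [← h2]
    refine sum_notMem K (fun i => fnIn U (E.repr V i) *
      ∑ S, contrCoeff n (b i) (A, S) • mono (xiFn U) S) fun i hi => ?_
    simp [hK i hi]
  rw [← E.sum_repr V]
  refine Submodule.sum_mem _ fun i _ => ?_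
  by_cases hi : i ∈ K
  · refine Submodule.smul_mem _ _ (Submodule.subset_span ⟨xiVec n (b i),
      isRhoIndependent_xiVec _, (tIota_xiVec_eq_zero_iff _).mpr (hK i hi), hE i⟩)
  · rw [h1 ⟨i, hi⟩, zero_smul]
    exact Submodule.zero_mem _

theorem exists_inverse_of_mul_transpose_eq_one {κ : Type} [Fintype κ] [DecidableEq κ]
    {M N : Matrix κ κ (Fn U)} (h : M * N.transpose = 1) :
    ∃ N' : Matrix κ κ (Fn U), N * N' = 1 ∧ N' * N = 1 := by
  obtain ⟨u, hu⟩ := isUnit_of_mul_transpose_eq_one h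
  exact ⟨(u⁻¹).val, by rw [← hu, Units.mul_inv], by rw [← hu, Units.inv_mul]⟩

/-- The matrix of the presymplectic form on prolongations. -/
theorem iota_iota_prolong (X Y : TVec n) : iota (prolong U Y) (iota (prolong U X) (omegaM U)) =
    Fn.toForm U (berezin (∑ B, subst U (Y B) * subst U (contr X B))) := by
  rw [iota_omegaM, iota_intForm]
  simp only [vTheta_prolong, contrTheta_prolong]

/-- Nondegeneracy outside K is proved by exhibiting vector fields dual to the E_i, i ∉ K, under the
form. Expanding them in the frame gives H with H Gᵀ = 1, and invertibility modulo odd variables does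
the rest. -/
theorem regular_presymplectic (hn : 3 ≤ n) :
    IsRegularPresymplectic (omegaM (n := n)) := by
  classical
  refine ⟨fun U _ => deRham_omegaM hn, ?_⟩
  obtain ⟨b, K, p, hp, hK, hli⟩ := exists_adapted_basis n
  refine ⟨K, fun i => p i - 1, fun U hU => ?_⟩
  obtain ⟨E, hE⟩ := exists_prolong_basis hU b
  refine ⟨E, fun i => ?_, fun i hi => ?_, ?_⟩
  · rw [hE]; exact isHomogeneous_prolong (hp i)
  · rw [hE]; exact iota_prolong ((tIota_xiVec_eq_zero_iff _).mpr (hK i hi))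
  let F : Coord n → Coord n → Fn U := fun i j =>
    berezin (∑ B, subst U (xiVec n (b j) B) * subst U (contr (xiVec n (b i)) B))
  -- For homogeneous fields the pairing is symmetric up to sign, so a kernel field also pairs to
  -- zero in the second slot.
  have hF : ∀ i j, j ∈ K → F i j = 0 := by
    intro i j hj
    simp only [F, ← map_mul, ← map_sum]
    rw [sum_mul_contr_eq_zero (hp i).xiVec_mem (hp j).xiVec_mem
      (by rw [contr_xiVec, hK j hj, map_zero]), map_zero, berezin, thetaCoeff_zero]
  let G : Matrix {i // i ∉ K} {i // i ∉ K} (Fn U) := Matrix.of fun i j => F i j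
  have hG : ∀ i j, Fn.toForm U (G i j) = iota (E j) (iota (E i) (omegaM U)) := by
    intro i j
    rw [hE, hE, iota_iota_prolong]; rfl
  obtain ⟨φ, hφ⟩ := exists_dual_of_linearIndependent hli
  obtain ⟨Y, hY⟩ := exists_dual_mono_xi hU
  -- The functionals φ_l are dual to the contractions of the b_i, i ∉ K, and Y_S is the Berezin dual
  -- of ξ(θ)^S; together they give generating functions dual to the contracted fields.
  let y : {i // i ∉ K} → TIdx n → FnTheta U := fun l B => ∑ S, φ l (Pi.single (B, S) 1) • Y S
  let V : {i // i ∉ K} → Vec U := fun l c => thetaCoeff c.2 (y l c.1)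
  have hV : ∀ l (i : {i // i ∉ K}), berezin (∑ B, vTheta (V l) B *
      subst U (contr (xiVec n (b i)) B)) = if l = i then 1 else 0 := by
    intro l i
    have h1 : ∀ B, berezin (vTheta (V l) B * subst U (contr (xiVec n (b i)) B)) =
        ∑ S, (φ l (Pi.single (B, S) 1) * contrCoeff n (b i) (B, S)) • (1 : Fn U) := by
      intro B
      rw [vTheta_thetaCoeff, contr_xiVec, subst_xiVec, Finset.sum_mul_sum, berezin, thetaCoeff_sum]
      refine Finset.sum_congr rfl fun S _ => ?_
      rw [thetaCoeff_sum]
      simp only [smul_mul_smul_comm, thetaCoeff_smul]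
      have h2 := hY S
      unfold berezin at h2
      simp [h2]
    have h2 : berezin (∑ B, vTheta (V l) B * subst U (contr (xiVec n (b i)) B)) =
        ∑ B, berezin (vTheta (V l) B * subst U (contr (xiVec n (b i)) B)) := thetaCoeff_sum _ _ _
    rw [h2]
    simp only [h1, ← Finset.sum_smul]
    rw [← Fintype.sum_prod_type' (fun B S => φ l (Pi.single (B, S) 1) * contrCoeff n (b i) (B, S)),
      ← eq_sum_single, hφ]
    split_ifs <;> simp
  -- Components along K may be dropped from H since the pairings `F i j` with j ∈ K vanish. The
  -- transpose appears because the second index of F is that of the field contracted last.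
  let H : Matrix {i // i ∉ K} {i // i ∉ K} (Fn U) := Matrix.of fun l j => E.repr (V l) j
  have hHG : H * G.transpose = 1 := by
    ext l i
    rw [Matrix.mul_apply, Matrix.one_apply, ← hV l i]
    have h1 : ∀ B, vTheta (V l) B =
        ∑ j, fnIn U (E.repr (V l) j) * subst U (xiVec n (b j) B) := by
      intro B
      conv_lhs => rw [← E.sum_repr (V l), vTheta_sum_smul]
      exact Finset.sum_congr rfl fun j _ => by rw [hE, vTheta_prolong]
    have h2 : berezin (∑ B, vTheta (V l) B * subst U (contr (xiVec n (b i)) B)) =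
        ∑ j, E.repr (V l) j * F i j := by
      simp only [h1, Finset.sum_mul]
      rw [Finset.sum_comm]
      simp only [mul_assoc, ← Finset.mul_sum]
      rw [berezin, thetaCoeff_sum]
      simp only [thetaCoeff_tin_mul]
      rfl
    rw [h2]
    exact sum_notMem K (fun j => E.repr (V l) j * F i j) fun j hj => by rw [hF i j hj, mul_zero]
  obtain ⟨G', h1, h2⟩ := exists_inverse_of_mul_transpose_eq_one hHG
  exact ⟨G, G', h1, h2, hG⟩


/-! ### The case of dimension four -/

section DimensionFour

theorem dT_xi_xi {n : ℕ} (a b : Fin n) : dT (Sum.inl a) (xi b) = if a = b then (1 : TFun n) else 0 := by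
  have := dT_tCoord_mul (Sum.inl a) (Sum.inl b) (1 : TFun n)
  rw [mul_one, dT_one, mul_zero, sub_zero] at this
  rw [xi, this]
  simp

theorem dT_xi_xi_mul {n : ℕ} (a b : Fin n) (x : TFun n) : dT (Sum.inl a) (xi b * x) =
    (if a = b then x else 0) - xi b * dT (Sum.inl a) x := by
  rw [xi, dT_tCoord_mul]
  simp

theorem mono_univ_four_eq : (mono xi Finset.univ : TFun 4) = xi 0 * (xi 1 * (xi 2 * xi 3)) := by
  have : (Finset.univ : Finset (Fin 4)).sort = [0, 1, 2, 3] := by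
    rw [Fin.sort_univ]; rfl
  rw [mono, this]
  simp

/-- By degree, 𝒱 is a multiple of the top monomial; differentiating both four times fixes the
factor, since ε_{0123} = 1. -/
theorem calV_nil_four : calV [] = (xi 0 * (xi 1 * (xi 2 * xi 3)) : TFun 4) := by
  have hmem : (calV [] : TFun 4) ∈ xiHom 4 4 := calV_mem_xiHom []
  have h1 : (calV [] : TFun 4) =
      xiCoeff Finset.univ (calV [] : TFun 4) • (mono xi Finset.univ : TFun 4) := by
    conv_lhs => rw [eq_sum_of_mem_xiHom hmem]
    refine Finset.sum_eq_single _ (fun S _ hS => ?_) (by simp)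
    rw [xiCoeff_of_mem_xiHom hmem, zero_smul]
    intro h
    exact hS (Finset.eq_univ_of_card S (by rw [h]; rfl))
  have h2 := mono_univ_four_eq
  have h3 : calV [0, 1, 2, 3] = (1 : TFun 4) := by
    have : eps [(0 : Fin 4), 1, 2, 3] = 1 := by
      have h : (Matrix.of fun i j : Fin 4 =>
          if [(0 : Fin 4), 1, 2, 3][(i : ℕ)]? = some j then (1 : ℝ) else 0) = 1 := by
        ext i j
        fin_cases i <;> fin_cases j <;> simp
      rw [eps, h, Matrix.det_one]
    simp [calV, this]
  have h4 : calV [0, 1, 2, 3] = dT (Sum.inl 3) (dT (Sum.inl 2) (dT (Sum.inl 1)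
      (dT (Sum.inl 0) (calV [] : TFun 4)))) := by
    rw [dT_xi_calV 0 (by simp), List.nil_append, dT_xi_calV 1 (by simp), dT_xi_calV 2 (by simp),
      dT_xi_calV 3 (by simp)]
    rfl
  rw [h3, h1, h2] at h4
  have h5 : dT (Sum.inl 3) (dT (Sum.inl 2) (dT (Sum.inl 1)
      (dT (Sum.inl 0) (xi 0 * (xi 1 * (xi 2 * xi 3)) : TFun 4)))) = 1 := by
    simp [dT_xi_xi, dT_xi_xi_mul]
  simp only [map_smul, h5] at h4
  have h6 : xiCoeff Finset.univ (calV [] : TFun 4) = 1 := by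
    have := congrArg ExteriorAlgebra.algebraMapInv h4
    simpa using this.symm
  rw [h1, h6, one_smul, h2]

theorem mono_univ_four : (mono xi Finset.univ : TFun 4) = calV [] := by
  rw [mono_univ_four_eq, calV_nil_four]

theorem contr_inr {n : ℕ} (X : TVec n) (p) : contr X (Sum.inr p) =
    ∑ a, X (Sum.inl a) * (calV [a, p.1.1, p.1.2] - calV [a, p.1.2, p.1.1]) := by
  simp [contr, sCoeff, qCoeff]

theorem rhoComp_swap {n : ℕ} {G : Type} [AddGroup G] (f : TIdx n → G) (a b : Fin n) :
    rhoComp f a b = -rhoComp f b a := by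
  unfold rhoComp
  rcases lt_trichotomy a b with h | h | h
  · simp [h, h.not_gt]
  · simp [h]
  · simp [h, h.not_gt]

theorem rhoComp_self {n : ℕ} {G : Type} [AddGroup G] (f : TIdx n → G) (a : Fin n) :
    rhoComp f a a = 0 := by
  simp [rhoComp]

theorem map_rhoComp {n : ℕ} {G G' : Type} [AddGroup G] [AddGroup G'] (φ : G →+ G')
    (f : TIdx n → G) (a b : Fin n) : rhoComp (fun A => φ (f A)) a b = φ (rhoComp f a b) := by
  unfold rhoComp
  split_ifs <;> simp

theorem contr_inl {n : ℕ} (X : TVec n) (a : Fin n) : contr X (Sum.inl a) =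
    ∑ b, ∑ c, rhoComp X b c * calV [a, b, c] := by
  -- In this contraction the components of X stand on the left, so the summation rule is applied in
  -- the opposite ring.
  have h := sum_mul_rhoComp (R := (TFun n)ᵐᵒᵖ) (fun b c => MulOpposite.op (calV [a, b, c]))
    (fun A => MulOpposite.op (X A))
  have h' := map_rhoComp (MulOpposite.opAddEquiv (α := TFun n)).toAddMonoidHom X
  simp only [AddEquiv.coe_toAddMonoidHom, MulOpposite.opAddEquiv_apply] at h'
  simp only [h', ← MulOpposite.op_mul, ← MulOpposite.op_sub] at h
  replace h := congrArg MulOpposite.unop h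
  simp only [Finset.unop_sum, MulOpposite.unop_op] at h
  rw [h]
  simp [contr, sCoeff, qCoeff]

theorem forall_of_increasing {P : Fin 4 → Fin 4 → Fin 4 → Prop}
    (rot : ∀ b c d, P b c d → P c d b) (swap : ∀ b c d, P b c d → P c b d) (rep : ∀ b d, P b b d)
    (h₁ : P 0 1 2) (h₂ : P 0 1 3) (h₃ : P 0 2 3) (h₄ : P 1 2 3) (b c d : Fin 4) : P b c d := by
  fin_cases b <;> fin_cases c <;> fin_cases d <;> first
    | assumption
    | exact rep _ _
    | exact rot _ _ _ (by assumption)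
    | exact rot _ _ _ (rot _ _ _ (by assumption))
    | exact swap _ _ _ (by assumption)
    | exact swap _ _ _ (rot _ _ _ (by assumption))
    | exact swap _ _ _ (rot _ _ _ (rot _ _ _ (by assumption)))
    | exact rot _ _ _ (rep _ _)
    | exact rot _ _ _ (rot _ _ _ (rep _ _))

theorem forall_lt_four {Q : {p : Fin 4 × Fin 4 // p.1 < p.2} → Prop}
    (h₁ : Q ⟨(0, 1), by decide⟩) (h₂ : Q ⟨(0, 2), by decide⟩) (h₃ : Q ⟨(0, 3), by decide⟩)
    (h₄ : Q ⟨(1, 2), by decide⟩) (h₅ : Q ⟨(1, 3), by decide⟩) (h₆ : Q ⟨(2, 3), by decide⟩)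
    (p) : Q p := by
  obtain ⟨⟨b, c⟩, h⟩ := p
  fin_cases b <;> fin_cases c <;> first | exact absurd h (by decide) | assumption

/-- In dimension four 𝒱_{abc} is ± the variable with the missing index. The component along ρ^{bc}
is therefore twice, up to sign, X^a ξ^d - X^d ξ^a for the complementary pair, and the component
along ξ^a is ±2 times the cyclic sum over the other three indices. -/
theorem contr_eq_zero_iff_four (X : TVec 4) : contr X = 0 ↔
    (∀ a d, X (Sum.inl a) * xi d = X (Sum.inl d) * xi a) ∧
    ∀ b c d, rhoComp X b c * xi d + rhoComp X c d * xi b + rhoComp X d b * xi c = 0 := by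
  have e1 : contr X (Sum.inr ⟨(0, 1), by decide⟩) =
      2 * (X (Sum.inl 2) * xi 3 - X (Sum.inl 3) * xi 2) := by
    rw [contr_inr]
    simp [Fin.sum_univ_four, calV_three, calV_nil_four, dT_xi_xi, dT_xi_xi_mul]
    noncomm_ring
  have e2 : contr X (Sum.inr ⟨(0, 2), by decide⟩) =
      2 * (X (Sum.inl 3) * xi 1 - X (Sum.inl 1) * xi 3) := by
    rw [contr_inr]
    simp [Fin.sum_univ_four, calV_three, calV_nil_four, dT_xi_xi, dT_xi_xi_mul]
    noncomm_ring
  have e3 : contr X (Sum.inr ⟨(0, 3), by decide⟩) =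
      2 * (X (Sum.inl 1) * xi 2 - X (Sum.inl 2) * xi 1) := by
    rw [contr_inr]
    simp [Fin.sum_univ_four, calV_three, calV_nil_four, dT_xi_xi, dT_xi_xi_mul]
    noncomm_ring
  have e4 : contr X (Sum.inr ⟨(1, 2), by decide⟩) =
      2 * (X (Sum.inl 0) * xi 3 - X (Sum.inl 3) * xi 0) := by
    rw [contr_inr]
    simp [Fin.sum_univ_four, calV_three, calV_nil_four, dT_xi_xi, dT_xi_xi_mul]
    noncomm_ring
  have e5 : contr X (Sum.inr ⟨(1, 3), by decide⟩) =
      2 * (X (Sum.inl 2) * xi 0 - X (Sum.inl 0) * xi 2) := by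
    rw [contr_inr]
    simp [Fin.sum_univ_four, calV_three, calV_nil_four, dT_xi_xi, dT_xi_xi_mul]
    noncomm_ring
  have e6 : contr X (Sum.inr ⟨(2, 3), by decide⟩) =
      2 * (X (Sum.inl 0) * xi 1 - X (Sum.inl 1) * xi 0) := by
    rw [contr_inr]
    simp [Fin.sum_univ_four, calV_three, calV_nil_four, dT_xi_xi, dT_xi_xi_mul]
    noncomm_ring
  have s := rhoComp_swap X
  have f0 : contr X (Sum.inl 0) =
      2 * (rhoComp X 1 2 * xi 3 + rhoComp X 2 3 * xi 1 + rhoComp X 3 1 * xi 2) := by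
    rw [contr_inl]
    simp [Fin.sum_univ_four, calV_three, calV_nil_four, dT_xi_xi, dT_xi_xi_mul]
    rw [s 2 1, s 3 2, s 1 3]
    noncomm_ring
  have f1 : contr X (Sum.inl 1) =
      -2 * (rhoComp X 0 2 * xi 3 + rhoComp X 2 3 * xi 0 + rhoComp X 3 0 * xi 2) := by
    rw [contr_inl]
    simp [Fin.sum_univ_four, calV_three, calV_nil_four, dT_xi_xi, dT_xi_xi_mul]
    rw [s 2 0, s 3 2, s 0 3]
    noncomm_ring
  have f2 : contr X (Sum.inl 2) =
      2 * (rhoComp X 0 1 * xi 3 + rhoComp X 1 3 * xi 0 + rhoComp X 3 0 * xi 1) := by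
    rw [contr_inl]
    simp [Fin.sum_univ_four, calV_three, calV_nil_four, dT_xi_xi, dT_xi_xi_mul]
    rw [s 1 0, s 3 1, s 0 3]
    noncomm_ring
  have f3 : contr X (Sum.inl 3) =
      -2 * (rhoComp X 0 1 * xi 2 + rhoComp X 1 2 * xi 0 + rhoComp X 2 0 * xi 1) := by
    rw [contr_inl]
    simp [Fin.sum_univ_four, calV_three, calV_nil_four, dT_xi_xi, dT_xi_xi_mul]
    rw [s 1 0, s 2 1, s 0 2]
    noncomm_ring
  have two : ∀ x : TFun 4, 2 * x = 0 → x = 0 := by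
    intro x hx
    rw [two_mul, ← two_smul ℝ] at hx
    exact (smul_eq_zero.mp hx).resolve_left two_ne_zero
  constructor
  · intro h
    have two' : ∀ x : TFun 4, -2 * x = 0 → x = 0 := fun x hx =>
      two x (by rwa [neg_mul, neg_eq_zero] at hx)
    rw [h] at e1 e2 e3 e4 e5 e6 f0 f1 f2 f3
    replace e1 := sub_eq_zero.mp (two _ e1.symm)
    replace e2 := sub_eq_zero.mp (two _ e2.symm)
    replace e3 := sub_eq_zero.mp (two _ e3.symm)
    replace e4 := sub_eq_zero.mp (two _ e4.symm)
    replace e5 := sub_eq_zero.mp (two _ e5.symm)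
    replace e6 := sub_eq_zero.mp (two _ e6.symm)
    replace f0 := two _ f0.symm
    replace f1 := two' _ f1.symm
    replace f2 := two _ f2.symm
    replace f3 := two' _ f3.symm
    refine ⟨fun a d => ?_, ?_⟩
    · fin_cases a <;> fin_cases d <;> first | rfl | assumption | (symm; assumption)
    · let P : Fin 4 → Fin 4 → Fin 4 → Prop := fun b c d =>
        rhoComp X b c * xi d + rhoComp X c d * xi b + rhoComp X d b * xi c = 0
      have rot : ∀ b c d, P b c d → P c d b := by
        intro b c d h
        simp only [P] at h ⊢
        rw [← h]; abel
      have swap : ∀ b c d, P b c d → P c b d := by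
        intro b c d h
        simp only [P] at h ⊢
        rw [s c b, s b d, s d c, ← neg_eq_zero, ← h]
        noncomm_ring
      have rep : ∀ b d, P b b d := by
        intro b d
        simp only [P]
        rw [rhoComp_self, s d b]
        noncomm_ring
      intro b c d
      change P b c d
      have g0 : P 1 2 3 := f0
      have g1 : P 0 2 3 := f1
      have g2 : P 0 1 3 := f2
      have g3 : P 0 1 2 := f3
      exact forall_of_increasing rot swap rep g3 g2 g1 g0 b c d
  · rintro ⟨h, h'⟩
    funext B
    rcases B with a | p
    · fin_cases a
      · exact f0.trans (by rw [h', mul_zero]; rfl)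
      · exact f1.trans (by rw [h', mul_zero]; rfl)
      · exact f2.trans (by rw [h', mul_zero]; rfl)
      · exact f3.trans (by rw [h', mul_zero]; rfl)
    · refine forall_lt_four (Q := fun p => contr X (Sum.inr p) = 0) ?_ ?_ ?_ ?_ ?_ ?_ p
      · rw [e1, h, sub_self, mul_zero]
      · rw [e2, h, sub_self, mul_zero]
      · rw [e3, h, sub_self, mul_zero]
      · rw [e4, h, sub_self, mul_zero]
      · rw [e5, h, sub_self, mul_zero]
      · rw [e6, h, sub_self, mul_zero]

end DimensionFour


/-! ### Products of 𝒱 with the variables ξ. -/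

variable {n : ℕ}

theorem xiHom_eq_zero {m : ℕ} (hm : n < m) {f : TFun n} (hf : f ∈ xiHom n m) : f = 0 := by
  rw [eq_sum_of_mem_xiHom hf]
  refine Finset.sum_eq_zero fun S _ => ?_
  have : S.card ≤ n := by simpa using Finset.card_le_univ S
  rw [xiCoeff_of_mem_xiHom hf (by omega), zero_smul]

theorem xi_mem_xiHom (a : Fin n) : xi a ∈ xiHom n 1 :=
  Submodule.subset_span ⟨[a], rfl, by simp⟩

theorem involute_xiHom {m : ℕ} {f : TFun n} (hf : f ∈ xiHom n m) :
    CliffordAlgebra.involute f = (-1 : ℝ) ^ m • f := by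
  induction hf using Submodule.span_induction with
  | mem f hf =>
    obtain ⟨l, rfl, rfl⟩ := hf
    induction l with
    | nil => simp
    | cons a l ih =>
      have h : CliffordAlgebra.involute (xi a : TFun n) = -xi a := CliffordAlgebra.involute_ι _
      rw [List.map_cons, List.prod_cons, List.length_cons, pow_succ, mul_neg_one, neg_smul,
        ← mul_smul_comm, ← neg_mul, ← h, ← ih]
      exact map_mul _ _ _
  | zero => simp
  | add f g _ _ hf hg => rw [smul_add, ← hf, ← hg]; exact map_add _ _ _
  | smul r f _ hf => rw [smul_comm, ← hf]; exact map_smul _ _ _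

theorem dT_mul {m : ℕ} (A : TIdx n) {f : TFun n} (hf : f ∈ xiHom n m) (g : TFun n) :
    dT A (f * g) = dT A f * g + (-1 : ℝ) ^ m • (f * dT A g) := by
  refine (SAlg.contractLeft_mul _ f g).trans ?_
  rw [involute_xiHom hf, smul_mul_assoc]

/-- The Kronecker symbol. -/
noncomputable def kron (a b : Fin n) : ℝ := if a = b then 1 else 0

section DimensionFour

theorem calV_nil_mul_xi (d : Fin 4) : calV [] * xi d = (0 : TFun 4) :=
  xiHom_eq_zero (by decide) (xiHom_mul (calV_mem_xiHom []) (xi_mem_xiHom d))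

/-- Obtained by applying ∂/∂ξ^a to 𝒱 ξ^d = 0, which holds for degree reasons; one further derivative
gives the rule for two indices. -/
theorem calV_one_mul_xi (a d : Fin 4) : calV [a] * xi d = -kron a d • (calV [] : TFun 4) := by
  have h := dT_mul (Sum.inl a) (calV_mem_xiHom (n := 4) []) (xi d)
  rw [calV_nil_mul_xi, map_zero, dT_xi_calV a (by simp), dT_xi_xi, List.nil_append] at h
  rw [eq_neg_of_add_eq_zero_left h.symm, kron]
  split_ifs <;> norm_num

theorem calV_two_mul_xi (a b d : Fin 4) :
    calV [a, b] * xi d = kron b d • (calV [a] : TFun 4) - kron a d • calV [b] := by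
  have h := dT_mul (Sum.inl b) (calV_mem_xiHom (n := 4) [a]) (xi d)
  rw [calV_one_mul_xi, map_smul, dT_xi_calV b (by simp), dT_xi_calV b (by simp), dT_xi_xi,
    List.nil_append] at h
  have h' := eq_sub_of_add_eq h.symm
  refine h'.trans ?_
  rw [kron, kron]
  split_ifs <;> simp [pow_succ] <;> abel

theorem calV_two_swap (a b : Fin 4) : calV [a, b] = -(calV [b, a] : TFun 4) := by
  have h := dT_comm (Sum.inl b) (Sum.inl a) (calV [] : TFun 4)
  have h1 : ∀ c : Fin 4, dT (Sum.inl c) (calV []) = (calV [c] : TFun 4) := fun c =>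
    dT_xi_calV c (by simp)
  have h2 : ∀ c d : Fin 4, dT (Sum.inl d) (calV [c]) = (calV [c, d] : TFun 4) := fun c d =>
    dT_xi_calV d (by simp)
  rwa [h1, h1, h2, h2] at h

/-! ### Expansion of polynomials in `ξ` that are annihilated by products of the variables -/

/-- The coefficient of the form of top degree. -/
noncomputable abbrev topCoeff : TFun 4 →ₗ[ℝ] ℝ := xiCoeff Finset.univ

theorem topCoeff_calV_nil : topCoeff (calV []) = 1 := by
  rw [← mono_univ_four, xiCoeff_mono, if_pos rfl]

theorem topCoeff_calV {l : List (Fin 4)} (hl : l.length ≠ 0) (hl' : l.length ≤ 4) :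
    topCoeff (calV l) = 0 :=
  xiCoeff_of_mem_xiHom (calV_mem_xiHom l) (by rw [Finset.card_univ, Fintype.card_fin]; omega)

/-- The functions of `ξ`. -/
noncomputable abbrev xiAlg : Subalgebra ℝ (TFun 4) := Algebra.adjoin ℝ (Set.range xi)

theorem xi_mem_xiAlg (a : Fin 4) : xi a ∈ xiAlg := Algebra.subset_adjoin ⟨a, rfl⟩

theorem mem_xiAlg_of_mem_xiHom {m : ℕ} {f : TFun 4} (hf : f ∈ xiHom 4 m) : f ∈ xiAlg := by
  rw [eq_sum_of_mem_xiHom hf]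
  exact Subalgebra.sum_mem _ fun S _ => Subalgebra.smul_mem _ (mono_xi_mem_adjoin S) _

theorem calV_mem_xiAlg (l : List (Fin 4)) : calV l ∈ xiAlg :=
  mem_xiAlg_of_mem_xiHom (calV_mem_xiHom l)

/-- The top coefficient of f ξ^{Sᶜ} is ± the coefficient of ξ^S in f. For S not the whole set, Sᶜ is
nonempty and the product vanishes, so only the top monomial survives. -/
theorem eq_of_mul_xi_eq_zero {f : TFun 4} (hf : f ∈ xiAlg) (h : ∀ d, f * xi d = 0) :
    f = topCoeff f • calV [] := by
  have hS : ∀ S : Finset (Fin 4), S ≠ Finset.univ → xiCoeff S f = 0 := by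
    intro S hS
    have h0 : ∀ l : List (Fin 4), l ≠ [] → f * (l.map xi).prod = 0 := by
      intro l hl
      obtain ⟨a, l, rfl⟩ := List.exists_cons_of_ne_nil hl
      rw [List.map_cons, List.prod_cons, ← mul_assoc, h, zero_mul]
    have h1 : f * mono xi Sᶜ = 0 := by
      refine h0 _ fun h => hS ?_
      have h' := congrArg List.length h
      rwa [Finset.length_sort, List.length_nil, Finset.card_eq_zero,
        Finset.compl_eq_empty_iff] at h'
    have h2 : topCoeff (f * mono xi Sᶜ) =
        xiCoeff S f * topCoeff (mono xi S * mono xi Sᶜ) := by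
      conv_lhs => rw [adjoin_xi_eq_sum hf, Finset.sum_mul, map_sum]
      rw [Finset.sum_eq_single S]
      · rw [smul_mul_assoc, map_smul, smul_eq_mul]
      · intro T _ hT
        rw [smul_mul_assoc, map_smul]
        rcases anticomm_xi.mono_mul_mono T Sᶜ with ⟨-, h3⟩ | ⟨h3, h4⟩
        · rw [h3, map_zero, smul_zero]
        · have h5 : T ∪ Sᶜ ≠ Finset.univ := by
            intro h6
            refine hT (Finset.Subset.antisymm ?_ ?_)
            · intro x hx
              by_contra hxS
              exact Finset.disjoint_left.mp h3 hx (Finset.mem_compl.mpr hxS)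
            · intro x hx
              have : x ∈ T ∪ Sᶜ := h6 ▸ Finset.mem_univ x
              simpa [hx] using this
          rcases h4 with h4 | h4
          · rw [h4, xiCoeff_mono, if_neg h5, smul_zero]
          · rw [h4, map_neg, xiCoeff_mono, if_neg h5, neg_zero, smul_zero]
      · simp
    rw [h1, map_zero] at h2
    rcases anticomm_xi.mono_mul_mono S Sᶜ with ⟨h3, -⟩ | ⟨-, h4⟩
    · exact absurd disjoint_compl_right h3
    · rw [Finset.union_compl] at h4
      rcases h4 with h4 | h4
      · rw [h4, xiCoeff_mono, if_pos rfl, mul_one] at h2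
        exact h2.symm
      · rw [h4, map_neg, xiCoeff_mono, if_pos rfl, mul_neg, mul_one, eq_comm, neg_eq_zero] at h2
        exact h2
  conv_lhs => rw [adjoin_xi_eq_sum hf]
  rw [Finset.sum_eq_single Finset.univ (fun S _ h => by rw [hS S h, zero_smul]) (by simp),
    mono_univ_four]

/-- Each f ξ^d is a multiple of 𝒱 by the previous lemma. As 𝒱_e ξ^d = -δ_{ed} 𝒱, adding the stated
multiples of 𝒱_e makes the sum annihilated by every ξ^d. -/
theorem eq_of_mul_xi_mul_xi_eq_zero {f : TFun 4} (hf : f ∈ xiAlg)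
    (h : ∀ b d, f * xi b * xi d = 0) :
    f = topCoeff f • calV [] - ∑ e, topCoeff (f * xi e) • calV [e] := by
  have h1 : ∀ d, (f + ∑ e, topCoeff (f * xi e) • calV [e]) * xi d = 0 := by
    intro d
    rw [add_mul, Finset.sum_mul]
    simp only [smul_mul_assoc, calV_one_mul_xi, smul_smul, ← Finset.sum_smul]
    have h2 := eq_of_mul_xi_eq_zero (Subalgebra.mul_mem _ hf (xi_mem_xiAlg d)) (h d)
    have h3 : ∑ e, topCoeff (f * xi e) * -kron e d = -topCoeff (f * xi d) := by
      simp [kron]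
    rw [h3, neg_smul, ← h2, add_neg_cancel]
  have h4 := eq_of_mul_xi_eq_zero (Subalgebra.add_mem _ hf (Subalgebra.sum_mem _ fun e _ =>
    Subalgebra.smul_mem _ (calV_mem_xiAlg [e]) _)) h1
  rw [map_add, map_sum] at h4
  simp only [map_smul, topCoeff_calV (l := [_]) (by simp) (by simp), smul_zero,
    Finset.sum_const_zero, add_zero] at h4
  exact eq_sub_of_add_eq h4

/-- The same correction one level up, now reducing to the preceding lemma. The factor 1/2
compensates for 𝒱_{ab} occurring twice, once for each order of a and b. -/
theorem eq_of_mul_xi_mul_xi_mul_xi_eq_zero {f : TFun 4} (hf : f ∈ xiAlg)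
    (h : ∀ b c d, f * xi b * xi c * xi d = 0) :
    f = topCoeff f • calV [] - ∑ e, topCoeff (f * xi e) • calV [e] +
      ∑ a, ∑ b, (topCoeff (f * xi a * xi b) / 2) • calV [a, b] := by
  have h1 : ∀ d, (f - ∑ a, ∑ b, (topCoeff (f * xi a * xi b) / 2) • calV [a, b]) * xi d =
      topCoeff (f * xi d) • calV [] := by
    intro d
    have h2 := eq_of_mul_xi_mul_xi_eq_zero (Subalgebra.mul_mem _ hf (xi_mem_xiAlg d)) (h d)
    have h3 : ∀ a b, topCoeff (f * xi a * xi b) = -topCoeff (f * xi b * xi a) := by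
      intro a b
      rw [mul_assoc, anticomm_xi.anti, mul_neg, map_neg, ← mul_assoc]
    rw [sub_mul]
    simp only [Finset.sum_mul, smul_mul_assoc, calV_two_mul_xi, smul_sub, smul_smul,
      Finset.sum_sub_distrib]
    rw [Finset.sum_comm (f := fun a b => (topCoeff (f * xi a * xi b) / 2 * kron a d) •
      (calV [b] : TFun 4))]
    simp only [← Finset.sum_smul, kron, mul_ite, mul_one, mul_zero, Finset.sum_ite_eq',
      Finset.mem_univ, if_true]
    rw [← Finset.sum_sub_distrib, sub_eq_iff_eq_add]
    refine h2.trans ?_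
    rw [sub_eq_add_neg, ← Finset.sum_neg_distrib]
    rw [add_right_inj]
    refine Finset.sum_congr rfl fun e _ => ?_
    rw [h3 d e]
    module
  have h4 := eq_of_mul_xi_mul_xi_eq_zero (Subalgebra.sub_mem _ hf (Subalgebra.sum_mem _ fun a _ =>
    Subalgebra.sum_mem _ fun b _ => Subalgebra.smul_mem _ (calV_mem_xiAlg [a, b]) _))
    (fun b d => by rw [h1, smul_mul_assoc, calV_nil_mul_xi, smul_zero])
  have h5 : ∀ a b, topCoeff (calV [a, b]) = 0 := fun a b => topCoeff_calV (by simp) (by simp)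
  simp only [h1, map_smul, map_sub, map_sum, h5, topCoeff_calV_nil, mul_zero,
    Finset.sum_const_zero, sub_zero, smul_eq_mul, mul_one] at h4
  exact sub_eq_iff_eq_add.mp h4

end DimensionFour

/-! ### Tensor symmetries -/

section Symmetries

variable {ι M : Type*} [AddCommGroup M] [Module ℝ M]

theorem eq_zero_of_eq_neg {x : M} (h : x = -x) : x = 0 := by
  have h1 : (2 : ℝ) • x = 0 := by
    rw [two_smul]
    nth_rewrite 1 [h]
    exact neg_add_cancel x
  exact (smul_eq_zero.mp h1).resolve_left two_ne_zero

/-- The pair symmetry of tensors with the symmetries of the Riemann tensor. -/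
theorem pair_symm {R : ι → ι → ι → ι → M} (h₁ : ∀ a b c d, R a b c d = -R b a c d)
    (h₂ : ∀ a b c d, R a b c d = -R a b d c)
    (h₃ : ∀ a b c d, R a b c d + R b c a d + R c a b d = 0) (a b c d : ι) :
    R a b c d = R c d a b := by
  -- Four cyclic identities, each fixing a different index, in the combination e1 + e2 - e3 - e4;
  -- all terms cancel except twice the desired difference.
  have e1 := h₃ a b c d
  have e2 := h₃ b c d a
  have e3 := h₃ c d a b
  have e4 := h₃ d a b c
  rw [h₂ b c d a, h₂ c d b a, h₁ d b c a] at e2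
  rw [h₁ a c d b, h₂ c a d b] at e3
  rw [h₂ d a b c, h₂ a b d c, h₂ b d a c] at e4
  have h : (2 : ℝ) • (R a b c d - R c d a b) = 0 := by
    have e : (2 : ℝ) • (R a b c d - R c d a b) =
        ((R a b c d + R b c a d + R c a b d) + (-R b c a d + -R c d a b + -R b d c a)) -
        ((R c d a b + R d a c b + - -R c a b d) + (-R d a c b + -R a b c d + -R b d c a)) := by
      module
    rw [e, e1, e2, e3, e4]
    simp
  exact sub_eq_zero.mp ((smul_eq_zero.mp h).resolve_left two_ne_zero)

variable [Fintype ι] {P : Submodule ℝ M}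

theorem sum_symm_mem {q : ι → ι → ℝ} (hq : ∀ a b, q a b = q b a) {D : ι → ι → M}
    (hD : ∀ a b, D a b + D b a ∈ P) : ∑ a, ∑ b, q a b • D a b ∈ P := by
  have h : (2 : ℝ) • ∑ a, ∑ b, q a b • D a b = ∑ a, ∑ b, q a b • (D a b + D b a) := by
    simp only [smul_add, Finset.sum_add_distrib]
    rw [two_smul, Finset.sum_comm (f := fun a b => q a b • D b a)]
    simp only [fun a b => hq b a]
  rw [← P.smul_mem_iff (two_ne_zero (α := ℝ)), h]
  exact P.sum_mem fun a _ => P.sum_mem fun b _ => P.smul_mem _ (hD a b)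

/-- Modulo P, D is antisymmetric in the first and in the last pair of arguments, hence invariant
under cyclic rotation. Averaging over the three rotations turns the coefficient into the cyclic sum
of s, which is zero. -/
theorem sum_cyclic_mem {s : ι → ι → ι → ℝ} (hs : ∀ a b c, s a b c + s b c a + s c a b = 0)
    {D : ι → ι → ι → M} (hD : ∀ a b c, D a b c = -D a c b)
    (hP : ∀ a b c, D a b c + D b a c ∈ P) : ∑ a, ∑ b, ∑ c, s b c a • D a b c ∈ P := by
  let e : ι × ι × ι ≃ ι × ι × ι :=
    ⟨fun q => (q.2.1, q.2.2, q.1), fun q => (q.2.2, q.1, q.2.1), fun _ => rfl, fun _ => rfl⟩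
  have h0 : ∀ f : ι → ι → ι → M, ∑ a, ∑ b, ∑ c, f a b c = ∑ q : ι × ι × ι, f q.1 q.2.1 q.2.2 := by
    intro f
    simp only [Fintype.sum_prod_type]
  have h1 := e.sum_comp fun q => s q.2.1 q.2.2 q.1 • D q.1 q.2.1 q.2.2
  have h2 := e.sum_comp fun q => s q.2.2 q.1 q.2.1 • D q.2.1 q.2.2 q.1
  have h : (3 : ℝ) • ∑ a, ∑ b, ∑ c, s b c a • D a b c = ∑ q : ι × ι × ι,
      (s q.2.2 q.1 q.2.1 • (D q.2.1 q.2.2 q.1 - D q.1 q.2.1 q.2.2) +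
        s q.1 q.2.1 q.2.2 • (D q.2.2 q.1 q.2.1 - D q.1 q.2.1 q.2.2)) := by
    rw [h0]
    simp only [smul_sub, Finset.sum_add_distrib, Finset.sum_sub_distrib]
    have h3 : ∑ q : ι × ι × ι, s q.2.2 q.1 q.2.1 • D q.2.1 q.2.2 q.1 =
      ∑ q : ι × ι × ι, s q.2.1 q.2.2 q.1 • D q.1 q.2.1 q.2.2 := h1
    have h4 : ∑ q : ι × ι × ι, s q.1 q.2.1 q.2.2 • D q.2.2 q.1 q.2.1 =
      ∑ q : ι × ι × ι, s q.2.2 q.1 q.2.1 • D q.2.1 q.2.2 q.1 := h2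
    have h5 : ∑ q : ι × ι × ι, s q.2.1 q.2.2 q.1 • D q.1 q.2.1 q.2.2 =
        -∑ q : ι × ι × ι, s q.2.2 q.1 q.2.1 • D q.1 q.2.1 q.2.2 -
          ∑ q : ι × ι × ι, s q.1 q.2.1 q.2.2 • D q.1 q.2.1 q.2.2 := by
      rw [← Finset.sum_neg_distrib, ← Finset.sum_sub_distrib]
      refine Finset.sum_congr rfl fun q _ => ?_
      have : s q.2.1 q.2.2 q.1 = -s q.2.2 q.1 q.2.1 - s q.1 q.2.1 q.2.2 := by
        linarith [hs q.1 q.2.1 q.2.2]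
      rw [this]
      module
    rw [h4, h3, show (3 : ℝ) = 2 + 1 by norm_num, add_smul, one_smul]
    nth_rewrite 2 [h5]
    module
  have h3 : ∀ a b c, D b c a - D a b c ∈ P := by
    intro a b c
    have := P.neg_mem (hP a b c)
    rw [hD b a c] at this
    rwa [neg_add, neg_neg, neg_add_eq_sub] at this
  rw [← P.smul_mem_iff (three_ne_zero (α := ℝ)), h]
  refine P.sum_mem fun q _ => P.add_mem (P.smul_mem _ (h3 _ _ _)) (P.smul_mem _ ?_)
  have := P.add_mem (h3 q.2.1 q.2.2 q.1) (h3 q.1 q.2.1 q.2.2)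
  rwa [sub_add_sub_cancel] at this

/-- Contracting t with the four-term combination in P gives ΣT + 2ΣT' + ΣT, where T' has two indices
of t exchanged. The Bianchi identity and the antisymmetry of E give 2ΣT' = ΣT, so three times the
sum lies in P. -/
theorem sum_riemann_mem {t : ι → ι → ι → ι → ℝ} (h₁ : ∀ a b c d, t a b c d = -t b a c d)
    (h₂ : ∀ a b c d, t a b c d = -t a b d c)
    (h₃ : ∀ a b c d, t a b c d + t b c a d + t c a b d = 0) {E : ι → ι → ι → ι → M}
    (hE : ∀ a b c d, E a b c d = -E b a c d)
    (hP : ∀ a b c d, E a b c d + E c b a d + E a d c b + E c d a b ∈ P) :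
    ∑ a, ∑ b, ∑ c, ∑ d, t c d a b • E a b c d ∈ P := by
  have hp := pair_symm h₁ h₂ h₃
  have h0 : ∀ f : ι → ι → ι → ι → M, ∑ a, ∑ b, ∑ c, ∑ d, f a b c d =
      ∑ q : ι × ι × ι × ι, f q.1 q.2.1 q.2.2.1 q.2.2.2 := by
    intro f
    simp only [Fintype.sum_prod_type]
  let T : ι × ι × ι × ι → M := fun q => t q.1 q.2.1 q.2.2.1 q.2.2.2 • E q.1 q.2.1 q.2.2.1 q.2.2.2
  let T' : ι × ι × ι × ι → M := fun q => t q.1 q.2.2.2 q.2.2.1 q.2.1 • E q.1 q.2.1 q.2.2.1 q.2.2.2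
  let ac : ι × ι × ι × ι ≃ ι × ι × ι × ι :=
    Function.Involutive.toPerm (fun q => (q.2.2.1, q.2.1, q.1, q.2.2.2)) fun _ => rfl
  let bd : ι × ι × ι × ι ≃ ι × ι × ι × ι :=
    Function.Involutive.toPerm (fun q => (q.1, q.2.2.2, q.2.2.1, q.2.1)) fun _ => rfl
  let ab : ι × ι × ι × ι ≃ ι × ι × ι × ι :=
    Function.Involutive.toPerm (fun q => (q.2.1, q.1, q.2.2.1, q.2.2.2)) fun _ => rfl
  -- Averaging T' over a ↔ b produces t_{adcb} - t_{bdca}, which equals t_{abcd} by the Bianchi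
  -- identity and pair symmetry.
  have hab : (2 : ℝ) • ∑ q, T' q = ∑ q, T q := by
    rw [two_smul]
    nth_rewrite 1 [← ab.sum_comp T']
    rw [← Finset.sum_add_distrib]
    refine Finset.sum_congr rfl fun ⟨a, b, c, d⟩ _ => ?_
    change t b d c a • E b a c d + t a d c b • E a b c d = t a b c d • E a b c d
    have h4 : t a b c d = t a d c b - t b d c a := by
      have e1 := h₃ a b c d
      rw [hp b c a d, h₂ a d b c, hp c a b d] at e1
      linarith
    rw [h4, hE b a c d]
    module
  have hY : ∑ q : ι × ι × ι × ι, t q.1 q.2.1 q.2.2.1 q.2.2.2 •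
      (E q.1 q.2.1 q.2.2.1 q.2.2.2 + E q.2.2.1 q.2.1 q.1 q.2.2.2 + E q.1 q.2.2.2 q.2.2.1 q.2.1 +
        E q.2.2.1 q.2.2.2 q.1 q.2.1) = (3 : ℝ) • ∑ q, T q := by
    have e2 : ∑ q : ι × ι × ι × ι, t q.1 q.2.1 q.2.2.1 q.2.2.2 • E q.2.2.1 q.2.1 q.1 q.2.2.2 =
        ∑ q, T' q := by
      rw [← ac.sum_comp]
      refine Finset.sum_congr rfl fun ⟨a, b, c, d⟩ _ => ?_
      change t c b a d • E a b c d = t a d c b • E a b c d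
      rw [hp]
    have e3 : ∑ q : ι × ι × ι × ι, t q.1 q.2.1 q.2.2.1 q.2.2.2 • E q.1 q.2.2.2 q.2.2.1 q.2.1 =
        ∑ q, T' q := by
      rw [← bd.sum_comp]
      rfl
    have e4 : ∑ q : ι × ι × ι × ι, t q.1 q.2.1 q.2.2.1 q.2.2.2 • E q.2.2.1 q.2.2.2 q.1 q.2.1 =
        ∑ q, T q := by
      rw [← (ac.trans bd).sum_comp]
      refine Finset.sum_congr rfl fun ⟨a, b, c, d⟩ _ => ?_
      change t c d a b • E a b c d = t a b c d • E a b c d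
      rw [hp]
    simp only [smul_add, Finset.sum_add_distrib]
    rw [e2, e3, e4, ← hab]
    module
  rw [h0]
  have h5 : ∑ q : ι × ι × ι × ι, t q.2.2.1 q.2.2.2 q.1 q.2.1 • E q.1 q.2.1 q.2.2.1 q.2.2.2 =
      ∑ q, T q := Finset.sum_congr rfl fun q _ => by rw [hp]
  rw [h5, ← P.smul_mem_iff (three_ne_zero (α := ℝ)), ← hY]
  exact P.sum_mem fun q _ => P.smul_mem _ (hP _ _ _ _)

end Symmetries


/-! ### The explicit vector fields in dimension four. -/

section DimensionFour

/-- The vector field `f ∂/∂ξ^a` as a linear function of `f`. -/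
noncomputable def ddXiL (a : Fin 4) : TFun 4 →ₗ[ℝ] TVec 4 := 
  LinearMap.single ℝ (fun _ : TIdx 4 => TFun 4) (Sum.inl a)

theorem ddXiL_apply (a : Fin 4) (f : TFun 4) : ddXiL a f = ddXi f a := rfl

/-- The vector field `f ∂/∂ρ^{ab}` as a linear function of `f`. -/
noncomputable def ddRhoL (a b : Fin 4) : TFun 4 →ₗ[ℝ] TVec 4 where
  toFun f := ddRho f a b
  map_add' f g := by
    unfold ddRho rhoComp
    split_ifs
    · exact Pi.single_add _ _ _
    · beta_reduce
      rw [Pi.single_add, neg_add]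
    · rw [add_zero]
  map_smul' r f := by
    unfold ddRho rhoComp
    split_ifs
    · exact Pi.single_smul _ _ _
    · beta_reduce
      rw [Pi.single_smul, RingHom.id_apply, smul_neg]
    · rw [smul_zero]

theorem ddRhoL_apply (a b : Fin 4) (f : TFun 4) : ddRhoL a b f = ddRho f a b := rfl

theorem ddXi_inl (f : TFun 4) (a b : Fin 4) : ddXi f a (Sum.inl b) = kron a b • f := by
  rw [ddXi, kron]
  split_ifs with h
  · subst h; simp
  · rw [Pi.single_eq_of_ne (by simpa using Ne.symm h), zero_smul]

theorem ddXi_inr (f : TFun 4) (a : Fin 4) (p) : ddXi f a (Sum.inr p) = 0 :=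
  Pi.single_eq_of_ne (by simp) _

theorem ddRho_inl (f : TFun 4) (a b c : Fin 4) : ddRho f a b (Sum.inl c) = 0 := by
  unfold ddRho rhoComp
  split_ifs <;> simp

theorem ddRho_inr (f : TFun 4) (a b : Fin 4) (p : {p : Fin 4 × Fin 4 // p.1 < p.2}) :
    ddRho f a b (Sum.inr p) =
      (kron a p.1.1 * kron b p.1.2 - kron a p.1.2 * kron b p.1.1) • f := by
  obtain ⟨⟨c, d⟩, hcd⟩ := p
  simp only at hcd
  unfold ddRho rhoComp kron
  by_cases h1 : a = c <;> by_cases h2 : b = d <;> by_cases h3 : a = d <;> by_cases h4 : b = c <;>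
    split_ifs <;> simp_all <;> omega

theorem rhoComp_zero_of {X : TVec 4} (h : ∀ p, X (Sum.inr p) = 0) (c d : Fin 4) :
    rhoComp X c d = 0 := by
  simp [rhoComp, h]

theorem rhoComp_ddRho (f : TFun 4) (a b c d : Fin 4) : rhoComp (ddRho f a b) c d =
    (kron a c * kron b d - kron a d * kron b c) • f := by
  rcases lt_trichotomy c d with h | h | h
  · rw [rhoComp, dif_pos h, ddRho_inr]
  · rw [h, rhoComp_self, sub_self, zero_smul]
  · rw [rhoComp, dif_neg h.not_gt, dif_pos h, ddRho_inr]
    module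

theorem rhoComp_add {n : ℕ} (X Y : TVec n) (c d : Fin n) :
    rhoComp (X + Y) c d = rhoComp X c d + rhoComp Y c d := by
  unfold rhoComp
  split_ifs <;> simp [add_comm]

/-- Multiplication by ξ turns each 𝒱 into Kronecker symbols times 𝒱 with one index fewer; the
symmetrisations in X³, Y³ and Y² make these terms cancel in the equations of
`contr_eq_zero_iff_four`. -/
theorem contr_kerField (i : KerIdx) : contr (kerField i) = 0 := by
  rw [contr_eq_zero_iff_four]
  cases i with
  | X4 a =>
    refine ⟨fun b d => ?_, fun b c d => ?_⟩
    · simp only [kerField, ddXi_inl, smul_mul_assoc, calV_nil_mul_xi, smul_zero]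
    · simp only [kerField, rhoComp_zero_of (ddXi_inr _ _), zero_mul, add_zero]
  | X3 a a' =>
    refine ⟨fun b d => ?_, fun b c d => ?_⟩
    · simp only [kerField, Pi.add_apply, ddXi_inl, add_mul, smul_mul_assoc, calV_one_mul_xi]
      module
    · simp only [kerField, rhoComp_add, rhoComp_zero_of (ddXi_inr _ _), zero_mul, add_zero]
  | Y4 a a' =>
    refine ⟨fun b d => ?_, fun b c d => ?_⟩
    · simp only [kerField, ddRho_inl, zero_mul]
    · simp only [kerField, rhoComp_ddRho, smul_mul_assoc, calV_nil_mul_xi, smul_zero, add_zero]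
  | Y3 x y z =>
    refine ⟨fun b d => ?_, fun b c d => ?_⟩
    · simp only [kerField, Pi.add_apply, ddRho_inl, add_zero, zero_mul]
    · simp only [kerField, rhoComp_add, rhoComp_ddRho, add_mul, smul_mul_assoc, calV_one_mul_xi]
      module
  | Y2 x y z w =>
    refine ⟨fun b d => ?_, fun b c d => ?_⟩
    · simp only [kerField, Pi.add_apply, ddRho_inl, add_zero, zero_mul]
    · simp only [kerField, rhoComp_add, rhoComp_ddRho, add_mul, smul_mul_assoc, calV_two_mul_xi]
      module

theorem tIota_kerField (i : KerIdx) : tIota (kerField i) (omegaT 4) = 0 :=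
  (tIota_omegaT_eq_zero_iff _).mpr fun B => congrFun (contr_kerField i) B

/-! ### The explicit vector fields commute -/

theorem apply_eq (X : TVec 4) {l : List (Fin 4)} (hl : l.length < 4) :
    TVec.apply X (calV l) = ∑ a, X (Sum.inl a) * calV (l ++ [a]) := by
  have h : TVec.apply X (calV l) = ∑ A, X A * dT A (calV l) := rfl
  rw [h, Fintype.sum_sum_type]
  simp only [dT_rho_calV, mul_zero, Finset.sum_const_zero, add_zero, dT_xi_calV _ hl]

/-- The action of a vector field on functions as a linear map. -/
noncomputable def applyL (X : TVec 4) : TFun 4 →ₗ[ℝ] TFun 4 :=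
  ∑ A, LinearMap.mulLeft ℝ (X A) ∘ₗ dT A

theorem applyL_apply (X : TVec 4) (f : TFun 4) : applyL X f = TVec.apply X f := by
  simp [applyL, TVec.apply]

theorem sum_kron_smul {M : Type*} [AddCommGroup M] [Module ℝ M] (a : Fin 4) (f : Fin 4 → M) :
    ∑ b, kron a b • f b = f a := by
  simp [kron]

theorem sum_kron_smul_left {M : Type*} [AddCommGroup M] [Module ℝ M] (a : Fin 4) (f : Fin 4 → M) :
    ∑ b, kron b a • f b = f a := by
  simp [kron]

/-- The Y fields do not act on ξ, and X⁴ raises the degree beyond four. For X³, differentiating 𝒱_l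
𝒱_e = 0 shows that 𝒱_e 𝒱_{lf} is ± 𝒱_l 𝒱_{ef}, which is antisymmetric in e and f and cancels in the
symmetrised field. -/
theorem apply_kerField_calV (i : KerIdx) {l : List (Fin 4)} (hl : l.length ≤ 2) :
    TVec.apply (kerField i) (calV l) = 0 := by
  rw [apply_eq _ (by omega)]
  cases i with
  | X4 a =>
    simp only [kerField, ddXi_inl, smul_mul_assoc, sum_kron_smul]
    refine xiHom_eq_zero ?_ (xiHom_mul (calV_mem_xiHom _) (calV_mem_xiHom _))
    simp
    omega
  | X3 a b =>
    simp only [kerField, Pi.add_apply, ddXi_inl, add_mul, smul_mul_assoc, Finset.sum_add_distrib,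
      sum_kron_smul]
    have h : ∀ e f : Fin 4, calV [e] * calV (l ++ [f]) = (-1 : ℝ) ^ (3 * (4 - (l ++ [f]).length)) •
        -((-1 : ℝ) ^ (4 - l.length) • (calV l * calV [e, f])) := by
      intro e f
      have h1 : calV l * calV [e] = (0 : TFun 4) := by
        refine xiHom_eq_zero ?_ (xiHom_mul (calV_mem_xiHom l) (calV_mem_xiHom [e]))
        simp
        omega
      have h2 := dT_mul (Sum.inl f) (calV_mem_xiHom l) (calV [e])
      rw [h1, map_zero, dT_xi_calV f (by omega), dT_xi_calV f (by simp)] at h2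
      rw [xiHom_mul_comm (calV_mem_xiHom [e]) (calV_mem_xiHom (l ++ [f]))]
      exact congrArg _ (eq_neg_of_add_eq_zero_left h2.symm)
    rw [h, h, calV_two_swap a b]
    simp
  | Y4 a b => simp only [kerField, ddRho_inl, zero_mul, Finset.sum_const_zero]
  | Y3 a b c => simp only [kerField, Pi.add_apply, ddRho_inl, add_zero, zero_mul, Finset.sum_const_zero]
  | Y2 a b c d =>
    simp only [kerField, Pi.add_apply, ddRho_inl, add_zero, zero_mul, Finset.sum_const_zero]

theorem ddXi_mem {S : Submodule ℝ (TFun 4)} {f : TFun 4} (hf : f ∈ S) (a : Fin 4) (A : TIdx 4) :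
    ddXi f a A ∈ S := by
  rcases A with b | p
  · rw [ddXi_inl]; exact S.smul_mem _ hf
  · rw [ddXi_inr]; exact S.zero_mem

theorem ddRho_mem {S : Submodule ℝ (TFun 4)} {f : TFun 4} (hf : f ∈ S) (a b : Fin 4) (A : TIdx 4) :
    ddRho f a b A ∈ S := by
  rcases A with c | p
  · rw [ddRho_inl]; exact S.zero_mem
  · rw [ddRho_inr]; exact S.smul_mem _ hf

/-- All components of the explicit fields are combinations of the 𝒱_l with at most two indices. So
both terms of the graded commutator vanish separately. -/
theorem apply_kerField (i j : KerIdx) (A : TIdx 4) :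
    TVec.apply (kerField i) (kerField j A) = 0 := by
  have h : ∀ l : List (Fin 4), l.length ≤ 2 → calV l ∈ LinearMap.ker (applyL (kerField i)) :=
    fun l hl => by
      rw [LinearMap.mem_ker, applyL_apply]
      exact apply_kerField_calV i hl
  rw [← applyL_apply, ← LinearMap.mem_ker]
  cases j with
  | X4 a => exact ddXi_mem (h _ (by simp)) _ _
  | X3 a b =>
    exact Submodule.add_mem _ (ddXi_mem (h _ (by simp)) _ _) (ddXi_mem (h _ (by simp)) _ _)
  | Y4 a b => exact ddRho_mem (h _ (by simp)) _ _ _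
  | Y3 a b c =>
    exact Submodule.add_mem _ (ddRho_mem (h _ (by simp)) _ _ _) (ddRho_mem (h _ (by simp)) _ _ _)
  | Y2 a b c d =>
    exact Submodule.add_mem _ (Submodule.add_mem _ (Submodule.add_mem _
      (ddRho_mem (h _ (by simp)) _ _ _) (ddRho_mem (h _ (by simp)) _ _ _))
      (ddRho_mem (h _ (by simp)) _ _ _)) (ddRho_mem (h _ (by simp)) _ _ _)

/-! ### The explicit vector fields span the `ρ`-independent kernel -/

theorem sum_ddXi_mem {X : TVec 4} (hX : IsRhoIndependent X)
    (h : ∀ a d, X (Sum.inl a) * xi d = X (Sum.inl d) * xi a) :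
    ∑ a, ddXi (X (Sum.inl a)) a ∈ Submodule.span ℝ (Set.range kerField) := by
  -- X^a ξ^b ξ^d is symmetric in a, b and antisymmetric in b, d. Alternating these two exchanges
  -- three times returns to the start with the opposite sign.
  have hk : ∀ a b d, X (Sum.inl a) * xi b * xi d = 0 := by
    have h1 : ∀ a b d, X (Sum.inl a) * xi b * xi d = X (Sum.inl b) * xi a * xi d := fun a b d => by
      rw [h]
    have h2 : ∀ a b d, X (Sum.inl a) * xi b * xi d = -(X (Sum.inl a) * xi d * xi b) := by
      intro a b d
      rw [mul_assoc, anticomm_xi.anti, mul_neg, mul_assoc]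
    intro a b d
    refine eq_zero_of_eq_neg ?_
    conv_lhs => rw [h1, h2, h1, h2, h1, h2]
    rw [neg_neg]
  have he : ∀ a, ddXi (X (Sum.inl a)) a = topCoeff (X (Sum.inl a)) • ddXi (calV []) a -
      ∑ e, topCoeff (X (Sum.inl a) * xi e) • ddXi (calV [e]) a := by
    intro a
    simp only [← ddXiL_apply]
    conv_lhs => rw [eq_of_mul_xi_mul_xi_eq_zero (hX _) (hk a)]
    simp only [map_sub, map_sum, map_smul]
  rw [Finset.sum_congr rfl fun a _ => he a, Finset.sum_sub_distrib]
  refine Submodule.sub_mem _ (Submodule.sum_mem _ fun a _ => Submodule.smul_mem _ _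
    (Submodule.subset_span ⟨.X4 a, rfl⟩)) ?_
  refine sum_symm_mem (q := fun a e => topCoeff (X (Sum.inl a) * xi e))
    (D := fun a e => ddXi (calV [e]) a) (fun a b => by rw [h]) fun a b => ?_
  exact Submodule.subset_span ⟨.X3 b a, rfl⟩

theorem rhoComp_mem_xiAlg {X : TVec 4} (hX : IsRhoIndependent X) (b c : Fin 4) :
    rhoComp X b c ∈ xiAlg := by
  unfold rhoComp
  split_ifs
  · exact hX _
  · exact Subalgebra.neg_mem _ (hX _)
  · exact Subalgebra.zero_mem _

variable {Z : Fin 4 → Fin 4 → TFun 4}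

theorem mul_xi_mul_xi_swap (f : TFun 4) (d e : Fin 4) : f * xi d * xi e = -(f * xi e * xi d) := by
  rw [mul_assoc, anticomm_xi.anti, mul_neg, mul_assoc]

theorem mul_xi_bianchi (h : ∀ b c d, Z b c * xi d + Z c d * xi b + Z d b * xi c = 0)
    (a b c d : Fin 4) :
    Z a b * xi c * xi d + Z b c * xi a * xi d + Z c a * xi b * xi d = 0 := by
  rw [← add_mul, ← add_mul, h, zero_mul]

/-- Z^{bc} ξ^d ξ^e has the symmetries of the Riemann tensor, in particular pair symmetry. Among five
indices with four values two coincide, and every coincidence either vanishes at once or reduces to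
Z^{bc} ξ^b ξ^e ξ^f. -/
theorem mul_xi_mul_xi_mul_xi_eq_zero (hZ : ∀ b c, Z b c = -Z c b)
    (h : ∀ b c d, Z b c * xi d + Z c d * xi b + Z d b * xi c = 0) (b c d e f : Fin 4) :
    Z b c * xi d * xi e * xi f = 0 := by
  have hp : ∀ b c d e, Z b c * xi d * xi e = Z d e * xi b * xi c :=
    pair_symm (R := fun b c d e => Z b c * xi d * xi e)
      (fun a b c d => by rw [hZ a b, neg_mul, neg_mul]) (fun a b c d => mul_xi_mul_xi_swap _ _ _)
      (mul_xi_bianchi h)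
  -- Three pair exchanges alternating with three transpositions of ξ's return to the same term with
  -- a minus sign.
  have h0 : ∀ b c e f, Z b c * xi b * xi e * xi f = 0 := by
    intro b c e f
    refine eq_zero_of_eq_neg ?_
    conv_lhs => rw [hp b c b e, mul_xi_mul_xi_swap, hp b e b f, mul_xi_mul_xi_swap, neg_neg,
      hp b f b c, mul_xi_mul_xi_swap]
  have s1 : ∀ b c d e f, Z b c * xi d * xi e * xi f = -(Z c b * xi d * xi e * xi f) := by
    intro b c d e f
    rw [hZ b c]; simp only [neg_mul]
  have s2 : ∀ b c d e f, Z b c * xi d * xi e * xi f = -(Z b c * xi e * xi d * xi f) := by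
    intro b c d e f
    rw [mul_xi_mul_xi_swap (Z b c), neg_mul]
  have hcases : ∀ b c d e f : Fin 4, b = c ∨ d = e ∨ e = f ∨ d = f ∨ b = d ∨ b = e ∨ b = f ∨
      c = d ∨ c = e ∨ c = f := by decide
  have hxx : ∀ (x : TFun 4) (a : Fin 4), x * xi a * xi a = 0 := fun x a => by
    rw [mul_assoc, anticomm_xi.sq, mul_zero]
  rcases hcases b c d e f with rfl | rfl | rfl | rfl | rfl | rfl | rfl | rfl | rfl | rfl
  · rw [eq_zero_of_eq_neg (hZ b b)]; simp
  · rw [hxx, zero_mul]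
  · rw [hxx]
  · rw [mul_xi_mul_xi_swap, hxx, zero_mul, neg_zero]
  · exact h0 _ _ _ _
  · rw [s2, h0, neg_zero]
  · rw [mul_xi_mul_xi_swap, s2, h0, neg_zero, neg_zero]
  · rw [s1, h0, neg_zero]
  · rw [s1, s2, h0, neg_zero, neg_zero]
  · rw [s1, mul_xi_mul_xi_swap, s2, h0, neg_zero, neg_zero, neg_zero]

theorem sum_rotate {ι M : Type*} [Fintype ι] [AddCommMonoid M] (f : ι → ι → ι → M) :
    ∑ b, ∑ c, ∑ e, f b c e = ∑ e, ∑ b, ∑ c, f b c e :=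
  (Finset.sum_congr rfl fun _ _ => Finset.sum_comm).trans Finset.sum_comm

/-- The expansion of Z^{bc} has three layers. The top one gives Y⁴ fields; in the next, the
coefficient tensor has vanishing cyclic sum and is absorbed by Y³; in the last, it has the Riemann
symmetries and is absorbed by Y². -/
theorem sum_ddRho_mem (hZ : ∀ b c, Z b c = -Z c b)
    (h : ∀ b c d, Z b c * xi d + Z c d * xi b + Z d b * xi c = 0) (hX : ∀ b c, Z b c ∈ xiAlg) :
    ∑ b, ∑ c, ddRho (Z b c) b c ∈ Submodule.span ℝ (Set.range kerField) := by
  have he : ∀ b c, ddRho (Z b c) b c = topCoeff (Z b c) • ddRho (calV []) b c -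
      ∑ e, topCoeff (Z b c * xi e) • ddRho (calV [e]) b c +
      ∑ e, ∑ f, (topCoeff (Z b c * xi e * xi f) / 2) • ddRho (calV [e, f]) b c := by
    intro b c
    simp only [← ddRhoL_apply]
    conv_lhs => rw [eq_of_mul_xi_mul_xi_mul_xi_eq_zero (hX b c)
      (mul_xi_mul_xi_mul_xi_eq_zero hZ h b c)]
    simp only [map_add, map_sub, map_sum, map_smul]
  have hs : ∀ (f : TFun 4) (b c : Fin 4), ddRho f b c = -ddRho f c b := fun f b c =>
    rhoComp_swap _ _ _
  simp only [he, Finset.sum_add_distrib, Finset.sum_sub_distrib]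
  refine Submodule.add_mem _ (Submodule.sub_mem _ ?_ ?_) ?_
  · exact Submodule.sum_mem _ fun b _ => Submodule.sum_mem _ fun c _ => Submodule.smul_mem _ _
      (Submodule.subset_span ⟨.Y4 b c, rfl⟩)
  · have h1 := sum_cyclic_mem (P := Submodule.span ℝ (Set.range kerField))
      (s := fun b c e => topCoeff (Z b c * xi e)) (D := fun e b c => ddRho (calV [e]) b c)
      (fun a b c => by simp only [← map_add, h, map_zero]) (fun a b c => hs _ _ _)
      (fun a b c => Submodule.subset_span ⟨.Y3 a b c, rfl⟩)
    rwa [sum_rotate]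
  · have h1 := sum_riemann_mem (P := Submodule.span ℝ (Set.range kerField))
      (t := fun b c e f => topCoeff (Z b c * xi e * xi f) / 2)
      (E := fun e f b c => ddRho (calV [e, f]) b c)
      (fun a b c d => by simp only [hZ a b, neg_mul, map_neg, neg_div])
      (fun a b c d => by simp only [mul_xi_mul_xi_swap _ c d, map_neg, neg_div])
      (fun a b c d => by
        simp only [← add_div, ← map_add, mul_xi_bianchi h, map_zero, zero_div])
      (fun a b c d => by
        simp only [← ddRhoL_apply, calV_two_swap a b, map_neg])
      (fun a b c d => Submodule.subset_span ⟨.Y2 a b c d, rfl⟩)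
    rw [sum_rotate]
    rwa [Finset.sum_congr rfl fun e _ => sum_rotate _]

theorem mem_span_kerField {X : TVec 4} (hX : IsRhoIndependent X) (h : contr X = 0) :
    X ∈ Submodule.span ℝ (Set.range kerField) := by
  obtain ⟨h1, h2⟩ := (contr_eq_zero_iff_four X).mp h
  -- The factor 1/2 accounts for each pair b < c occurring twice in the double sum.
  have hX' : X = ∑ a, ddXi (X (Sum.inl a)) a +
      (1 / 2 : ℝ) • ∑ b, ∑ c, ddRho (rhoComp X b c) b c := by
    funext A
    rcases A with d | p
    · simp only [Pi.add_apply, Pi.smul_apply, Finset.sum_apply, ddXi_inl, ddRho_inl,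
        Finset.sum_const_zero, smul_zero, add_zero]
      simp [kron]
    · simp only [Pi.add_apply, Pi.smul_apply, Finset.sum_apply, ddXi_inr, ddRho_inr,
        Finset.sum_const_zero, zero_add, sub_smul, mul_smul, Finset.sum_sub_distrib]
      simp only [← Finset.smul_sum, sum_kron_smul_left]
      have h3 : rhoComp X p.1.1 p.1.2 = X (Sum.inr p) := dif_pos p.2
      rw [rhoComp_swap X p.1.2 p.1.1, h3]
      module
  rw [hX']
  exact Submodule.add_mem _ (sum_ddXi_mem hX h1) (Submodule.smul_mem _ _
    (sum_ddRho_mem (rhoComp_swap X) h2 (rhoComp_mem_xiAlg hX)))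

theorem prolong_mem_span {U : Opens (BodySpace 4)} {X : TVec 4}
    (hX : X ∈ Submodule.span ℝ (Set.range kerField)) :
    prolong U X ∈ Submodule.span (Fn U) (Set.range fun i => prolong U (kerField i)) := by
  induction hX using Submodule.span_induction with
  | mem X hX =>
    obtain ⟨i, rfl⟩ := hX
    exact Submodule.subset_span ⟨i, rfl⟩
  | zero =>
    have := prolong_smul (U := U) 0 (0 : TVec 4)
    rw [zero_smul, map_zero, zero_smul] at this
    rw [this]
    exact Submodule.zero_mem _
  | add X Y _ _ hX hY => rw [prolong_add]; exact Submodule.add_mem _ hX hY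
  | smul r X _ hX => rw [prolong_smul]; exact Submodule.smul_mem _ _ hX

end DimensionFour

end FrameGravity

/-! ### The main theorem. -/

theorem mainTheorem1 :
    -- the explicit vector fields for `n = 4`
    ((∀ i, FrameGravity.tIota (FrameGravity.kerField i) (FrameGravity.omegaT 4) = 0) ∧
      (∀ i j A, FrameGravity.TVec.apply (FrameGravity.kerField i) (FrameGravity.kerField j A) =
        (-1 : ℝ) ^ (FrameGravity.kerDeg i * FrameGravity.kerDeg j) •
          FrameGravity.TVec.apply (FrameGravity.kerField j) (FrameGravity.kerField i A)) ∧
      ∀ U ≤ FrameGravity.body 4, ∀ V : FrameGravity.Vec U,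
        FrameGravity.iota V (FrameGravity.omegaM U) = 0 ↔
          V ∈ Submodule.span (FrameGravity.Fn U)
            (Set.range fun i => FrameGravity.prolong U (FrameGravity.kerField i))) ∧
    -- all dimensions
    ∀ n : ℕ, 3 ≤ n →
      FrameGravity.IsRegularPresymplectic (FrameGravity.omegaM (n := n)) ∧
      ∀ U ≤ FrameGravity.body n, ∀ V : FrameGravity.Vec U,
        FrameGravity.iota V (FrameGravity.omegaM U) = 0 ↔
          V ∈ Submodule.span (FrameGravity.Fn U)
            {W | ∃ X : FrameGravity.TVec n, FrameGravity.IsRhoIndependent X ∧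
              FrameGravity.tIota X (FrameGravity.omegaT n) = 0 ∧
              W = FrameGravity.prolong U X} := by
  refine ⟨⟨FrameGravity.tIota_kerField, fun i j A => ?_, fun U hU V =>
    ⟨fun hV => ?_, FrameGravity.iota_of_mem_span ?_⟩⟩, fun n hn =>
    ⟨FrameGravity.regular_presymplectic hn, fun U hU V =>
      ⟨FrameGravity.mem_span_prolong hU, FrameGravity.iota_of_mem_span ?_⟩⟩⟩
  -- Each field annihilates the components of every other, so both sides are zero and the sign plays
  -- no role.
  · rw [FrameGravity.apply_kerField, FrameGravity.apply_kerField, smul_zero]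
  · refine Submodule.span_le.mpr ?_ (FrameGravity.mem_span_prolong hU hV)
    rintro _ ⟨X, hX, h, rfl⟩
    exact FrameGravity.prolong_mem_span
      (FrameGravity.mem_span_kerField hX (funext ((FrameGravity.tIota_omegaT_eq_zero_iff X).mp h)))
  · rintro _ ⟨i, rfl⟩
    exact FrameGravity.iota_prolong (FrameGravity.tIota_kerField i)
  · rintro _ ⟨X, -, hX, rfl⟩
    exact FrameGravity.iota_prolong hX
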